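/- For $t\in\mathbb R$ and $z\in\mathbb C$ let $$H_t(z)=\int_0^\infty e^{tu^2}\Phi(u)\cos(zu)\,du,\qquad \Phi(u)=\sum_{n=1}^\infty\left(2\pi^2n^4e^{9u}-3\pi n^2e^{5u}\right)\exp\left(-\pi n^2e^{4u}\right).$$ Let $\Lambda$ be the de Bruijn–Newman constant, that is, the infimum of the set of real $t$ such that all zeros of $H_t$ are real (by de Bruijn and Newman, $\Lambda$ is a real number and all zeros of $H_t$ are real if and only if $t\ge\Lambda$). Write $\log_+x=\log(2+|x|)$ and $\Psi(T)=\frac{T}{4\pi}\log\frac{T}{4\pi}-\frac{T}{4\pi}$, and for an interval $I\subset\mathbb R$ let $N_t(I)$ be the number of zeros of $H_t$ in $I$, each zero being counted once. Theorem 3.2 (Riemann–von Mangoldt type formulae). Assume $\Lambda<0$. (i) There is a constant $K$ such that for all $\Lambda<t\le0$ and all $T>0$, $H_t$ has only finitely many zeros in $[0,T]$ and $$\left|N_t([0,T])-\Psi(T)\right|\le K\log_+^2T.$$ (ii) For every $C>0$ there is a function $c=c_C:\mathbb R\to\mathbb R$ with $c(T)\to0$ as $T\to\infty$ such that for all $\Lambda<t\le0$,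 all $T>0$ and all $0\le\alpha\le C$, $$\left|N_t([T,T+\alpha\log_+T])-\frac{\alpha\log_+^2T}{4\pi}\right|\le c(T)\log_+^2T.$$ -/

import Mathlib

open Filter Topology

noncomputable section

namespace DeBruijnNewman

/-- The super-exponentially decaying function
`Φ(u) = ∑_{n ≥ 1} (2 π² n⁴ e^{9u} - 3 π n² e^{5u}) exp(-π n² e^{4u})`;
the summation index is shifted by one. -/
def Phi (u : ℝ) : ℝ :=
  ∑' n : ℕ, (2 * Real.pi ^ 2 * ((n : ℝ) + 1) ^ 4 * Real.exp (9 * u)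
      - 3 * Real.pi * ((n : ℝ) + 1) ^ 2 * Real.exp (5 * u))
    * Real.exp (-Real.pi * ((n : ℝ) + 1) ^ 2 * Real.exp (4 * u))

/-- De Bruijn's family of entire functions `H_t(z) = ∫₀^∞ e^{t u²} Φ(u) cos(z u) du`.
The integral converges absolutely for all real `t` and complex `z`. -/
def H (t : ℝ) (z : ℂ) : ℂ :=
  ∫ u in Set.Ioi (0 : ℝ),
    ((Real.exp (t * u ^ 2) * Phi u : ℝ) : ℂ) * Complex.cos (z * (u : ℂ))

/-- All zeros of `H_t` in the complex plane are real. -/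
def HasOnlyRealZeros (t : ℝ) : Prop :=
  ∀ z : ℂ, H t z = 0 → z.im = 0

/-- The de Bruijn–Newman constant: the infimum of the times `t` at which all zeros of `H_t` are
real. By theorems of de Bruijn and Newman this set of times is a closed half-line `[Λ, ∞)`, so that
`Λ` is the number for which all zeros of `H_t` are real if and only if `Λ ≤ t`. -/
def Lam : ℝ := sInf {t : ℝ | HasOnlyRealZeros t}

/-- The set of zeros of `H_t` in a set `I` of real numbers. -/
def zerosIn (t : ℝ) (I : Set ℝ) : Set ℝ :=
  {x : ℝ | x ∈ I ∧ H t (x : ℂ) = 0}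

/-- The number `N_t(I)` of zeros of `H_t` in `I` (a genuine count whenever there are finitely
many). -/
def N (t : ℝ) (I : Set ℝ) : ℕ := (zerosIn t I).ncard

/-- The modified logarithm `log₊ x = log (2 + |x|)`. -/
def logPlus (x : ℝ) : ℝ := Real.log (2 + |x|)

/-- The main term `Ψ(T) = (T/4π) log (T/4π) - T/4π`, used for `T > 0`. -/
def Psi (T : ℝ) : ℝ :=
  T / (4 * Real.pi) * Real.log (T / (4 * Real.pi)) - T / (4 * Real.pi)

end DeBruijnNewman

end

/-!
The function `w ↦ H_0(iw)` is `ζ((w + 1) / 2)` times a Gamma factor (`H_zero_eq`), so far to the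
right its logarithmic derivative is `¼ log (w / 4π)` up to a small error, by Stirling's formula.
Backward heat flow is a Gaussian average, `H_t(z) = E[H_0(z + τV)]` with `t = -τ²/2` after a
shift of the contour (`integral_gaussian_mul_H_zero`). When `Im z` is a large multiple of
`log |z|`, a shift to the saddle point shows that `H_t` has no zero there and that
`L_t = H_t'/H_t` has the same asymptotics as for `t = 0`, uniformly in `Λ < t ≤ 0`
(`exists_norm_logDeriv_H_sub_le`).

For `t > Λ` all zeros of `H_t` are real, by de Bruijn's theorem (`HasOnlyRealZeros.mono`), and
simple, because Laguerre's inequality would fail shortly before `t` at a multiple zero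
(`deriv_H_ne_zero`). Since `H_t` has order less than two, `L_t` has a partial fraction expansion
over the zeros `x_k`; in particular `-Im L_t(x + iy)` is the Poisson sum
`∑ y / ((x - x_k)² + y²)` (`SimplyRealRooted.hasSum_poisson`). Everything about the zeros is read
off from these sums at heights that are large multiples of `log T`, where `L_t` is known.

For the first formula, integrate the Poisson sum over `[0, T]` at height `Y`, a large multiple of
`log₊ T`. Each zero contributes `arctan ((T - x_k) / Y) + arctan (x_k / Y)`, which is `π` times
the indicator of `[0, T]` up to Poisson kernels and conjugate Poisson kernels at the two endpoints.
These add up to values of `L_t`, of size `log T`, times `Y`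
(`SimplyRealRooted.abs_pi_mul_ncard_sub_le`), so the error is `O(log² T)`.

For the second formula, rescale the zeros about a point near `T` by `ℓ = log₊ T`. The Poisson sums
at the heights `mℓ`, for all large fixed `m`, converge after division by `ℓ` to those of the
uniform measure with density `1/4π`. The number of zeros in a short interval follows by a
Tauberian argument of Karamata type: in the variable `q = m² / (p² + m²)` the Poisson kernels
become the functions `q / (1 + a q)`, whose linear combinations approximate `q` times any
continuous function uniformly (`tendsto_of_tendsto_resolventFn`), and the indicator of the interval
lies between two such functions of almost equal integral (`tendsto_N_div`). Uniformity in the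
length of the interval comes from monotonicity.
-/

noncomputable section

namespace DeBruijnNewman

open MeasureTheory Set

/-! ### The theta series and the evenness of `Φ` -/

/-- The `k`-th derivative of the theta series `∑_{n ≥ 1} exp (-π n² x)`, as a termwise
differentiated series; the summation index is shifted by one. -/
def thetaSeries (k : ℕ) (x : ℝ) : ℝ :=
  ∑' n : ℕ, (-(Real.pi * ((n : ℝ) + 1) ^ 2)) ^ k * Real.exp (-(Real.pi * ((n : ℝ) + 1) ^ 2) * x)

lemma summable_pow_mul_exp_neg_sq (k : ℕ) {δ : ℝ} (hδ : 0 < δ) :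
    Summable fun n : ℕ => (Real.pi * ((n : ℝ) + 1) ^ 2) ^ k *
      Real.exp (-(Real.pi * ((n : ℝ) + 1) ^ 2) * δ) := by
  have h0 := (Real.summable_pow_mul_exp_neg_nat_mul (2 * k) hδ)
  have h1 := ((summable_nat_add_iff 1).2 h0).mul_left (Real.pi ^ k)
  refine Summable.of_nonneg_of_le (fun n => by positivity) (fun n => ?_) h1
  have hpi : 1 ≤ Real.pi := by linarith [Real.pi_gt_three]
  have hn : (1 : ℝ) ≤ (n : ℝ) + 1 := by linarith [(Nat.cast_nonneg n : (0 : ℝ) ≤ n)]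
  have e : (Real.pi * ((n : ℝ) + 1) ^ 2) ^ k = Real.pi ^ k * ((n : ℝ) + 1) ^ (2 * k) := by
    rw [mul_pow, ← pow_mul]
  rw [e, mul_assoc]
  push_cast
  refine mul_le_mul_of_nonneg_left (mul_le_mul_of_nonneg_left (Real.exp_le_exp.2 ?_)
    (by positivity)) (by positivity)
  have : ((n : ℝ) + 1) ≤ Real.pi * ((n : ℝ) + 1) ^ 2 := by nlinarith
  linarith [mul_le_mul_of_nonneg_left this hδ.le]

lemma summable_thetaSeries (k : ℕ) {x : ℝ} (hx : 0 < x) :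
    Summable fun n : ℕ => (-(Real.pi * ((n : ℝ) + 1) ^ 2)) ^ k *
      Real.exp (-(Real.pi * ((n : ℝ) + 1) ^ 2) * x) := by
  refine Summable.of_norm ?_
  refine (summable_pow_mul_exp_neg_sq k hx).congr fun n => ?_
  have hp : 0 ≤ Real.pi * ((n : ℝ) + 1) ^ 2 := by positivity
  rw [norm_mul, norm_pow, norm_neg, Real.norm_of_nonneg hp, Real.norm_of_nonneg (Real.exp_pos _).le]

lemma hasDerivAt_thetaSeries (k : ℕ) {x : ℝ} (hx : 0 < x) :
    HasDerivAt (thetaSeries k) (thetaSeries (k + 1) x) x := by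
  unfold thetaSeries
  refine hasDerivAt_tsum_of_isPreconnected (𝕜 := ℝ) (F := ℝ)
    (g := fun (n : ℕ) x => (-(Real.pi * ((n : ℝ) + 1) ^ 2)) ^ k *
      Real.exp (-(Real.pi * ((n : ℝ) + 1) ^ 2) * x))
    (g' := fun (n : ℕ) x => (-(Real.pi * ((n : ℝ) + 1) ^ 2)) ^ (k + 1) *
      Real.exp (-(Real.pi * ((n : ℝ) + 1) ^ 2) * x))
    (t := Ioi (x / 2)) (y₀ := x) (y := x)
    (u := fun n : ℕ => (Real.pi * ((n : ℝ) + 1) ^ 2) ^ (k + 1) *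
      Real.exp (-(Real.pi * ((n : ℝ) + 1) ^ 2) * (x / 2)))
    (summable_pow_mul_exp_neg_sq (k + 1) (half_pos hx)) isOpen_Ioi isPreconnected_Ioi
    (fun n y hy => ?_) (fun n y hy => ?_) ?_ ?_ ?_
  · refine ((((hasDerivAt_id' y).const_mul (-(Real.pi * ((n : ℝ) + 1) ^ 2))).exp).const_mul
      ((-(Real.pi * ((n : ℝ) + 1) ^ 2)) ^ k)).congr_deriv ?_
    ring
  · have hp : 0 ≤ Real.pi * ((n : ℝ) + 1) ^ 2 := by positivity
    have hy' : x / 2 < y := hy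
    rw [norm_mul, norm_pow, norm_neg, Real.norm_of_nonneg hp,
      Real.norm_of_nonneg (Real.exp_pos _).le]
    refine mul_le_mul_of_nonneg_left (Real.exp_le_exp.2 ?_) (by positivity)
    linarith [mul_le_mul_of_nonneg_left hy'.le hp]
  · exact half_lt_self hx
  · exact summable_thetaSeries k hx
  · exact half_lt_self hx

lemma hasSum_Phi (u : ℝ) :
    HasSum (fun n : ℕ => (2 * Real.pi ^ 2 * ((n : ℝ) + 1) ^ 4 * Real.exp (9 * u)
      - 3 * Real.pi * ((n : ℝ) + 1) ^ 2 * Real.exp (5 * u))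
        * Real.exp (-Real.pi * ((n : ℝ) + 1) ^ 2 * Real.exp (4 * u)))
      (Real.exp u * (2 * Real.exp (4 * u) ^ 2 * thetaSeries 2 (Real.exp (4 * u))
        + 3 * Real.exp (4 * u) * thetaSeries 1 (Real.exp (4 * u)))) := by
  have h1 := (summable_thetaSeries 1 (Real.exp_pos (4 * u))).hasSum.mul_left (3 * Real.exp (4 * u))
  have h2 := (summable_thetaSeries 2 (Real.exp_pos (4 * u))).hasSum.mul_left
    (2 * Real.exp (4 * u) ^ 2)
  have h3 := (h2.add h1).mul_left (Real.exp u)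
  have e9 : Real.exp (9 * u) = Real.exp u * Real.exp (4 * u) ^ 2 := by
    rw [← Real.exp_nat_mul, ← Real.exp_add]; congr 1; push_cast; ring
  have e5 : Real.exp (5 * u) = Real.exp u * Real.exp (4 * u) := by
    rw [← Real.exp_add]; congr 1; ring
  refine Eq.mpr (congrArg (fun f => HasSum f _) (funext fun n => ?_)) h3
  rw [e9, e5, show -Real.pi * ((n : ℝ) + 1) ^ 2 = -(Real.pi * ((n : ℝ) + 1) ^ 2) by ring]
  ring

lemma Phi_eq_thetaSeries (u : ℝ) :
    Phi u = Real.exp u * (2 * Real.exp (4 * u) ^ 2 * thetaSeries 2 (Real.exp (4 * u))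
      + 3 * Real.exp (4 * u) * thetaSeries 1 (Real.exp (4 * u))) := (hasSum_Phi u).tsum_eq

lemma tsum_int_exp_eq_thetaSeries {x : ℝ} (hx : 0 < x) :
    ∑' n : ℤ, Real.exp (-Real.pi * x * (n : ℝ) ^ 2) = 1 + 2 * thetaSeries 0 x := by
  have hs : HasSum (fun n : ℕ => Real.exp (-(Real.pi * ((n : ℝ) + 1) ^ 2) * x))
      (thetaSeries 0 x) := by
    simpa [thetaSeries] using (summable_thetaSeries 0 hx).hasSum
  set f : ℤ → ℝ := fun n => Real.exp (-Real.pi * x * (n : ℝ) ^ 2) with hf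
  have h2 : HasSum (fun n : ℕ => f (-((n : ℤ) + 1))) (thetaSeries 0 x) := by
    convert hs using 2 with n
    change Real.exp _ = _
    congr 1
    push_cast
    ring
  have h3 : HasSum (fun n : ℕ => f ((n + 1 : ℕ) : ℤ)) (thetaSeries 0 x) := by
    convert hs using 2 with n
    change Real.exp _ = _
    congr 1
    push_cast
    ring
  have h1 := (hasSum_nat_add_iff (f := fun n : ℕ => f (n : ℤ)) 1).1 h3
  have h0 : f 0 = 1 := by simp [hf]
  rw [(HasSum.of_nat_of_neg_add_one h1 h2).tsum_eq, Finset.sum_range_one, Nat.cast_zero, h0]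
  ring

/-- The function `e^u (1 + 2 ∑_{n ≥ 1} exp (-π n² e^{4u}))`, which is even by the functional
equation of the theta function. -/
def evenTheta (u : ℝ) : ℝ := Real.exp u * (1 + 2 * thetaSeries 0 (Real.exp (4 * u)))

lemma evenTheta_neg (u : ℝ) : evenTheta (-u) = evenTheta u := by
  have h := Real.tsum_exp_neg_mul_int_sq (Real.exp_pos (4 * u))
  have h2 := tsum_int_exp_eq_thetaSeries (Real.exp_pos (4 * (-u)))
  have e : ∑' n : ℤ, Real.exp (-Real.pi / Real.exp (4 * u) * (n : ℝ) ^ 2)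
      = ∑' n : ℤ, Real.exp (-Real.pi * Real.exp (4 * (-u)) * (n : ℝ) ^ 2) := by
    refine tsum_congr fun n => ?_
    rw [mul_neg, Real.exp_neg, div_eq_mul_inv]
  rw [tsum_int_exp_eq_thetaSeries (Real.exp_pos _), e, h2, ← Real.exp_mul] at h
  unfold evenTheta
  rw [h, one_div, ← Real.exp_neg, ← mul_assoc, ← Real.exp_add]
  congr 2
  ring

lemma hasDerivAt_exp_four_mul (u : ℝ) :
    HasDerivAt (fun u => Real.exp (4 * u)) (4 * Real.exp (4 * u)) u := by
  refine (((hasDerivAt_id' u).const_mul (4 : ℝ)).exp).congr_deriv ?_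
  ring

lemma hasDerivAt_thetaSeries_exp (k : ℕ) (u : ℝ) :
    HasDerivAt (fun u => thetaSeries k (Real.exp (4 * u)))
      (thetaSeries (k + 1) (Real.exp (4 * u)) * (4 * Real.exp (4 * u))) u := by
  exact (hasDerivAt_thetaSeries k (Real.exp_pos (4 * u))).comp u (hasDerivAt_exp_four_mul u)

lemma deriv_evenTheta : deriv evenTheta = fun u => Real.exp u *
    (1 + 2 * thetaSeries 0 (Real.exp (4 * u))
      + 8 * (Real.exp (4 * u) * thetaSeries 1 (Real.exp (4 * u)))) := by
  ext u
  have h := (Real.hasDerivAt_exp u).mul (((hasDerivAt_thetaSeries_exp 0 u).const_mul 2).const_add 1)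
  refine (h.congr_deriv ?_).deriv
  ring

/-- `Φ` is a second order differential operator applied to the even theta function. -/
lemma deriv_deriv_evenTheta (u : ℝ) :
    deriv (deriv evenTheta) u = evenTheta u + 16 * Phi u := by
  rw [deriv_evenTheta]
  have h := (Real.hasDerivAt_exp u).mul
    ((((hasDerivAt_thetaSeries_exp 0 u).const_mul 2).const_add 1).add
      (((hasDerivAt_exp_four_mul u).mul (hasDerivAt_thetaSeries_exp 1 u)).const_mul 8))
  refine (h.congr_deriv ?_).deriv
  rw [Phi_eq_thetaSeries, evenTheta]
  simp only [Pi.add_apply, Pi.mul_apply]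
  ring

lemma Phi_neg (u : ℝ) : Phi (-u) = Phi u := by
  have h1 : (fun u => evenTheta (-u)) = evenTheta := funext evenTheta_neg
  have h2 : ∀ v, deriv evenTheta (-v) = -deriv evenTheta v := by
    intro v
    have := deriv_comp_neg evenTheta v
    rw [h1] at this
    rw [this, neg_neg]
  have h3 : deriv (deriv evenTheta) (-u) = deriv (deriv evenTheta) u := by
    have e := deriv_comp_neg (deriv evenTheta) u
    rw [funext h2, deriv.fun_neg] at e
    linarith
  rw [deriv_deriv_evenTheta, deriv_deriv_evenTheta, evenTheta_neg] at h3
  linarith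

lemma continuous_Phi : Continuous Phi := by
  have h : Phi = fun u => Real.exp u * (2 * Real.exp (4 * u) ^ 2 * thetaSeries 2 (Real.exp (4 * u))
      + 3 * Real.exp (4 * u) * thetaSeries 1 (Real.exp (4 * u))) := funext Phi_eq_thetaSeries
  rw [h]
  have hc : ∀ k, Continuous fun u : ℝ => thetaSeries k (Real.exp (4 * u)) := fun k =>
    continuous_iff_continuousAt.2 fun u => (hasDerivAt_thetaSeries_exp k u).continuousAt
  have h1 := hc 1
  have h2 := hc 2
  fun_prop

lemma Phi_abs (u : ℝ) : Phi |u| = Phi u := by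
  rcases abs_choice u with h | h <;> rw [h]
  exact Phi_neg u

lemma Phi_pos (u : ℝ) : 0 < Phi u := by
  rw [← Phi_abs]
  set v := |u|
  have hv : 0 ≤ v := abs_nonneg u
  have h45 : Real.exp (5 * v) ≤ Real.exp (9 * v) := Real.exp_le_exp.2 (by linarith)
  have hterm : ∀ n : ℕ, 0 < (2 * Real.pi ^ 2 * ((n : ℝ) + 1) ^ 4 * Real.exp (9 * v)
      - 3 * Real.pi * ((n : ℝ) + 1) ^ 2 * Real.exp (5 * v))
        * Real.exp (-Real.pi * ((n : ℝ) + 1) ^ 2 * Real.exp (4 * v)) := by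
    intro n
    refine mul_pos ?_ (Real.exp_pos _)
    have hn : (1 : ℝ) ≤ ((n : ℝ) + 1) ^ 2 := by
      have : (0 : ℝ) ≤ n := n.cast_nonneg
      nlinarith
    have hpi := Real.pi_gt_three
    have h2 : 3 < 2 * (Real.pi * ((n : ℝ) + 1) ^ 2) := by nlinarith
    have h3 : 3 * Real.exp (5 * v) < 2 * (Real.pi * ((n : ℝ) + 1) ^ 2) * Real.exp (9 * v) :=
      mul_lt_mul h2 h45 (Real.exp_pos _) (by linarith)
    have h4 : 0 < Real.pi * ((n : ℝ) + 1) ^ 2 := by positivity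
    nlinarith [mul_lt_mul_of_pos_left h3 h4]
  have h := hasSum_Phi v
  rw [← Phi_eq_thetaSeries] at h
  exact (hterm 0).trans_le (le_hasSum h 0 fun n _ => (hterm n).le)

/-- `Φ` decays faster than the exponential of any multiple of `|u|³`. -/
lemma exists_abs_Phi_le (M : ℝ) : ∃ C, ∀ u, |Phi u| ≤ C * Real.exp (-M * |u| ^ 3) := by
  have hs : Summable fun n : ℕ => (2 * Real.pi ^ 2 * ((n : ℝ) + 1) ^ 4 +
      3 * Real.pi * ((n : ℝ) + 1) ^ 2) * Real.exp (-(Real.pi * ((n : ℝ) + 1) ^ 2) * (1 / 2)) := by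
    refine (((summable_pow_mul_exp_neg_sq 2 one_half_pos).mul_left 2).add
      ((summable_pow_mul_exp_neg_sq 1 one_half_pos).mul_left 3)).congr fun n => ?_
    ring
  set S := ∑' n : ℕ, (2 * Real.pi ^ 2 * ((n : ℝ) + 1) ^ 4 +
      3 * Real.pi * ((n : ℝ) + 1) ^ 2) * Real.exp (-(Real.pi * ((n : ℝ) + 1) ^ 2) * (1 / 2))
  have hpi := Real.pi_gt_three
  have key : ∀ u : ℝ, 0 ≤ u → |Phi u| ≤ S * Real.exp (9 * u - Real.exp (4 * u)) := by
    intro u hu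
    have hX : 1 ≤ Real.exp (4 * u) := Real.one_le_exp (by positivity)
    unfold Phi S
    rw [← tsum_mul_right, ← Real.norm_eq_abs]
    refine tsum_of_norm_bounded (hs.mul_right _).hasSum fun n => ?_
    have hn : (1 : ℝ) ≤ ((n : ℝ) + 1) ^ 2 := by
      have : (0 : ℝ) ≤ n := n.cast_nonneg
      nlinarith
    rw [norm_mul, Real.norm_of_nonneg (Real.exp_pos _).le]
    have h59 : Real.exp (5 * u) ≤ Real.exp (9 * u) := Real.exp_le_exp.2 (by linarith)
    have hb : ‖2 * Real.pi ^ 2 * ((n : ℝ) + 1) ^ 4 * Real.exp (9 * u)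
        - 3 * Real.pi * ((n : ℝ) + 1) ^ 2 * Real.exp (5 * u)‖
        ≤ (2 * Real.pi ^ 2 * ((n : ℝ) + 1) ^ 4 + 3 * Real.pi * ((n : ℝ) + 1) ^ 2)
          * Real.exp (9 * u) := by
      refine (norm_sub_le _ _).trans ?_
      rw [Real.norm_of_nonneg (by positivity), Real.norm_of_nonneg (by positivity), add_mul]
      gcongr
    have he : Real.exp (-Real.pi * ((n : ℝ) + 1) ^ 2 * Real.exp (4 * u))
        ≤ Real.exp (-(Real.pi * ((n : ℝ) + 1) ^ 2) * (1 / 2)) * Real.exp (-Real.exp (4 * u)) := by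
      rw [← Real.exp_add]
      refine Real.exp_le_exp.2 ?_
      have h1 : ((n : ℝ) + 1) ^ 2 * (1 / 2) + Real.exp (4 * u) * (1 / 2)
          ≤ ((n : ℝ) + 1) ^ 2 * Real.exp (4 * u) := by nlinarith
      have h2 : Real.pi * (((n : ℝ) + 1) ^ 2 * (1 / 2) + Real.exp (4 * u) * (1 / 2))
          ≤ Real.pi * (((n : ℝ) + 1) ^ 2 * Real.exp (4 * u)) :=
        mul_le_mul_of_nonneg_left h1 (by linarith)
      nlinarith
    calc _ ≤ ((2 * Real.pi ^ 2 * ((n : ℝ) + 1) ^ 4 + 3 * Real.pi * ((n : ℝ) + 1) ^ 2)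
          * Real.exp (9 * u)) * (Real.exp (-(Real.pi * ((n : ℝ) + 1) ^ 2) * (1 / 2))
            * Real.exp (-Real.exp (4 * u))) := mul_le_mul hb he (Real.exp_pos _).le (by positivity)
      _ = _ := by rw [sub_eq_add_neg (9 * u), Real.exp_add]; ring
  have hS : 0 ≤ S := tsum_nonneg fun n => by positivity
  refine ⟨S * Real.exp (9 * (|M| + 9) + |M| * (|M| + 9) ^ 3), fun u => ?_⟩
  rw [← Phi_abs]
  refine (key _ (abs_nonneg u)).trans ?_
  rw [mul_assoc, ← Real.exp_add]
  gcongr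
  set v := |u|
  have hv : 0 ≤ v := abs_nonneg u
  -- `e^{4v} = (e^v)^4 ≥ (1 + v)^4` beats the cubic polynomial once `v` exceeds its coefficient
  have h4 : (1 + v) ^ 4 ≤ Real.exp (4 * v) := by
    have := Real.add_one_le_exp v
    have e : Real.exp (4 * v) = Real.exp v ^ 4 := by rw [← Real.exp_nat_mul]; norm_num
    rw [e]
    gcongr
    linarith
  have hM : M * v ^ 3 ≤ |M| * v ^ 3 := by gcongr; exact le_abs_self M
  have hA := abs_nonneg M
  have hpos : 0 ≤ |M| * (|M| + 9) ^ 3 := by positivity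
  have hpos' : 0 ≤ |M| * v ^ 3 := by positivity
  rcases le_total v (|M| + 9) with h | h
  · have h1 : |M| * v ^ 3 ≤ |M| * (|M| + 9) ^ 3 := by gcongr
    have := Real.exp_pos (4 * v)
    linarith
  · have h1 : (|M| + 9) * (1 + v) ^ 3 ≤ (1 + v) ^ 4 := by
      rw [show (1 + v) ^ 4 = (1 + v) * (1 + v) ^ 3 by ring]
      exact mul_le_mul_of_nonneg_right (by linarith) (by positivity)
    have h2 : v ^ 3 ≤ (1 + v) ^ 3 := by gcongr; linarith
    have h3 : v ≤ (1 + v) ^ 3 := by nlinarith [pow_nonneg hv 2, pow_nonneg hv 3]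
    have h4 : |M| * v ^ 3 ≤ |M| * (1 + v) ^ 3 := by gcongr
    linarith

/-! ### Fourier transforms of rapidly decaying weights -/

/-- A continuous weight on the line that decays faster than `exp (-M |u|³)` for every `M`. -/
structure IsRapid (W : ℝ → ℂ) : Prop where
  continuous : Continuous W
  decay : ∀ M : ℝ, ∃ C, ∀ u, ‖W u‖ ≤ C * Real.exp (-M * |u| ^ 3)

lemma sq_le_one_add_abs_pow_three (u : ℝ) : u ^ 2 ≤ 1 + |u| ^ 3 := by
  rw [← sq_abs]
  rcases le_total |u| 1 with h | h <;> nlinarith [abs_nonneg u, pow_nonneg (abs_nonneg u) 3,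
    pow_nonneg (abs_nonneg u) 2]

lemma IsRapid.mul {W g : ℝ → ℂ} (hW : IsRapid W) (hg : Continuous g) {A B : ℝ}
    (hgb : ∀ u, ‖g u‖ ≤ A * Real.exp (B * |u| ^ 3)) : IsRapid fun u => g u * W u := by
  refine ⟨hg.mul hW.continuous, fun M => ?_⟩
  obtain ⟨C, hC⟩ := hW.decay (M + B)
  refine ⟨A * C, fun u => ?_⟩
  rw [norm_mul]
  have h1 := hgb u
  have h2 := hC u
  calc ‖g u‖ * ‖W u‖ ≤ (A * Real.exp (B * |u| ^ 3)) * (C * Real.exp (-(M + B) * |u| ^ 3)) :=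
        mul_le_mul h1 h2 (norm_nonneg _) ((norm_nonneg _).trans h1)
    _ = A * C * (Real.exp (B * |u| ^ 3) * Real.exp (-(M + B) * |u| ^ 3)) := by ring
    _ = A * C * Real.exp (-M * |u| ^ 3) := by rw [← Real.exp_add]; ring_nf

lemma IsRapid.integrable {W : ℝ → ℂ} (hW : IsRapid W) : Integrable W := by
  obtain ⟨C, hC⟩ := hW.decay 1
  have hC0 : 0 ≤ C := by
    have := (norm_nonneg _).trans (hC 0)
    simpa using this
  refine Integrable.mono' ((integrable_exp_neg_mul_sq one_pos).const_mul (C * Real.exp 1))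
    hW.continuous.aestronglyMeasurable (Eventually.of_forall fun u => (hC u).trans ?_)
  rw [mul_assoc, ← Real.exp_add]
  gcongr
  linarith [sq_le_one_add_abs_pow_three u]

lemma norm_cexp_mul_le (p w : ℂ) {u r : ℝ} (hp : ‖p‖ ≤ r) (hw : ‖w‖ ≤ 1 + u ^ 2) :
    ‖Complex.exp (p * w)‖ ≤ Real.exp (2 * r) * Real.exp (r * |u| ^ 3) := by
  rw [Complex.norm_exp, ← Real.exp_add]
  refine Real.exp_le_exp.2 ((Complex.re_le_norm _).trans ?_)
  rw [norm_mul]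
  have h := sq_le_one_add_abs_pow_three u
  have hr : 0 ≤ r := (norm_nonneg p).trans hp
  calc ‖p‖ * ‖w‖ ≤ r * (1 + u ^ 2) := mul_le_mul hp hw (norm_nonneg _) hr
    _ ≤ r * (1 + (1 + |u| ^ 3)) := by gcongr
    _ = _ := by ring

lemma IsRapid.mul_cexp {W φ : ℝ → ℂ} (hW : IsRapid W) (hφ : Continuous φ)
    (hb : ∀ u, ‖φ u‖ ≤ 1 + u ^ 2) (p : ℂ) : IsRapid fun u => Complex.exp (p * φ u) * W u :=
  hW.mul (by fun_prop) fun u => norm_cexp_mul_le p (φ u) le_rfl (hb u)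

lemma IsRapid.mul_quad {W φ : ℝ → ℂ} (hW : IsRapid W) (hφ : Continuous φ)
    (hb : ∀ u, ‖φ u‖ ≤ 1 + u ^ 2) : IsRapid fun u => φ u * W u :=
  hW.mul (A := Real.exp 2) (B := 1) hφ fun u => by
    refine (hb u).trans ?_
    rw [← Real.exp_add]
    have h := sq_le_one_add_abs_pow_three u
    have := Real.add_one_le_exp (2 + 1 * |u| ^ 3)
    linarith

/-- Differentiation under the integral sign with respect to a complex parameter. -/
lemma IsRapid.hasDerivAt_integral {W φ : ℝ → ℂ} (hW : IsRapid W) (hφ : Continuous φ)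
    (hb : ∀ u, ‖φ u‖ ≤ 1 + u ^ 2) (p : ℂ) :
    HasDerivAt (fun p : ℂ => ∫ u, Complex.exp (p * φ u) * W u)
      (∫ u, Complex.exp (p * φ u) * (φ u * W u)) p := by
  have hφW := hW.mul_quad hφ hb
  set r := ‖p‖ + 1
  have hdom : IsRapid fun u : ℝ => (((Real.exp (2 * r) * Real.exp (r * |u| ^ 3) : ℝ)) : ℂ)
      * (φ u * W u) := by
    refine hφW.mul (A := Real.exp (2 * r)) (B := r) (by fun_prop) fun u => ?_
    rw [Complex.norm_real, Real.norm_of_nonneg (by positivity)]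
  refine (hasDerivAt_integral_of_dominated_loc_of_deriv_le (s := Metric.ball p 1)
    (F' := fun q u => Complex.exp (q * φ u) * (φ u * W u))
    (Metric.ball_mem_nhds p one_pos)
    (Eventually.of_forall fun q => (hW.mul_cexp hφ hb q).continuous.aestronglyMeasurable)
    (hW.mul_cexp hφ hb p).integrable
    (hφW.mul_cexp hφ hb p).continuous.aestronglyMeasurable
    (Eventually.of_forall fun u q hq => ?_) hdom.integrable.norm
    (Eventually.of_forall fun u q hq => ?_)).2
  · rw [norm_mul, norm_mul (Complex.ofReal _), Complex.norm_real, Real.norm_of_nonneg (by positivity)]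
    refine mul_le_mul_of_nonneg_right (norm_cexp_mul_le q _ ?_ (hb u)) (norm_nonneg _)
    have h1 : ‖q - p‖ < 1 := by simpa [dist_eq_norm] using hq
    have := norm_add_le (q - p) p
    rw [sub_add_cancel] at this
    linarith
  · refine (((hasDerivAt_id' q).mul_const (φ u)).cexp.mul_const (W u)).congr_deriv ?_
    ring

/-- The Fourier transform `∫ W(u) e^{izu} du` of a weight, as a function of complex `z`. -/
def fourierExp (W : ℝ → ℂ) (z : ℂ) : ℂ := ∫ u : ℝ, Complex.exp (z * (Complex.I * u)) * W u

lemma norm_I_mul_le (u : ℝ) : ‖Complex.I * (u : ℂ)‖ ≤ 1 + u ^ 2 := by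
  rw [norm_mul, Complex.norm_I, one_mul, Complex.norm_real, Real.norm_eq_abs, ← sq_abs]
  nlinarith [sq_nonneg (|u| - 1), abs_nonneg u]

lemma IsRapid.I_mul {W : ℝ → ℂ} (hW : IsRapid W) : IsRapid fun u => Complex.I * u * W u :=
  hW.mul_quad (by fun_prop) norm_I_mul_le

lemma IsRapid.mul_cexp_I {W : ℝ → ℂ} (hW : IsRapid W) (z : ℂ) :
    IsRapid fun u => Complex.exp (z * (Complex.I * u)) * W u :=
  hW.mul_cexp (φ := fun u => Complex.I * u) (by fun_prop) norm_I_mul_le z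

lemma IsRapid.hasDerivAt_fourierExp {W : ℝ → ℂ} (hW : IsRapid W) (z : ℂ) :
    HasDerivAt (fourierExp W) (fourierExp (fun u => Complex.I * u * W u) z) z :=
  hW.hasDerivAt_integral (φ := fun u => Complex.I * u) (by fun_prop) norm_I_mul_le z

lemma IsRapid.differentiable_fourierExp {W : ℝ → ℂ} (hW : IsRapid W) :
    Differentiable ℂ (fourierExp W) := fun z => (hW.hasDerivAt_fourierExp z).differentiableAt

lemma IsRapid.deriv_fourierExp {W : ℝ → ℂ} (hW : IsRapid W) :
    deriv (fourierExp W) = fourierExp fun u => Complex.I * u * W u :=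
  funext fun z => (hW.hasDerivAt_fourierExp z).deriv

/-- Young's inequality, giving order of growth `3/2` against cubic exponential decay. -/
lemma mul_le_rpow_add_pow {a b : ℝ} (ha : 0 ≤ a) (hb : 0 ≤ b) :
    a * b ≤ a ^ (3 / 2 : ℝ) + b ^ 3 := by
  have h32 : (0 : ℝ) ≤ a ^ (3 / 2 : ℝ) := Real.rpow_nonneg ha _
  have hs : a ^ (3 / 2 : ℝ) = a * √a := by
    rw [show (3 / 2 : ℝ) = 1 + 1 / 2 by norm_num, Real.rpow_add' ha (by norm_num), Real.rpow_one,
      Real.sqrt_eq_rpow]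
  rcases le_total b (√a) with h | h
  · have : a * b ≤ a * √a := by gcongr
    rw [hs]
    linarith [pow_nonneg hb 3]
  · have h1 : a ≤ b ^ 2 := by
      have := Real.sq_sqrt ha
      have : √a ^ 2 ≤ b ^ 2 := by gcongr
      linarith
    have : a * b ≤ b ^ 2 * b := by gcongr
    nlinarith

lemma IsRapid.exists_norm_fourierExp_le {W : ℝ → ℂ} (hW : IsRapid W) :
    ∃ C, 0 < C ∧ ∀ z, ‖fourierExp W z‖ ≤ C * Real.exp (C * ‖z‖ ^ (3 / 2 : ℝ)) := by
  have hdom : IsRapid fun u : ℝ => ((Real.exp (|u| ^ 3) : ℝ) : ℂ) * W u := by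
    refine hW.mul (A := 1) (B := 1) (by fun_prop) fun u => ?_
    rw [Complex.norm_real, Real.norm_of_nonneg (by positivity), one_mul, one_mul]
  set D := ∫ u, ‖((Real.exp (|u| ^ 3) : ℝ) : ℂ) * W u‖
  have hD : 0 ≤ D := integral_nonneg fun u => norm_nonneg _
  refine ⟨D + 1, by positivity, fun z => ?_⟩
  set m := ‖z‖ ^ (3 / 2 : ℝ)
  have hm : 0 ≤ m := by positivity
  have h1 : ‖fourierExp W z‖ ≤ ∫ u, Real.exp m * ‖((Real.exp (|u| ^ 3) : ℝ) : ℂ) * W u‖ := by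
    refine norm_integral_le_of_norm_le (hdom.integrable.norm.const_mul _)
      (Eventually.of_forall fun u => ?_)
    rw [norm_mul, norm_mul, Complex.norm_real, Real.norm_of_nonneg (Real.exp_pos _).le,
      ← mul_assoc (Real.exp m), ← Real.exp_add]
    refine mul_le_mul_of_nonneg_right ?_ (norm_nonneg _)
    rw [Complex.norm_exp]
    refine Real.exp_le_exp.2 ((Complex.re_le_norm _).trans ?_)
    rw [norm_mul, norm_mul, Complex.norm_I, one_mul, Complex.norm_real]
    exact mul_le_rpow_add_pow (norm_nonneg _) (abs_nonneg _)
  rw [integral_const_mul] at h1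
  refine h1.trans ?_
  have : Real.exp m ≤ Real.exp ((D + 1) * m) := Real.exp_le_exp.2 (by nlinarith)
  rw [mul_comm]
  gcongr
  linarith

lemma fourierExp_conj {W : ℝ → ℂ} (hW : ∀ u, W (-u) = (starRingEnd ℂ) (W u)) (z : ℂ) :
    fourierExp W ((starRingEnd ℂ) z) = (starRingEnd ℂ) (fourierExp W z) := by
  unfold fourierExp
  rw [← integral_conj, ← integral_neg_eq_self]
  congr 1
  ext u
  rw [map_mul, ← Complex.exp_conj, hW]
  simp

lemma fourierExp_neg {W : ℝ → ℂ} (hW : ∀ u, W (-u) = W u) (z : ℂ) :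
    fourierExp W (-z) = fourierExp W z := by
  unfold fourierExp
  rw [← integral_neg_eq_self]
  congr 1
  ext u
  rw [hW]
  simp

/-- The weight whose Fourier transform is `H_t`. -/
def weight (t : ℝ) (u : ℝ) : ℂ := Complex.exp (t * (u : ℂ) ^ 2) * (Phi u / 2 : ℝ)

lemma weight_neg (t u : ℝ) : weight t (-u) = weight t u := by
  simp [weight, Phi_neg]

lemma weight_conj (t u : ℝ) : (starRingEnd ℂ) (weight t u) = weight t u := by
  simp only [weight, map_mul, ← Complex.exp_conj, Complex.conj_ofReal, map_pow]

lemma isRapid_Phi : IsRapid fun u => ((Phi u / 2 : ℝ) : ℂ) := by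
  refine ⟨by have := continuous_Phi; fun_prop, fun M => ?_⟩
  obtain ⟨C, hC⟩ := exists_abs_Phi_le M
  refine ⟨C, fun u => ?_⟩
  rw [Complex.norm_real, norm_div, Real.norm_eq_abs]
  have := hC u
  have := abs_nonneg (Phi u)
  rw [Real.norm_of_nonneg (by norm_num : (0 : ℝ) ≤ 2)]
  linarith

lemma norm_sq_le (u : ℝ) : ‖(u : ℂ) ^ 2‖ ≤ 1 + u ^ 2 := by
  rw [norm_pow, Complex.norm_real, Real.norm_eq_abs, sq_abs]
  linarith

lemma isRapid_weight (t : ℝ) : IsRapid (weight t) :=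
  isRapid_Phi.mul_cexp (φ := fun u => (u : ℂ) ^ 2) (by fun_prop) norm_sq_le t

lemma H_eq_fourierExp (t : ℝ) (z : ℂ) : H t z = fourierExp (weight t) z := by
  have hi := ((isRapid_weight t).mul_cexp_I z).integrable
  have hi' := ((isRapid_weight t).mul_cexp_I (-z)).integrable
  unfold fourierExp H
  rw [← intervalIntegral.integral_Iic_add_Ioi hi.integrableOn hi.integrableOn (b := 0), ← neg_zero,
    ← integral_comp_neg_Ioi 0, neg_zero, ← integral_add]
  · refine integral_congr_ae (Eventually.of_forall fun u => ?_)
    simp only [Complex.cos, weight, Phi_neg]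
    push_cast
    ring_nf
  · refine (hi'.integrableOn (s := Ioi 0)).congr (Eventually.of_forall fun u => ?_)
    simp only [weight_neg]
    push_cast
    ring_nf
  · exact hi.integrableOn

lemma H_neg (t : ℝ) (z : ℂ) : H t (-z) = H t z := by
  rw [H_eq_fourierExp, H_eq_fourierExp, fourierExp_neg (weight_neg t)]

/-- Multiplication of the weight by `u²`-exponentials is differentiable in time, with values in
Fourier transforms. -/
lemma IsRapid.hasDerivAt_fourierExp_time {W : ℝ → ℂ} (hW : IsRapid W) (z : ℂ) (t : ℝ) :
    HasDerivAt (fun t : ℝ => fourierExp (fun u => Complex.exp (t * (u : ℂ) ^ 2) * W u) z)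
      (fourierExp (fun u => Complex.exp (t * (u : ℂ) ^ 2) * ((u : ℂ) ^ 2 * W u)) z) t := by
  have h := ((hW.mul_cexp_I z).hasDerivAt_integral (φ := fun u => (u : ℂ) ^ 2) (by fun_prop)
    norm_sq_le t).comp_ofReal
  unfold fourierExp
  convert h using 1
  · ext s
    congr 1
    ext u
    ring
  · congr 1
    ext u
    ring

/-! ### Partial fractions of the logarithmic derivative -/

lemma exists_eq_pow_mul {F : ℂ → ℂ} (hF : Differentiable ℂ F) {c : ℂ} (hc : F c ≠ 0) (x : ℂ) :
    ∃ (n : ℕ) (g : ℂ → ℂ), Differentiable ℂ g ∧ g x ≠ 0 ∧ ∀ z, F z = (z - x) ^ n * g z := by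
  have hA : ∀ {F : ℂ → ℂ}, Differentiable ℂ F → AnalyticOnNhd ℂ F univ := fun h =>
    Complex.analyticOnNhd_univ_iff_differentiable.2 h
  have htop : analyticOrderAt F x ≠ ⊤ := fun h => hc <| by
    have h0 := (hA hF).eqOn_zero_of_preconnected_of_eventuallyEq_zero isPreconnected_univ
      (mem_univ x) (analyticOrderAt_eq_top.1 h)
    exact h0 (mem_univ c)
  obtain ⟨n, hn⟩ := ENat.ne_top_iff_exists.1 htop
  clear htop
  induction n generalizing F c with
  | zero =>
    refine ⟨0, F, hF, ?_, by simp⟩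
    rw [Nat.cast_zero] at hn
    exact ((hA hF x (mem_univ x)).analyticOrderAt_eq_zero).1 hn.symm
  | succ n ih =>
    have hx : F x = 0 := by
      refine apply_eq_zero_of_analyticOrderAt_ne_zero ?_
      rw [← hn]
      exact_mod_cast Nat.succ_ne_zero n
    have hd : Differentiable ℂ (dslope F x) :=
      differentiableOn_univ.1 ((Complex.differentiableOn_dslope univ_mem).2 hF.differentiableOn)
    have hmul : ∀ z, F z = (z - x) * dslope F x z := fun z => by
      have := sub_smul_dslope F x z
      rw [hx, sub_zero, smul_eq_mul] at this
      exact this.symm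
    have hord : analyticOrderAt F x = 1 + analyticOrderAt (dslope F x) x := by
      have e : F = (fun z => z - x) * dslope F x := funext hmul
      conv_lhs => rw [e]
      rw [analyticOrderAt_mul (by fun_prop) (hA hd x (mem_univ x))]
      congr 1
      have h1 : AnalyticAt ℂ (fun z : ℂ => z - x) x := by fun_prop
      rw [show (1 : ℕ∞) = ((1 : ℕ) : ℕ∞) by simp, h1.analyticOrderAt_eq_natCast]
      exact ⟨fun _ => 1, analyticAt_const, one_ne_zero, Eventually.of_forall fun z => by simp⟩
    have hn' : (n : ℕ∞) = analyticOrderAt (dslope F x) x := by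
      rw [hord, Nat.cast_succ, add_comm] at hn
      generalize analyticOrderAt (dslope F x) x = a at hn ⊢
      cases a using ENat.recTopCoe with
      | top => simp at hn
      | coe a =>
        have h : 1 + n = 1 + a := by exact_mod_cast hn
        exact_mod_cast Nat.add_left_cancel h
    obtain ⟨k, g, hg, hgx, hk⟩ := ih hd (c := c)
      (fun h => hc (by rw [hmul, h, mul_zero])) hn'
    exact ⟨k + 1, g, hg, hgx, fun z => by rw [hmul, hk, pow_succ]; ring⟩

lemma finite_zeros_closedBall {F : ℂ → ℂ} (hF : Differentiable ℂ F) {c : ℂ} (hc : F c ≠ 0)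
    (R : ℝ) : {z | F z = 0 ∧ z ∈ Metric.closedBall c R}.Finite := by
  by_contra h
  obtain ⟨x, -, hx⟩ := Set.Infinite.exists_accPt_of_subset_isCompact h
    (isCompact_closedBall c R) fun z hz => hz.2
  have hfr : ∃ᶠ z in 𝓝[≠] x, F z = 0 := by
    rw [accPt_iff_frequently_nhdsNE] at hx
    exact hx.mono fun z hz => hz.1
  have h0 := (Complex.analyticOnNhd_univ_iff_differentiable.2 hF).eqOn_zero_of_preconnected_of_frequently_eq_zero
    isPreconnected_univ (mem_univ x) hfr
  exact hc (h0 (mem_univ c))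

/-- `F = ∏_{x ∈ Z} (z - x) · g` splits off all zeros of `F` in the closed disc of radius `R`
about `c`, with multiplicity. -/
structure ZeroFactorization (F : ℂ → ℂ) (c : ℂ) (R : ℝ) (Z : Multiset ℂ) (g : ℂ → ℂ) : Prop where
  differentiable : Differentiable ℂ g
  eq_mul : ∀ z, F z = (Z.map fun x => z - x).prod * g z
  mem_closedBall : ∀ x ∈ Z, x ∈ Metric.closedBall c R
  ne_zero : ∀ z ∈ Metric.closedBall c R, g z ≠ 0

lemma exists_zeroFactorization {F : ℂ → ℂ} (hF : Differentiable ℂ F) {c : ℂ} (hc : F c ≠ 0)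
    (R : ℝ) : ∃ Z g, ZeroFactorization F c R Z g := by
  have key : ∀ S : Finset ℂ, (∀ x ∈ S, x ∈ Metric.closedBall c R) →
      ∃ (Z : Multiset ℂ) (g : ℂ → ℂ), Differentiable ℂ g ∧
        (∀ z, F z = (Z.map fun x => z - x).prod * g z) ∧
        (∀ x ∈ Z, x ∈ Metric.closedBall c R) ∧ ∀ x ∈ S, g x ≠ 0 := by
    intro S
    induction S using Finset.induction_on with
    | empty => exact fun _ => ⟨0, F, hF, by simp, by simp, by simp⟩
    | insert x S hx ih =>
      intro hS
      obtain ⟨Z, g, hg, hm, hZ, hgS⟩ := ih fun y hy => hS y (Finset.mem_insert_of_mem hy)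
      have hgc : g c ≠ 0 := fun h => hc (by rw [hm, h, mul_zero])
      obtain ⟨n, g', hg', hgx, hn⟩ := exists_eq_pow_mul hg hgc x
      refine ⟨Z + Multiset.replicate n x, g', hg', fun z => ?_, fun y hy => ?_, fun y hy => ?_⟩
      · rw [hm, hn, Multiset.map_add, Multiset.prod_add, Multiset.map_replicate,
          Multiset.prod_replicate, mul_assoc]
      · rcases Multiset.mem_add.1 hy with h | h
        · exact hZ y h
        · rw [Multiset.eq_of_mem_replicate h]
          exact hS x (Finset.mem_insert_self _ _)
      · rcases Finset.mem_insert.1 hy with rfl | h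
        · exact hgx
        · intro h0
          exact hgS y h (by rw [hn, h0, mul_zero])
  obtain ⟨Z, g, hg, hm, hZ, hgS⟩ := key (finite_zeros_closedBall hF hc R).toFinset
    fun x hx => ((Set.Finite.mem_toFinset _).1 hx).2
  refine ⟨Z, g, hg, hm, hZ, fun z hz h => hgS z ?_ h⟩
  rw [Set.Finite.mem_toFinset]
  exact ⟨by rw [hm, h, mul_zero], hz⟩

lemma hasDerivAt_multiset_prod (Z : Multiset ℂ) {z : ℂ} (hz : ∀ x ∈ Z, z ≠ x) :
    HasDerivAt (fun z => (Z.map fun x => z - x).prod)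
      ((Z.map fun x => z - x).prod * (Z.map fun x => 1 / (z - x)).sum) z := by
  induction Z using Multiset.induction_on with
  | empty => simpa using hasDerivAt_const z (1 : ℂ)
  | cons a Z ih =>
    have h := ((hasDerivAt_id' z).sub_const a).mul (ih fun x hx => hz x (Multiset.mem_cons_of_mem hx))
    have ha : z - a ≠ 0 := sub_ne_zero.2 (hz a (Multiset.mem_cons_self a Z))
    simp only [Multiset.map_cons, Multiset.prod_cons, Multiset.sum_cons]
    refine h.congr_deriv ?_
    field_simp

lemma ZeroFactorization.logDeriv_eq {F : ℂ → ℂ} {c : ℂ} {R : ℝ} {Z : Multiset ℂ} {g : ℂ → ℂ}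
    (h : ZeroFactorization F c R Z g) {z : ℂ} (hz : F z ≠ 0) :
    logDeriv F z = (Z.map fun x => 1 / (z - x)).sum + logDeriv g z := by
  have h0 := hz
  rw [h.eq_mul] at h0
  have hP := left_ne_zero_of_mul h0
  have hg := right_ne_zero_of_mul h0
  have hne : ∀ x ∈ Z, z ≠ x := by
    rintro x hx rfl
    refine hP (Multiset.prod_eq_zero ?_)
    exact Multiset.mem_map.2 ⟨z, hx, sub_self z⟩
  have hd := (hasDerivAt_multiset_prod Z hne).mul (h.differentiable z).hasDerivAt
  have e : F = (fun z => (Z.map fun x => z - x).prod) * g := funext h.eq_mul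
  rw [logDeriv_apply, logDeriv_apply, e, hd.deriv, Pi.mul_apply]
  field_simp

/-- The cofactor inherits the growth of `F`, because each linear factor is larger on the circle of
radius `2R` than at the centre. -/
lemma ZeroFactorization.norm_cofactor_le {F : ℂ → ℂ} {c : ℂ} {R : ℝ} {Z : Multiset ℂ} {g : ℂ → ℂ}
    (h : ZeroFactorization F c R Z g) (hc : F c ≠ 0) (hR : 0 < R) {M : ℝ}
    (hM : ∀ z ∈ Metric.closedBall c (2 * R), ‖F z‖ ≤ M * ‖F c‖) :
    ∀ z ∈ Metric.closedBall c (2 * R), ‖g z‖ ≤ M * ‖g c‖ := by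
  have hfr : ∀ z ∈ frontier (Metric.ball c (2 * R)), ‖g z‖ ≤ M * ‖g c‖ := by
    intro z hz
    rw [frontier_ball c (by positivity)] at hz
    have hz2 : ‖z - c‖ = 2 * R := by simpa [dist_eq_norm] using hz
    have hB : ‖(Z.map fun x => c - x).prod‖ ≤ ‖(Z.map fun x => z - x).prod‖ := by
      have hZ := h.mem_closedBall
      clear * - hZ hz2
      induction Z using Multiset.induction_on with
      | empty => simp
      | cons a Z ih =>
        simp only [Multiset.map_cons, Multiset.prod_cons, norm_mul]
        refine mul_le_mul ?_ (ih fun x hx => hZ x (Multiset.mem_cons_of_mem hx)) (norm_nonneg _)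
          (norm_nonneg _)
        have ha : ‖a - c‖ ≤ R := by
          simpa [dist_eq_norm] using hZ a (Multiset.mem_cons_self a Z)
        have h1 := norm_sub_norm_le (z - c) (a - c)
        rw [sub_sub_sub_cancel_right] at h1
        rw [norm_sub_rev c a]
        linarith
    have hFz := hM z (Metric.sphere_subset_closedBall hz)
    rw [h.eq_mul, h.eq_mul c, norm_mul, norm_mul] at hFz
    have hBc : 0 < ‖(Z.map fun x => c - x).prod‖ := by
      rw [h.eq_mul] at hc
      exact norm_pos_iff.2 (left_ne_zero_of_mul hc)
    refine le_of_mul_le_mul_left ?_ hBc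
    calc _ ≤ ‖(Z.map fun x => z - x).prod‖ * ‖g z‖ := by gcongr
      _ ≤ _ := by rw [mul_left_comm]; exact hFz
  intro z hz
  refine Complex.norm_le_of_forall_mem_frontier_norm_le Metric.isBounded_ball
    h.differentiable.diffContOnCl hfr ?_
  rwa [closure_ball c (by positivity)]

/-- A zero-free function on a disc of radius `R` with `log |g / g(c)| ≤ m` has a logarithmic
derivative with derivative `O(m / R²)` near the centre, by Borel–Carathéodory and Cauchy. -/
lemma norm_logDeriv_sub_le {g : ℂ → ℂ} {c : ℂ} {R m : ℝ} (hR : 0 < R) (hm : 0 < m)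
    (hg : DifferentiableOn ℂ g (Metric.ball c R)) (hg0 : ∀ z ∈ Metric.ball c R, g z ≠ 0)
    (hgm : ∀ z ∈ Metric.ball c R, ‖g z‖ ≤ Real.exp m * ‖g c‖) {z z' : ℂ}
    (hz : z ∈ Metric.ball c (R / 4)) (hz' : z' ∈ Metric.ball c (R / 4)) :
    ‖logDeriv g z - logDeriv g z'‖ ≤ 128 * m / R ^ 2 * ‖z - z'‖ := by
  have hcR : c ∈ Metric.ball c R := Metric.mem_ball_self hR
  have hld : DifferentiableOn ℂ (logDeriv g) (Metric.ball c R) :=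
    (hg.deriv Metric.isOpen_ball).div hg hg0
  obtain ⟨l₀, hl₀⟩ := hld.isExactOn_ball
  set l : ℂ → ℂ := fun z => l₀ z - l₀ c with hl
  have hld' : ∀ z ∈ Metric.ball c R, HasDerivAt l (logDeriv g z) z := fun z hz =>
    (hl₀ z hz).sub_const _
  have hlc : l c = 0 := sub_self _
  have hexp : ∀ z ∈ Metric.ball c R, g z = g c * Complex.exp (l z) := by
    have hder : ∀ z ∈ Metric.ball c R,
        HasDerivAt (fun z => g z * Complex.exp (-l z)) 0 z := by
      intro z hz
      have h1 := (hg.differentiableAt (Metric.isOpen_ball.mem_nhds hz)).hasDerivAt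
      refine (h1.mul (hld' z hz).neg.cexp).congr_deriv ?_
      rw [logDeriv_apply]
      have := hg0 z hz
      field_simp
      ring
    intro z hz
    have := Metric.isOpen_ball.is_const_of_deriv_eq_zero (convex_ball c R).isPreconnected
      (fun z hz => (hder z hz).differentiableAt.differentiableWithinAt)
      (fun z hz => (hder z hz).deriv) hz hcR
    simp only [hlc, neg_zero, Complex.exp_zero, mul_one] at this
    rw [← this, mul_assoc, ← Complex.exp_add, neg_add_cancel, Complex.exp_zero, mul_one]
  have hre : ∀ z ∈ Metric.ball c R, (l z).re ≤ m := by
    intro z hz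
    have h1 := hgm z hz
    rw [hexp z hz, norm_mul, Complex.norm_exp, mul_comm] at h1
    exact Real.exp_le_exp.1 (le_of_mul_le_mul_right h1 (norm_pos_iff.2 (hg0 c hcR)))
  have hbc : ∀ z ∈ Metric.closedBall c (R / 2), ‖l z‖ ≤ 2 * m := by
    intro z hz
    have hz1 : ‖z - c‖ ≤ R / 2 := by simpa [dist_eq_norm] using hz
    have hmap : ∀ w ∈ Metric.ball (0 : ℂ) R, c + w ∈ Metric.ball c R := by
      intro w hw
      simpa [dist_eq_norm] using hw
    have h := Complex.borelCaratheodory_zero (f := fun w => l (c + w)) (M := m) (R := R)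
      (z := z - c) hm (fun w hw => ((hld' _ (hmap w hw)).comp_const_add c
        w).differentiableAt.differentiableWithinAt)
      (fun w hw => hre _ (hmap w hw)) hR (by
        rw [mem_ball_zero_iff]; linarith) (by simp [hlc])
    simp only [add_sub_cancel] at h
    refine h.trans ?_
    rw [div_le_iff₀ (by linarith)]
    nlinarith
  have hl1 : ∀ z ∈ Metric.closedBall c (3 * R / 8), ‖logDeriv g z‖ ≤ 16 * m / R := by
    intro z hz
    have hz1 : dist z c ≤ 3 * R / 8 := hz
    have h := Complex.norm_deriv_le_of_forall_mem_sphere_norm_le (c := z) (R := R / 8) (f := l)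
      (C := 2 * m) (by positivity) ?_ fun w hw => hbc w ?_
    · rw [(hld' z (by rw [Metric.mem_ball]; linarith)).deriv] at h
      refine h.trans (le_of_eq ?_)
      field_simp
      ring
    · refine DifferentiableOn.diffContOnCl (s := Metric.ball z (R / 8)) fun w hw => ?_
      rw [closure_ball z (by positivity)] at hw
      refine (hld' w ?_).differentiableAt.differentiableWithinAt
      rw [Metric.mem_closedBall] at hw
      rw [Metric.mem_ball]
      linarith [dist_triangle w z c]
    · rw [Metric.mem_sphere] at hw
      rw [Metric.mem_closedBall]
      linarith [dist_triangle w z c]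
  have hl2 : ∀ z ∈ Metric.ball c (R / 4), ‖deriv (logDeriv g) z‖ ≤ 128 * m / R ^ 2 := by
    intro z hz
    have hz1 : dist z c < R / 4 := hz
    have h := Complex.norm_deriv_le_of_forall_mem_sphere_norm_le (c := z) (R := R / 8)
      (f := logDeriv g) (C := 16 * m / R) (by positivity) ?_ fun w hw => hl1 w ?_
    · refine h.trans (le_of_eq ?_)
      field_simp
      ring
    · refine DifferentiableOn.diffContOnCl (s := Metric.ball z (R / 8)) (hld.mono ?_)
      rw [closure_ball z (by positivity)]
      intro w hw
      rw [Metric.mem_closedBall] at hw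
      rw [Metric.mem_ball]
      linarith [dist_triangle w z c]
    · rw [Metric.mem_sphere] at hw
      rw [Metric.mem_closedBall]
      linarith [dist_triangle w z c]
  refine Convex.norm_image_sub_le_of_norm_deriv_le (s := Metric.ball c (R / 4)) (fun w hw => ?_) hl2
    (convex_ball c _) hz' hz
  refine hld.differentiableAt (Metric.isOpen_ball.mem_nhds ?_)
  rw [Metric.mem_ball] at hw ⊢
  linarith

/-- Growth of order at most `3/2` (and finite type). -/
def HasGrowth (F : ℂ → ℂ) : Prop :=
  ∃ C, 0 < C ∧ ∀ z, ‖F z‖ ≤ C * Real.exp (C * ‖z‖ ^ (3 / 2 : ℝ))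

lemma tendsto_growth_div_sq (A B D : ℝ) :
    Tendsto (fun R : ℝ => 128 * (A + B * (3 * R) ^ (3 / 2 : ℝ)) / R ^ 2 * D) atTop (𝓝 0) := by
  have h1 : Tendsto (fun R : ℝ => R ^ (-(2 : ℝ))) atTop (𝓝 0) := tendsto_rpow_neg_atTop two_pos
  have h2 : Tendsto (fun R : ℝ => R ^ (-(1 / 2 : ℝ))) atTop (𝓝 0) :=
    tendsto_rpow_neg_atTop one_half_pos
  have h3 := ((h1.const_mul A).add (h2.const_mul (B * 3 ^ (3 / 2 : ℝ)))).const_mul (128 * D)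
  simp only [mul_zero, add_zero] at h3
  refine h3.congr' ?_
  filter_upwards [eventually_gt_atTop 0] with R hR
  rw [Real.mul_rpow (by norm_num) hR.le, show (-(1 / 2) : ℝ) = 3 / 2 - 2 by norm_num,
    Real.rpow_sub hR, Real.rpow_neg hR.le]
  simp only [Real.rpow_ofNat]
  field_simp

/-- **Hadamard's partial fraction expansion** for entire functions of order less than two: the
difference of two values of `F'/F` is the limit of the sums over the zeros in large discs. -/
theorem exists_forall_norm_logDeriv_sub_le {F : ℂ → ℂ} (hF : HasGrowth F) {c : ℂ} (hc : F c ≠ 0)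
    {z z' : ℂ} (hz : F z ≠ 0) (hz' : F z' ≠ 0) {ε : ℝ} (hε : 0 < ε) :
    ∃ R₀, ∀ R ≥ R₀, ∀ Z g, ZeroFactorization F c R Z g →
      ‖logDeriv F z - logDeriv F z' - (Z.map fun x => 1 / (z - x) - 1 / (z' - x)).sum‖ ≤ ε := by
  obtain ⟨C, hC, hFC⟩ := hF
  have hFc : 0 < ‖F c‖ := norm_pos_iff.2 hc
  set A := |Real.log (C / ‖F c‖)| + 1
  have hlim := (tendsto_growth_div_sq A C ‖z - z'‖).eventually (ge_mem_nhds hε)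
  have hall := (hlim.and ((eventually_ge_atTop ‖c‖).and ((eventually_gt_atTop 0).and
    ((eventually_gt_atTop (4 * dist z c)).and (eventually_gt_atTop (4 * dist z' c))))))
  obtain ⟨R₀, hR₀⟩ := eventually_atTop.1 hall
  refine ⟨R₀, fun R hR Z g hfac => ?_⟩
  obtain ⟨h1, h2, h3, h4, h5⟩ := hR₀ R hR
  have e : logDeriv F z - logDeriv F z' - (Z.map fun x => 1 / (z - x) - 1 / (z' - x)).sum
      = logDeriv g z - logDeriv g z' := by
    rw [hfac.logDeriv_eq hz, hfac.logDeriv_eq hz', Multiset.sum_map_sub]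
    ring
  rw [e]
  -- on the disc of radius `2R` the cofactor grows like `exp (O(R ^ (3/2)))`, so its logarithmic
  -- derivative varies by `O(R ^ (-1/2))` near the centre
  have hbound := hfac.norm_cofactor_le hc h3
    (M := Real.exp (A + C * (3 * R) ^ (3 / 2 : ℝ))) fun w hw => by
      have hw1 : ‖w‖ ≤ 3 * R := by
        have : ‖w - c‖ ≤ 2 * R := by simpa [dist_eq_norm] using hw
        have := norm_add_le (w - c) c
        rw [sub_add_cancel] at this
        linarith
      refine (hFC w).trans ?_
      have hA : C / ‖F c‖ ≤ Real.exp A := by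
        rw [← Real.log_le_iff_le_exp (by positivity)]
        linarith [le_abs_self (Real.log (C / ‖F c‖))]
      rw [div_le_iff₀ hFc] at hA
      rw [Real.exp_add]
      calc C * Real.exp (C * ‖w‖ ^ (3 / 2 : ℝ))
          ≤ (Real.exp A * ‖F c‖) * Real.exp (C * (3 * R) ^ (3 / 2 : ℝ)) := by gcongr
        _ = _ := by ring
  have hpos : 0 ≤ (3 * R) ^ (3 / 2 : ℝ) := by positivity
  have hsub : Metric.ball c R ⊆ Metric.closedBall c (2 * R) := fun w hw => by
    rw [Metric.mem_ball] at hw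
    rw [Metric.mem_closedBall]
    linarith
  refine (norm_logDeriv_sub_le h3 (by positivity) hfac.differentiable.differentiableOn
    (fun w hw => hfac.ne_zero w (Metric.ball_subset_closedBall hw))
    (fun w hw => hbound w (hsub hw)) ?_ ?_).trans h1
  · rw [Metric.mem_ball]; linarith
  · rw [Metric.mem_ball]; linarith

/-! ### Real entire functions with only real zeros -/

/-- An entire function of order less than two that is real on the real line and has only real
zeros. -/
structure RealRooted (F : ℂ → ℂ) : Prop where
  differentiable : Differentiable ℂ F
  growth : HasGrowth F
  conj : ∀ z, F ((starRingEnd ℂ) z) = (starRingEnd ℂ) (F z)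
  im_eq_zero : ∀ z, F z = 0 → z.im = 0

namespace RealRooted

lemma ne_zero {F : ℂ → ℂ} (hF : RealRooted F) {z : ℂ} (hz : z.im ≠ 0) : F z ≠ 0 :=
  fun h => hz (hF.im_eq_zero z h)

lemma deriv_conj {F : ℂ → ℂ} (hF : RealRooted F) (z : ℂ) :
    deriv F ((starRingEnd ℂ) z) = (starRingEnd ℂ) (deriv F z) := by
  have e : (starRingEnd ℂ) ∘ F ∘ (starRingEnd ℂ) = F := by
    ext z
    simp [hF.conj]
  have h := congrFun (deriv_conj_conj (𝕜 := ℂ) (f := F)) ((starRingEnd ℂ) z)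
  rw [e, Function.comp_apply, Function.comp_apply, Complex.conj_conj] at h
  exact h

lemma im_ofReal {F : ℂ → ℂ} (hF : RealRooted F) (x : ℝ) : (F x).im = 0 := by
  have h := hF.conj x
  rw [Complex.conj_ofReal] at h
  exact Complex.conj_eq_iff_im.1 h.symm

lemma logDeriv_conj {F : ℂ → ℂ} (hF : RealRooted F) (z : ℂ) :
    logDeriv F ((starRingEnd ℂ) z) = (starRingEnd ℂ) (logDeriv F z) := by
  rw [logDeriv_apply, logDeriv_apply, hF.deriv_conj, hF.conj, map_div₀]

end RealRooted

lemma im_one_div_sub (z : ℂ) (x : ℝ) :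
    (1 / (z - x)).im = -(z.im / ((x - z.re) ^ 2 + z.im ^ 2)) := by
  rw [one_div, Complex.inv_im, Complex.normSq_apply]
  simp only [Complex.sub_re, Complex.sub_im, Complex.ofReal_re, Complex.ofReal_im, sub_zero]
  rw [neg_div]
  congr 2
  ring

lemma ZeroFactorization.apply_eq_zero {F : ℂ → ℂ} {c : ℂ} {R : ℝ} {Z : Multiset ℂ} {g : ℂ → ℂ}
    (h : ZeroFactorization F c R Z g) {x : ℂ} (hx : x ∈ Z) : F x = 0 := by
  rw [h.eq_mul, Multiset.prod_eq_zero (Multiset.mem_map.2 ⟨x, hx, sub_self x⟩), zero_mul]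

lemma ZeroFactorization.mem_of_apply_eq_zero {F : ℂ → ℂ} {c : ℂ} {R : ℝ} {Z : Multiset ℂ}
    {g : ℂ → ℂ} (h : ZeroFactorization F c R Z g) {x : ℂ} (hx : F x = 0)
    (hxc : x ∈ Metric.closedBall c R) : x ∈ Z := by
  rw [h.eq_mul] at hx
  have := (mul_eq_zero.1 hx).resolve_right (h.ne_zero x hxc)
  obtain ⟨y, hy, hy'⟩ := Multiset.mem_map.1 (Multiset.prod_eq_zero_iff.1 this)
  rwa [sub_eq_zero.1 hy']

namespace RealRooted

lemma I_ne_zero {F : ℂ → ℂ} (hF : RealRooted F) : F Complex.I ≠ 0 := hF.ne_zero (by simp)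

/-- `F'/F` maps the upper half plane to the closed lower half plane; each zero contributes a
Poisson kernel. -/
lemma im_logDeriv_le {F : ℂ → ℂ} (hF : RealRooted F) {z : ℂ} (hz : 0 < z.im) (S : Multiset ℝ)
    (hS : S = 0 ∨ ∃ x : ℝ, F x = 0 ∧ S = {x}) :
    (logDeriv F z).im ≤ -(S.map fun x => z.im / ((x - z.re) ^ 2 + z.im ^ 2)).sum := by
  refine le_of_forall_pos_le_add fun ε hε => ?_
  have hz1 : F z ≠ 0 := hF.ne_zero hz.ne'
  have hz2 : F ((starRingEnd ℂ) z) ≠ 0 := hF.ne_zero (by simp [hz.ne'])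
  obtain ⟨R₀, hR₀⟩ := exists_forall_norm_logDeriv_sub_le hF.growth hF.I_ne_zero hz1 hz2 hε
  set x₀ : ℂ := (S.map fun x : ℝ => (x : ℂ)).sum with hx₀
  set R := max R₀ (dist x₀ Complex.I)
  obtain ⟨Z, g, hfac⟩ := exists_zeroFactorization hF.differentiable hF.I_ne_zero R
  have h := hR₀ R (le_max_left _ _) Z g hfac
  rw [hF.logDeriv_conj] at h
  have h' := (Complex.abs_im_le_norm _).trans h
  have hterm : ∀ x ∈ Z, (1 / (z - x) - 1 / ((starRingEnd ℂ) z - x)).im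
      = -(2 * (z.im / ((x.re - z.re) ^ 2 + z.im ^ 2))) := by
    intro x hx
    have hxr : x = (x.re : ℂ) := by
      apply Complex.ext
      · simp
      · simpa using hF.im_eq_zero x (hfac.apply_eq_zero hx)
    rw [hxr, Complex.sub_im, im_one_div_sub, im_one_div_sub]
    simp only [Complex.conj_re, Complex.conj_im, Complex.ofReal_re]
    ring
  have hsum : ((Z.map fun x => 1 / (z - x) - 1 / ((starRingEnd ℂ) z - x)).sum).im
      = -(2 * (Z.map fun x => z.im / ((x.re - z.re) ^ 2 + z.im ^ 2)).sum) := by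
    have e : ∀ Z : Multiset ℂ, (Z.sum).im = (Z.map Complex.im).sum := fun Z =>
      map_multiset_sum Complex.imAddGroupHom Z
    rw [e, Multiset.map_map, ← Multiset.sum_map_mul_left, ← Multiset.sum_map_neg']
    rw [Multiset.map_map]
    exact congrArg Multiset.sum (Multiset.map_congr rfl hterm)
  have hnn : ∀ Z : Multiset ℂ,
      0 ≤ (Z.map fun x => z.im / ((x.re - z.re) ^ 2 + z.im ^ 2)).sum := by
    intro Z
    refine Multiset.sum_nonneg fun a ha => ?_
    obtain ⟨x, -, rfl⟩ := Multiset.mem_map.1 ha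
    positivity
  have hSZ : (S.map fun x => z.im / ((x - z.re) ^ 2 + z.im ^ 2)).sum
      ≤ (Z.map fun x => z.im / ((x.re - z.re) ^ 2 + z.im ^ 2)).sum := by
    rcases hS with rfl | ⟨x, hx, rfl⟩
    · simpa using hnn Z
    · have hxZ : (x : ℂ) ∈ Z := by
        refine hfac.mem_of_apply_eq_zero hx ?_
        have : x₀ = x := by simp [hx₀]
        rw [Metric.mem_closedBall, ← this]
        exact le_max_right _ _
      obtain ⟨Z', rfl⟩ := Multiset.exists_cons_of_mem hxZ
      rw [Multiset.map_cons, Multiset.sum_cons]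
      have := hnn Z'
      simp
      simpa using this
  rw [Complex.sub_im, hsum, Complex.sub_im, Complex.conj_im] at h'
  have := (abs_le.1 h').2
  linarith

lemma im_logDeriv_nonpos {F : ℂ → ℂ} (hF : RealRooted F) {z : ℂ} (hz : 0 < z.im) :
    (logDeriv F z).im ≤ 0 := by
  simpa using hF.im_logDeriv_le hz 0 (Or.inl rfl)

lemma im_logDeriv_neg {F : ℂ → ℂ} (hF : RealRooted F) {z : ℂ} (hz : 0 < z.im)
    (h0 : ∃ x, F x = 0) : (logDeriv F z).im < 0 := by
  obtain ⟨x, hx⟩ := h0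
  have hxr : x = (x.re : ℂ) := by
    apply Complex.ext
    · simp
    · simpa using hF.im_eq_zero x hx
  rw [hxr] at hx
  have h := hF.im_logDeriv_le hz {x.re} (Or.inr ⟨_, hx, rfl⟩)
  rw [Multiset.map_singleton, Multiset.sum_singleton] at h
  have : 0 < z.im / ((x.re - z.re) ^ 2 + z.im ^ 2) := by positivity
  linarith

lemma hasDerivAt_norm_sq {F : ℂ → ℂ} (hF : RealRooted F) (x : ℝ) {y : ℝ} (hy : y ≠ 0) :
    HasDerivAt (fun y : ℝ => ‖F (x + y * Complex.I)‖ ^ 2)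
      (-(2 * ‖F (x + y * Complex.I)‖ ^ 2 * (logDeriv F (x + y * Complex.I)).im)) y := by
  have h1 : HasDerivAt (fun y : ℝ => (x : ℂ) + y * Complex.I) Complex.I y := by
    simpa using ((hasDerivAt_id' y).ofReal_comp.mul_const Complex.I).const_add (x : ℂ)
  have h2 := (hF.differentiable (x + y * Complex.I)).hasDerivAt.comp y h1
  have h3 := h2.norm_sq
  refine h3.congr_deriv ?_
  have hne : F (x + y * Complex.I) ≠ 0 := hF.ne_zero (by simpa using hy)
  have hd : deriv F (x + y * Complex.I) = logDeriv F (x + y * Complex.I) * F (x + y * Complex.I) := by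
    rw [logDeriv_apply, div_mul_cancel₀ _ hne]
  rw [hd, Function.comp_apply, Complex.inner, ← Complex.normSq_eq_norm_sq, Complex.normSq_apply]
  simp only [Complex.mul_re, Complex.mul_im, Complex.conj_re, Complex.conj_im, Complex.I_re,
    Complex.I_im]
  ring

lemma norm_mono {F : ℂ → ℂ} (hF : RealRooted F) (x : ℝ) {y₁ y₂ : ℝ} (h0 : 0 ≤ y₁) (h : y₁ ≤ y₂) :
    ‖F (x + y₁ * Complex.I)‖ ≤ ‖F (x + y₂ * Complex.I)‖ := by
  have hm : MonotoneOn (fun y : ℝ => ‖F (x + y * Complex.I)‖ ^ 2) (Ici 0) := by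
    have hc := hF.differentiable.continuous
    refine monotoneOn_of_deriv_nonneg (convex_Ici 0) (by fun_prop) (fun y hy => ?_) fun y hy => ?_
    · rw [interior_Ici] at hy
      exact (hF.hasDerivAt_norm_sq x (ne_of_gt hy)).differentiableAt.differentiableWithinAt
    · rw [interior_Ici] at hy
      rw [(hF.hasDerivAt_norm_sq x (ne_of_gt hy)).deriv]
      have := hF.im_logDeriv_nonpos (z := x + y * Complex.I) (by simpa using hy)
      have h2 : 0 ≤ 2 * ‖F (x + y * Complex.I)‖ ^ 2 := by positivity
      linarith [mul_nonpos_of_nonneg_of_nonpos h2 this]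
  exact (pow_le_pow_iff_left₀ (norm_nonneg _) (norm_nonneg _) two_ne_zero).1
    (hm h0 (h0.trans h) h)

lemma norm_strictMono {F : ℂ → ℂ} (hF : RealRooted F) (hx : ∃ x, F x = 0) (x : ℝ) {y₁ y₂ : ℝ}
    (h0 : 0 ≤ y₁) (h : y₁ < y₂) : ‖F (x + y₁ * Complex.I)‖ < ‖F (x + y₂ * Complex.I)‖ := by
  have hm : StrictMonoOn (fun y : ℝ => ‖F (x + y * Complex.I)‖ ^ 2) (Ici 0) := by
    have hc := hF.differentiable.continuous
    refine strictMonoOn_of_deriv_pos (convex_Ici 0) (by fun_prop) fun y hy => ?_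
    rw [interior_Ici] at hy
    rw [(hF.hasDerivAt_norm_sq x (ne_of_gt hy)).deriv]
    have hy' : (x + y * Complex.I : ℂ).im ≠ 0 := by simpa using (ne_of_gt hy)
    have := hF.im_logDeriv_neg (z := x + y * Complex.I) (by simpa using hy) hx
    have h2 : 0 < 2 * ‖F (x + y * Complex.I)‖ ^ 2 := by
      have := norm_pos_iff.2 (hF.ne_zero hy')
      positivity
    linarith [mul_neg_of_pos_of_neg h2 this]
  exact (pow_lt_pow_iff_left₀ (norm_nonneg _) (norm_nonneg _) two_ne_zero).1
    (hm h0 (h0.trans h.le) h)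

/-- Without zeros, evenness forces the function to be constant. -/
lemma deriv_eq_zero_of_even {F : ℂ → ℂ} (hF : RealRooted F) (he : ∀ z, F (-z) = F z)
    (h0 : ∀ z, F z ≠ 0) (z : ℂ) : deriv F z = 0 := by
  have hL : logDeriv F z = logDeriv F 0 := by
    rw [← sub_eq_zero, ← norm_le_zero_iff]
    refine le_of_forall_pos_le_add fun ε hε => ?_
    obtain ⟨R₀, hR₀⟩ := exists_forall_norm_logDeriv_sub_le hF.growth hF.I_ne_zero (h0 z) (h0 0) hε
    obtain ⟨Z, g, hfac⟩ := exists_zeroFactorization hF.differentiable hF.I_ne_zero R₀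
    have hZ : Z = 0 := Multiset.eq_zero_of_forall_notMem fun x hx => h0 x (hfac.apply_eq_zero hx)
    have h := hR₀ R₀ le_rfl Z g hfac
    rw [hZ] at h
    simpa using h
  have hd0 : deriv F 0 = 0 := by
    have h := deriv_comp_neg F 0
    rw [funext he, neg_zero] at h
    exact self_eq_neg.1 h
  rw [logDeriv_apply, logDeriv_apply, hd0, zero_div, div_eq_zero_iff] at hL
  exact hL.resolve_right (h0 z)

/-- De Bruijn's averaging step: `F(z + ib) + F(z - ib)` inherits real zeros. -/
lemma add_shift_ne_zero {F : ℂ → ℂ} (hF : RealRooted F) (he : ∀ z, F (-z) = F z) {b : ℝ}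
    (hb : 0 < b) {z : ℂ} (hz : 0 < z.im) :
    F (z + b * Complex.I) + F (z - b * Complex.I) ≠ 0 := by
  by_cases h0 : ∃ x, F x = 0
  · intro h
    have e1 : z + b * Complex.I = (z.re : ℂ) + ((z.im + b : ℝ) : ℂ) * Complex.I := by
      apply Complex.ext <;> simp
    have e2 : z - b * Complex.I = (z.re : ℂ) + ((z.im - b : ℝ) : ℂ) * Complex.I := by
      apply Complex.ext <;> simp
    have hn : ‖F (z - b * Complex.I)‖ = ‖F ((z.re : ℂ) + ((|z.im - b| : ℝ) : ℂ) * Complex.I)‖ := by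
      rcases abs_choice (z.im - b) with ha | ha
      · rw [ha, e2]
      · have e3 : (z.re : ℂ) + ((|z.im - b| : ℝ) : ℂ) * Complex.I
            = (starRingEnd ℂ) (z - b * Complex.I) := by
          rw [ha]
          apply Complex.ext
          · simp
          · simp
            ring
        rw [e3, hF.conj, RCLike.norm_conj]
    -- `z - ib` or its conjugate lies strictly below `z + ib`, so the moduli cannot agree
    have hlt := hF.norm_strictMono h0 z.re (abs_nonneg (z.im - b)) (y₂ := z.im + b)
      (abs_lt.2 ⟨by linarith, by linarith⟩)
    rw [← hn, ← e1, eq_neg_of_add_eq_zero_left h, norm_neg] at hlt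
    exact lt_irrefl _ hlt
  · push Not at h0
    have hc := is_const_of_deriv_eq_zero hF.differentiable (hF.deriv_eq_zero_of_even he h0)
    rw [hc _ 0, hc (z - _) 0, ← two_mul]
    exact mul_ne_zero two_ne_zero (h0 0)

/-- **Laguerre's inequality** `F F'' ≤ F'²` on the real line. -/
lemma laguerre {F : ℂ → ℂ} (hF : RealRooted F) (x : ℝ) :
    0 ≤ (deriv F x ^ 2 - deriv (deriv F) x * F x).re := by
  have hdx : (deriv F x).im = 0 := by
    have h := hF.deriv_conj x
    rw [Complex.conj_ofReal] at h
    exact Complex.conj_eq_iff_im.1 h.symm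
  have hx := hF.im_ofReal x
  rcases eq_or_ne (F x) 0 with h0 | h0
  · rw [h0, mul_zero, sub_zero, sq, Complex.mul_re, hdx]
    nlinarith [sq_nonneg (deriv F x).re]
  have hdd : Differentiable ℂ (deriv F) := hF.differentiable.deriv
  have hL := (hdd x).hasDerivAt.div (hF.differentiable x).hasDerivAt h0
  have h1 : HasDerivAt (fun y : ℝ => (x : ℂ) + y * Complex.I) Complex.I 0 := by
    simpa using ((hasDerivAt_id' (0 : ℝ)).ofReal_comp.mul_const Complex.I).const_add (x : ℂ)
  have e0 : (x : ℂ) + ((0 : ℝ) : ℂ) * Complex.I = x := by simp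
  rw [← e0] at hL
  have h2 := hL.comp (0 : ℝ) h1
  have h3 : HasDerivAt (fun y : ℝ => (logDeriv F (x + y * Complex.I)).im) _ 0 :=
    Complex.imCLM.hasFDerivAt.comp_hasDerivAt (0 : ℝ) h2
  rw [e0] at h3
  have hle : Complex.imCLM ((deriv (deriv F) x * F x - deriv F x * deriv F x) / F x ^ 2
      * Complex.I) ≤ 0 := by
    refine le_of_tendsto (h3.tendsto_slope.mono_left (nhdsWithin_mono (0 : ℝ) (s := Ioi 0)
      fun y hy => ne_of_gt hy)) ?_
    filter_upwards [self_mem_nhdsWithin] with y hy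
    have hy' : (0 : ℝ) < y := hy
    have hi := hF.im_logDeriv_nonpos (z := x + y * Complex.I) (by simpa using hy')
    have hi0 : (logDeriv F ((x : ℂ) + ((0 : ℝ) : ℂ) * Complex.I)).im = 0 := by
      rw [e0, logDeriv_apply, Complex.div_im, hdx, hx]
      simp
    rw [slope_def_field, hi0, sub_zero, sub_zero]
    exact div_nonpos_of_nonpos_of_nonneg hi hy'.le
  have e : F x = ((F x).re : ℂ) := by
    apply Complex.ext
    · simp
    · simpa using hx
  have hre : (F x).re ≠ 0 := fun h => h0 (by rw [e, h, Complex.ofReal_zero])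
  rw [Complex.imCLM_apply, Complex.mul_I_im] at hle
  rw [show (F x) ^ 2 = (((F x).re ^ 2 : ℝ) : ℂ) by rw [e]; push_cast; simp,
    Complex.div_ofReal_re] at hle
  have h4 : (deriv (deriv F) x * F x - deriv F x * deriv F x).re ≤ 0 := by
    by_contra hcon
    push Not at hcon
    have : 0 < (F x).re ^ 2 := by positivity
    exact absurd (div_pos hcon this) (not_lt.2 hle)
  rw [sq, Complex.sub_re]
  rw [Complex.sub_re] at h4
  linarith

/-- A real-rooted function with a zero has a real-rooted derivative. -/
lemma derivative {F : ℂ → ℂ} (hF : RealRooted F) (h0 : ∃ x, F x = 0) (hg : HasGrowth (deriv F)) :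
    RealRooted (deriv F) := by
  have hup : ∀ z : ℂ, 0 < z.im → deriv F z ≠ 0 := fun z hz h => by
    have := hF.im_logDeriv_neg hz h0
    rw [logDeriv_apply, h, zero_div] at this
    exact lt_irrefl _ this
  refine ⟨hF.differentiable.deriv, hg, hF.deriv_conj, fun z hz => ?_⟩
  rcases lt_trichotomy z.im 0 with h | h | h
  · refine absurd ?_ (hup ((starRingEnd ℂ) z) (by simpa using h))
    rw [hF.deriv_conj, hz, map_zero]
  · exact h
  · exact absurd hz (hup z h)

end RealRooted

/-! ### Preservation of real zeros and simplicity of zeros -/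

lemma IsRapid.hasGrowth {W : ℝ → ℂ} (hW : IsRapid W) : HasGrowth (fourierExp W) :=
  hW.exists_norm_fourierExp_le

lemma IsRapid.cosh_mul {W : ℝ → ℂ} (hW : IsRapid W) (b : ℝ) :
    IsRapid fun u => (Real.cosh (b * u) : ℂ) * W u := by
  refine hW.mul (A := Real.exp (b ^ 2 / 2)) (B := b ^ 2 / 2) (by fun_prop) fun u => ?_
  rw [Complex.norm_real, Real.norm_of_nonneg (Real.cosh_pos _).le, ← Real.exp_add]
  refine (Real.cosh_le_exp_half_sq _).trans (Real.exp_le_exp.2 ?_)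
  have := sq_le_one_add_abs_pow_three u
  nlinarith [sq_nonneg b]

lemma IsRapid.fourierExp_cosh_mul {W : ℝ → ℂ} (hW : IsRapid W) (b : ℝ) (z : ℂ) :
    fourierExp (fun u => (Real.cosh (b * u) : ℂ) * W u) z
      = (fourierExp W (z + b * Complex.I) + fourierExp W (z - b * Complex.I)) / 2 := by
  unfold fourierExp
  rw [← integral_add (hW.mul_cexp_I _).integrable (hW.mul_cexp_I _).integrable, ← integral_div]
  congr 1
  ext u
  have e1 : (z + b * Complex.I) * (Complex.I * u) = z * (Complex.I * u) + -(b * u) := by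
    linear_combination ((b : ℂ) * u) * Complex.I_mul_I
  have e2 : (z - b * Complex.I) * (Complex.I * u) = z * (Complex.I * u) + b * u := by
    linear_combination (-(b : ℂ) * u) * Complex.I_mul_I
  dsimp only
  rw [e1, e2, Complex.exp_add, Complex.exp_add, Complex.ofReal_cosh, Complex.cosh]
  push_cast
  ring

lemma realRooted_fourierExp_cosh_mul {W : ℝ → ℂ} (hW : IsRapid W) (he : ∀ u, W (-u) = W u)
    (hc : ∀ u, (starRingEnd ℂ) (W u) = W u) (hF : RealRooted (fourierExp W)) {b : ℝ} (hb : 0 < b) :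
    RealRooted (fourierExp fun u => (Real.cosh (b * u) : ℂ) * W u) := by
  have hW' := hW.cosh_mul b
  have hconj : ∀ z, fourierExp (fun u => (Real.cosh (b * u) : ℂ) * W u) ((starRingEnd ℂ) z)
      = (starRingEnd ℂ) (fourierExp (fun u => (Real.cosh (b * u) : ℂ) * W u) z) :=
    fourierExp_conj fun u => by
      rw [map_mul, hc, he, mul_neg, Real.cosh_neg, Complex.conj_ofReal]
  have hup : ∀ z : ℂ, 0 < z.im → fourierExp (fun u => (Real.cosh (b * u) : ℂ) * W u) z ≠ 0 := by
    intro z hz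
    rw [hW.fourierExp_cosh_mul]
    exact div_ne_zero (hF.add_shift_ne_zero (fourierExp_neg he) hb hz) two_ne_zero
  refine ⟨hW'.differentiable_fourierExp, hW'.hasGrowth, hconj, fun z hz => ?_⟩
  rcases lt_trichotomy z.im 0 with h | h | h
  · refine absurd ?_ (hup ((starRingEnd ℂ) z) (by simpa using h))
    rw [hconj, hz, map_zero]
  · exact h
  · exact absurd hz (hup z h)

lemma realRooted_fourierExp_cosh_pow_mul {W : ℝ → ℂ} (hW : IsRapid W) (he : ∀ u, W (-u) = W u)
    (hc : ∀ u, (starRingEnd ℂ) (W u) = W u) (hF : RealRooted (fourierExp W)) {b : ℝ} (hb : 0 < b)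
    (k : ℕ) : IsRapid (fun u => (Real.cosh (b * u) : ℂ) ^ k * W u) ∧
      RealRooted (fourierExp fun u => (Real.cosh (b * u) : ℂ) ^ k * W u) := by
  induction k with
  | zero => simpa using ⟨hW, hF⟩
  | succ k ih =>
    have e : (fun u : ℝ => (Real.cosh (b * u) : ℂ) ^ (k + 1) * W u)
        = fun u : ℝ => (Real.cosh (b * u) : ℂ) * ((Real.cosh (b * u) : ℂ) ^ k * W u) := by
      ext u
      ring
    rw [e]
    refine ⟨ih.1.cosh_mul b, realRooted_fourierExp_cosh_mul ih.1 (fun u => ?_) (fun u => ?_) ih.2 hb⟩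
    · rw [he, mul_neg, Real.cosh_neg]
    · rw [map_mul, hc, map_pow, Complex.conj_ofReal]

lemma one_add_sq_div_two_le_cosh (x : ℝ) : 1 + x ^ 2 / 2 ≤ Real.cosh x := by
  have h1 : Real.cosh x = 1 + 2 * Real.sinh (x / 2) ^ 2 := by
    have h := Real.cosh_two_mul (x / 2)
    rw [mul_div_cancel₀ x two_ne_zero] at h
    have h2 := Real.cosh_sq (x / 2)
    linarith
  have h2 : (x / 2) ^ 2 ≤ Real.sinh (x / 2) ^ 2 := by
    rw [sq_le_sq]
    rcases le_total 0 (x / 2) with h | h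
    · have := Real.self_le_sinh_iff.2 h
      rw [abs_of_nonneg h, abs_of_nonneg (h.trans this)]
      exact this
    · have := Real.self_le_sinh_iff.2 (neg_nonneg.2 h)
      rw [Real.sinh_neg] at this
      rw [abs_of_nonpos h, abs_of_nonpos (by linarith)]
      exact this
  rw [h1]
  nlinarith

lemma cosh_pow_le_exp {δ : ℝ} (hδ : 0 ≤ δ) (u : ℝ) (n : ℕ) :
    Real.cosh (√(2 * δ / n) * u) ^ n ≤ Real.exp (δ * u ^ 2) := by
  rcases Nat.eq_zero_or_pos n with rfl | hn
  · simpa using by positivity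
  refine (pow_le_pow_left₀ (Real.cosh_pos _).le (Real.cosh_le_exp_half_sq _) n).trans (le_of_eq ?_)
  rw [← Real.exp_nat_mul, mul_pow, Real.sq_sqrt (by positivity)]
  congr 1
  field_simp

/-- The Gaussian multiplier `exp (δ u²)` is a limit of powers of hyperbolic cosines. -/
lemma tendsto_cosh_pow {δ : ℝ} (hδ : 0 ≤ δ) (u : ℝ) :
    Tendsto (fun n : ℕ => Real.cosh (√(2 * δ / n) * u) ^ n) atTop (𝓝 (Real.exp (δ * u ^ 2))) := by
  refine tendsto_of_tendsto_of_tendsto_of_le_of_le (Real.tendsto_one_add_div_pow_exp (δ * u ^ 2))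
    tendsto_const_nhds (fun n => ?_) fun n => cosh_pow_le_exp hδ u n
  refine pow_le_pow_left₀ (by positivity) ?_ n
  refine le_trans (le_of_eq ?_) (one_add_sq_div_two_le_cosh _)
  rw [mul_pow, Real.sq_sqrt (by positivity)]
  ring

lemma H_zero_ne_zero (t : ℝ) : H t 0 ≠ 0 := by
  have hr : ∀ u : ℝ, weight t u = ((Real.exp (t * u ^ 2) * (Phi u / 2) : ℝ) : ℂ) := by
    intro u
    simp [weight]
  have hi : Integrable fun u : ℝ => Real.exp (t * u ^ 2) * (Phi u / 2) := by
    have := (isRapid_weight t).integrable.re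
    refine this.congr (Eventually.of_forall fun u => ?_)
    simp only [hr]
    exact Complex.ofReal_re _
  have hpos : ∀ u : ℝ, 0 < Real.exp (t * u ^ 2) * (Phi u / 2) := fun u => by
    have := Phi_pos u
    positivity
  have h : 0 < ∫ u : ℝ, Real.exp (t * u ^ 2) * (Phi u / 2) := by
    rw [integral_pos_iff_support_of_nonneg (fun u => (hpos u).le) hi]
    have : Function.support (fun u : ℝ => Real.exp (t * u ^ 2) * (Phi u / 2)) = univ :=
      eq_univ_of_forall fun u => (hpos u).ne'
    rw [this]
    simp
  rw [H_eq_fourierExp, fourierExp]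
  simp only [zero_mul, Complex.exp_zero, one_mul, hr]
  rw [integral_complex_ofReal]
  exact_mod_cast h.ne'

lemma differentiable_H (t : ℝ) : Differentiable ℂ (H t) := by
  rw [funext (H_eq_fourierExp t)]
  exact (isRapid_weight t).differentiable_fourierExp

lemma H_conj (t : ℝ) (z : ℂ) : H t ((starRingEnd ℂ) z) = (starRingEnd ℂ) (H t z) := by
  rw [H_eq_fourierExp, H_eq_fourierExp]
  exact fourierExp_conj (fun u => by rw [weight_neg, weight_conj]) z

lemma HasOnlyRealZeros.realRooted {t : ℝ} (h : HasOnlyRealZeros t) :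
    RealRooted (fourierExp (weight t)) := by
  have e := funext (H_eq_fourierExp t)
  refine e ▸ ⟨differentiable_H t, ?_, H_conj t, h⟩
  rw [e]
  exact (isRapid_weight t).hasGrowth

/-- **De Bruijn's theorem**: the property of having only real zeros persists forward in time. The
vertical monotonicity of `|F|` survives the limit in `n` and forces a zero off the real axis to
spread along a segment. -/
theorem HasOnlyRealZeros.mono {t₀ t : ℝ} (h : HasOnlyRealZeros t₀) (ht : t₀ < t) :
    HasOnlyRealZeros t := by
  set δ := t - t₀
  have hδ : 0 < δ := sub_pos.2 ht
  -- `n` averaging steps with shift `√(2δ/n)` approximate the heat flow over a time span `δ`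
  set G : ℕ → ℂ → ℂ := fun n => fourierExp fun u =>
    (Real.cosh (√(2 * δ / n) * u) : ℂ) ^ n * weight t₀ u
  have hG : ∀ n : ℕ, 0 < n → RealRooted (G n) := fun n hn =>
    (realRooted_fourierExp_cosh_pow_mul (isRapid_weight t₀) (weight_neg t₀) (weight_conj t₀)
      h.realRooted (b := √(2 * δ / n)) (by positivity) n).2
  have hlim : ∀ z, Tendsto (fun n => G n z) atTop (𝓝 (H t z)) := by
    intro z
    rw [H_eq_fourierExp]
    refine tendsto_integral_of_dominated_convergence
      (fun u => ‖Complex.exp (z * (Complex.I * u)) * weight t u‖) (fun n => ?_)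
      ((isRapid_weight t).mul_cexp_I z).integrable.norm
      (fun n => Eventually.of_forall fun u => ?_) (Eventually.of_forall fun u => ?_)
    · have := (isRapid_weight t₀).continuous
      exact Continuous.aestronglyMeasurable (by fun_prop)
    · have e : weight t u = ((Real.exp (δ * u ^ 2) : ℝ) : ℂ) * weight t₀ u := by
        simp only [weight, δ]
        push_cast
        rw [← mul_assoc, ← Complex.exp_add]
        ring_nf
      rw [e, norm_mul, norm_mul, norm_mul, norm_mul, Complex.norm_real, norm_pow, Complex.norm_real,
        Real.norm_of_nonneg (Real.exp_pos _).le, Real.norm_of_nonneg (Real.cosh_pos _).le]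
      gcongr
      exact cosh_pow_le_exp hδ.le u n
    · have e : weight t u = ((Real.exp (δ * u ^ 2) : ℝ) : ℂ) * weight t₀ u := by
        simp only [weight, δ]
        push_cast
        rw [← mul_assoc, ← Complex.exp_add]
        ring_nf
      rw [e]
      have h1 := (Complex.continuous_ofReal.tendsto _).comp (tendsto_cosh_pow hδ.le u)
      refine Tendsto.const_mul _ (Tendsto.mul_const _ ?_)
      refine h1.congr fun n => ?_
      simp
  have hup : ∀ z : ℂ, 0 < z.im → H t z ≠ 0 := by
    intro z hz h0
    have hseg : ∀ y ∈ Ioo 0 z.im, H t (z.re + y * Complex.I) = 0 := by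
      intro y hy
      have hle : ‖H t (z.re + y * Complex.I)‖ ≤ ‖H t (z.re + z.im * Complex.I)‖ := by
        refine le_of_tendsto_of_tendsto (hlim _).norm (hlim _).norm ?_
        filter_upwards [eventually_gt_atTop 0] with n hn
        exact (hG n hn).norm_mono z.re hy.1.le hy.2.le
      rw [Complex.re_add_im, h0, norm_zero] at hle
      exact norm_le_zero_iff.1 hle
    have hfin := finite_zeros_closedBall (differentiable_H t) (H_zero_ne_zero t) (‖z‖ * 2)
    have hmaps : MapsTo (fun y : ℝ => (z.re : ℂ) + y * Complex.I) (Ioo 0 z.im)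
        {w | H t w = 0 ∧ w ∈ Metric.closedBall 0 (‖z‖ * 2)} := by
      refine fun y hy => ⟨hseg y hy, ?_⟩
      rw [mem_closedBall_zero_iff]
      have h1 := norm_add_le (z.re : ℂ) (y * Complex.I)
      rw [norm_mul, Complex.norm_I, mul_one, Complex.norm_real, Complex.norm_real,
        Real.norm_of_nonneg hy.1.le, Real.norm_eq_abs] at h1
      have h2 := Complex.abs_re_le_norm z
      have h3 := Complex.abs_im_le_norm z
      have h4 := le_abs_self z.im
      linarith [hy.2]
    refine (Ioo_infinite hz) (Set.Finite.of_injOn hmaps ?_ hfin)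
    intro a _ b _ hab
    have := congrArg Complex.im hab
    simpa using this
  intro z hz
  rcases lt_trichotomy z.im 0 with h | h | h
  · refine absurd ?_ (hup ((starRingEnd ℂ) z) (by simpa using h))
    rw [H_conj, hz, map_zero]
  · exact h
  · exact absurd hz (hup z h)

lemma hasOnlyRealZeros_of_Lam_lt (hLam : Lam < 0) {t : ℝ} (ht : Lam < t) : HasOnlyRealZeros t := by
  -- the infimum of the empty set is `0` by convention, which the hypothesis excludes
  have hne : {t : ℝ | HasOnlyRealZeros t}.Nonempty := by
    by_contra h
    rw [Set.not_nonempty_iff_eq_empty] at h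
    rw [Lam, h, Real.sInf_empty] at hLam
    exact lt_irrefl _ hLam
  obtain ⟨t₀, h₀, h₁⟩ := exists_lt_of_csInf_lt hne ht
  exact HasOnlyRealZeros.mono h₀ h₁

/-- The weight of the `k`-th derivative of `H_t`. -/
def derivWeight (t : ℝ) (k : ℕ) (u : ℝ) : ℂ := (Complex.I * u) ^ k * weight t u

lemma derivWeight_succ (t : ℝ) (k : ℕ) :
    derivWeight t (k + 1) = fun u => Complex.I * u * derivWeight t k u := by
  ext u
  simp only [derivWeight]
  ring

lemma isRapid_derivWeight (t : ℝ) (k : ℕ) : IsRapid (derivWeight t k) := by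
  induction k with
  | zero =>
    have e : derivWeight t 0 = weight t := by
      ext u
      simp [derivWeight]
    rw [e]
    exact isRapid_weight t
  | succ k ih =>
    rw [derivWeight_succ]
    exact ih.I_mul

lemma deriv_fourierExp_derivWeight (t : ℝ) (k : ℕ) :
    deriv (fourierExp (derivWeight t k)) = fourierExp (derivWeight t (k + 1)) := by
  rw [(isRapid_derivWeight t k).deriv_fourierExp, derivWeight_succ]

lemma H_eq_fourierExp_derivWeight (t : ℝ) : H t = fourierExp (derivWeight t 0) := by
  ext z
  rw [H_eq_fourierExp]
  congr 1
  ext u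
  simp [derivWeight]

lemma iteratedDeriv_H (t : ℝ) (k : ℕ) :
    iteratedDeriv k (H t) = fourierExp (derivWeight t k) := by
  induction k with
  | zero => rw [iteratedDeriv_zero, H_eq_fourierExp_derivWeight]
  | succ k ih => rw [iteratedDeriv_succ, ih, deriv_fourierExp_derivWeight]

lemma fourierExp_derivWeight_neg (t : ℝ) (k : ℕ) (z : ℂ) :
    fourierExp (derivWeight t k) (-z) = (-1) ^ k * fourierExp (derivWeight t k) z := by
  unfold fourierExp
  rw [← integral_neg_eq_self, ← integral_const_mul]
  congr 1
  ext u
  simp only [derivWeight, weight_neg]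
  push_cast
  rw [show Complex.I * -(u : ℂ) = (-1) * (Complex.I * u) by ring, mul_pow]
  ring_nf

lemma exists_fourierExp_derivWeight_eq_zero {t : ℝ} {k : ℕ}
    (h : RealRooted (fourierExp (derivWeight t k))) : ∃ z, fourierExp (derivWeight t k) z = 0 := by
  by_contra h0
  push Not at h0
  rcases Nat.even_or_odd k with hk | hk
  · have hd := h.deriv_eq_zero_of_even
      (fun z => by rw [fourierExp_derivWeight_neg, hk.neg_one_pow, one_mul]) h0
    have hd2 : fourierExp (derivWeight t (k + 2)) 0 = 0 := by
      rw [← deriv_fourierExp_derivWeight, ← deriv_fourierExp_derivWeight]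
      have : deriv (fourierExp (derivWeight t k)) = fun _ => 0 := funext hd
      rw [this]
      simp
    -- the even moments of the positive weight do not vanish
    have hk2 : Even (k + 2) := hk.add even_two
    have hr : ∀ u : ℝ, derivWeight t (k + 2) u
        = Complex.I ^ (k + 2) * ((u ^ (k + 2) * (Real.exp (t * u ^ 2) * (Phi u / 2)) : ℝ) : ℂ) := by
      intro u
      simp [derivWeight, weight, mul_pow]
      ring
    have hIk : Complex.I ^ (k + 2) ≠ 0 := pow_ne_zero _ Complex.I_ne_zero
    have hi : Integrable fun u : ℝ => u ^ (k + 2) * (Real.exp (t * u ^ 2) * (Phi u / 2)) := by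
      have := ((isRapid_derivWeight t (k + 2)).integrable.const_mul (Complex.I ^ (k + 2))⁻¹).re
      refine this.congr (Eventually.of_forall fun u => ?_)
      simp only [hr]
      rw [inv_mul_cancel_left₀ hIk]
      exact Complex.ofReal_re _
    have hpos : ∀ u : ℝ, 0 < Real.exp (t * u ^ 2) * (Phi u / 2) := fun u => by
      have := Phi_pos u
      positivity
    have hint : 0 < ∫ u : ℝ, u ^ (k + 2) * (Real.exp (t * u ^ 2) * (Phi u / 2)) := by
      rw [integral_pos_iff_support_of_nonneg
        (fun u => mul_nonneg (hk2.pow_nonneg u) (hpos u).le) hi]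
      refine lt_of_lt_of_le (b := volume (Ioo (0 : ℝ) 1)) (by simp) (measure_mono fun u hu => ?_)
      exact (mul_pos (pow_pos hu.1 _) (hpos u)).ne'
    rw [fourierExp] at hd2
    simp only [zero_mul, Complex.exp_zero, one_mul, hr] at hd2
    rw [integral_const_mul, integral_complex_ofReal] at hd2
    exact hint.ne' (by exact_mod_cast (mul_eq_zero.1 hd2).resolve_left hIk)
  · refine h0 0 ?_
    have := fourierExp_derivWeight_neg t k 0
    rw [neg_zero, hk.neg_one_pow, neg_one_mul] at this
    exact self_eq_neg.1 this

lemma HasOnlyRealZeros.realRooted_derivWeight {t : ℝ} (h : HasOnlyRealZeros t) (k : ℕ) :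
    RealRooted (fourierExp (derivWeight t k)) := by
  induction k with
  | zero =>
    rw [← H_eq_fourierExp_derivWeight, funext (H_eq_fourierExp t)]
    exact h.realRooted
  | succ k ih =>
    have hg := (isRapid_derivWeight t (k + 1)).hasGrowth
    rw [← deriv_fourierExp_derivWeight] at hg ⊢
    exact ih.derivative (exists_fourierExp_derivWeight_eq_zero ih) hg

/-- The backward heat equation `∂_t H_t = -H_t''` for the derivatives of `H_t`. -/
lemma hasDerivAt_fourierExp_derivWeight_time (k : ℕ) (z : ℂ) (t : ℝ) :
    HasDerivAt (fun t : ℝ => fourierExp (derivWeight t k) z)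
      (-fourierExp (derivWeight t (k + 2)) z) t := by
  have hW : IsRapid fun u => (Complex.I * u) ^ k * ((Phi u / 2 : ℝ) : ℂ) := by
    have := isRapid_derivWeight 0 k
    unfold derivWeight weight at this
    simpa using this
  have h := hW.hasDerivAt_fourierExp_time z t
  have e : ∀ s : ℝ, (fun u : ℝ => Complex.exp (s * (u : ℂ) ^ 2) *
      ((Complex.I * u) ^ k * ((Phi u / 2 : ℝ) : ℂ))) = derivWeight s k := by
    intro s
    ext u
    simp only [derivWeight, weight]
    ring
  simp only [e] at h
  refine h.congr_deriv ?_
  unfold fourierExp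
  rw [← integral_neg]
  congr 1
  ext u
  simp only [derivWeight, weight, pow_add, mul_pow, Complex.I_sq]
  ring

/-- Zeros are simple when all zeros at slightly earlier times are real: Laguerre's inequality for
the derivative of order `m - 2` at a zero of order `m` would be violated just before time `t`. -/
theorem deriv_H_ne_zero {t₀ t : ℝ} (h : ∀ s, t₀ < s → HasOnlyRealZeros s) (ht : t₀ < t) {x : ℝ}
    (hx : H t x = 0) : deriv (H t) x ≠ 0 := by
  intro hd
  set K : ℝ → ℕ → ℂ := fun s k => fourierExp (derivWeight s k) x with hK
  have hex : ∃ k, K t k ≠ 0 := by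
    by_contra hcon
    push Not at hcon
    refine H_zero_ne_zero t ?_
    have hs := Complex.taylorSeries_eq_of_entire' (c := (x : ℂ)) (z := 0) (differentiable_H t)
    rw [← hs]
    refine (tsum_congr fun n => ?_).trans tsum_zero
    rw [iteratedDeriv_H, show fourierExp (derivWeight t n) x = 0 from hcon n]
    simp
  -- the order `m` of the zero
  classical
  set m := Nat.find hex with hm
  have hm0 : K t m ≠ 0 := Nat.find_spec hex
  have hlt : ∀ k < m, K t k = 0 := fun k hk => by
    have := Nat.find_min hex hk
    push Not at this
    exact this
  have h0 : K t 0 = 0 := by rw [hK]; dsimp only; rw [← H_eq_fourierExp_derivWeight]; exact hx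
  have h1 : K t 1 = 0 := by
    rw [hK]; dsimp only
    rw [← zero_add 1, ← deriv_fourierExp_derivWeight, ← H_eq_fourierExp_derivWeight]
    exact hd
  have hm2 : 2 ≤ m := by
    by_contra hcon
    have : m = 0 ∨ m = 1 := by omega
    rcases this with e | e <;> rw [e] at hm0
    · exact hm0 h0
    · exact hm0 h1
  obtain ⟨k, hk⟩ := Nat.exists_eq_add_of_le' hm2
  have hk0 : K t k = 0 := hlt k (by omega)
  have hk1 : K t (k + 1) = 0 := hlt (k + 1) (by omega)
  have hD : ∀ j, HasDerivAt (fun s => K s j) (-K t (j + 2)) t := fun j =>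
    hasDerivAt_fourierExp_derivWeight_time j x t
  -- Laguerre's expression for the derivative of order `m - 2` vanishes at time `t`, where it has a
  -- local minimum, but by the heat equation its derivative in time is `K t m ^ 2`
  have hψ := ((hD (k + 1)).pow 2).sub ((hD (k + 2)).mul (hD k))
  have hψ' : HasDerivAt (fun s => (K s (k + 1) ^ 2 - K s (k + 2) * K s k).re) _ t :=
    Complex.reCLM.hasFDerivAt.comp_hasDerivAt t hψ
  have hmin : IsLocalMin (fun s => (K s (k + 1) ^ 2 - K s (k + 2) * K s k).re) t := by
    filter_upwards [lt_mem_nhds ht] with s hs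
    have hl := ((h s hs).realRooted_derivWeight k).laguerre x
    rw [deriv_fourierExp_derivWeight, deriv_fourierExp_derivWeight] at hl
    simpa [hk0, hk1] using hl
  have hz := hmin.hasDerivAt_eq_zero hψ'
  have him : (K t m).im = 0 := ((h t ht).realRooted_derivWeight m).im_ofReal x
  rw [hk] at him hm0
  simp only [hk0, hk1] at hz
  have hre : ((K t m).re : ℂ) = K t m := by
    rw [hk]
    apply Complex.ext
    · simp
    · simpa using him.symm
  rw [hk] at hre
  rw [← hre] at hz hm0
  simp at hz hm0
  exact hm0 (by norm_cast at hz)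

/-! ### Stirling's formula for the complex Gamma function -/

lemma norm_deriv_le_of_norm_le_div {f : ℂ → ℂ} {a C : ℝ} (ha : 1 ≤ a)
    (hf : DifferentiableOn ℂ f {s | a < s.re}) (hfC : ∀ s : ℂ, a < s.re → ‖f s‖ ≤ C / ‖s‖) {s : ℂ}
    (hs : a + 1 < s.re) : ‖deriv f s‖ ≤ 2 * C / ‖s‖ := by
  have hs2 : 2 ≤ ‖s‖ := by linarith [Complex.re_le_norm s]
  have hre : ∀ w ∈ Metric.closedBall s 1, a < w.re := by
    intro w hw
    have h1 : ‖w - s‖ ≤ 1 := by simpa [dist_eq_norm] using hw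
    have h2 := (abs_le.1 ((Complex.abs_re_le_norm (w - s)).trans h1)).1
    rw [Complex.sub_re] at h2
    linarith
  have h0 : 0 ≤ C := by
    have h := (norm_nonneg _).trans (hfC s (by linarith))
    by_contra hc
    exact absurd h (not_le.2 (div_neg_of_neg_of_pos (not_le.1 hc) (by linarith)))
  have h := Complex.norm_deriv_le_of_forall_mem_sphere_norm_le (c := s) (R := 1) (f := f)
    (C := 2 * C / ‖s‖) one_pos ?_ fun w hw => ?_
  · simpa using h
  · refine DifferentiableOn.diffContOnCl (s := Metric.ball s 1) (hf.mono fun w hw => ?_)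
    rw [closure_ball s one_ne_zero] at hw
    exact hre w hw
  · have hw' := Metric.sphere_subset_closedBall hw
    refine (hfC w (hre w hw')).trans ?_
    have h1 : ‖w - s‖ = 1 := by simpa [dist_eq_norm] using hw
    have h2 := norm_sub_norm_le s w
    rw [norm_sub_rev, h1] at h2
    rw [div_le_div_iff₀ (by linarith) (by linarith)]
    nlinarith

/-- The error in one step of the trapezoidal rule for the logarithm. -/
def stirlingTerm (w : ℂ) : ℂ := (w + 1 / 2) * (Complex.log (w + 1) - Complex.log w) - 1

lemma log_add_one_sub_log {w : ℂ} (hw : 0 < w.re) :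
    Complex.log (w + 1) - Complex.log w = Complex.log (1 + w⁻¹) := by
  have hw0 : w ≠ 0 := fun h => by simp [h] at hw
  have e : w + 1 = w * (1 + w⁻¹) := by field_simp
  have h1 : 0 < (w⁻¹).re := by
    rw [Complex.inv_re]
    exact div_pos hw (Complex.normSq_pos.2 hw0)
  have h2 : (1 + w⁻¹) ≠ 0 := fun h => by
    have := congrArg Complex.re h
    simp only [Complex.add_re, Complex.one_re, Complex.zero_re] at this
    linarith
  have h3 := Complex.abs_arg_lt_pi_div_two_iff.2 (Or.inl hw)
  have h4 := Complex.abs_arg_lt_pi_div_two_iff (z := 1 + w⁻¹).2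
    (Or.inl (by simp only [Complex.add_re, Complex.one_re]; linarith))
  rw [abs_lt] at h3 h4
  rw [e, Complex.log_mul hw0 h2 ⟨by linarith [h3.1, h4.1], by linarith [h3.2, h4.2]⟩]
  ring

lemma norm_stirlingTerm_le {w : ℂ} (hw : 2 ≤ w.re) : ‖stirlingTerm w‖ ≤ 2 / ‖w‖ ^ 2 := by
  have hn : 2 ≤ ‖w‖ := hw.trans (Complex.re_le_norm w)
  have hw0 : w ≠ 0 := norm_pos_iff.1 (by linarith)
  have hx : ‖w⁻¹‖ ≤ 1 / 2 := by
    rw [norm_inv, inv_le_comm₀ (by linarith) (by norm_num)]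
    simpa using hn
  have h := Complex.norm_log_sub_logTaylor_le 2 (z := w⁻¹) (by linarith)
  have ht : Complex.logTaylor 3 w⁻¹ = w⁻¹ - w⁻¹ ^ 2 / 2 := by
    simp [Complex.logTaylor, Finset.sum_range_succ]
    ring
  set r := Complex.log (1 + w⁻¹) - Complex.logTaylor 3 w⁻¹ with hr
  have e : stirlingTerm w = (w + 1 / 2) * r - (1 / 4) * w⁻¹ ^ 2 := by
    rw [stirlingTerm, log_add_one_sub_log (by linarith), hr, ht]
    field_simp
    ring
  have hr' : ‖r‖ ≤ (2 / 3) * ‖w‖⁻¹ ^ 3 := by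
    refine h.trans ?_
    have h1 : (1 - ‖w⁻¹‖)⁻¹ ≤ 2 := by
      rw [inv_le_comm₀ (by linarith) (by norm_num)]
      linarith
    have h0 : 0 ≤ ‖w⁻¹‖ ^ 3 := by positivity
    rw [norm_inv] at h1 h0 ⊢
    have h2 := mul_le_mul_of_nonneg_left h1 h0
    rw [div_le_iff₀ (by positivity)]
    push_cast
    linarith
  have hw2 : ‖w + 1 / 2‖ ≤ (5 / 4) * ‖w‖ := by
    refine (norm_add_le _ _).trans ?_
    norm_num
    linarith
  rw [e]
  refine (norm_sub_le _ _).trans ?_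
  rw [norm_mul, norm_mul, norm_pow, norm_inv]
  have h5 : ‖w + 1 / 2‖ * ‖r‖ ≤ (5 / 4 * ‖w‖) * ((2 / 3) * ‖w‖⁻¹ ^ 3) := by gcongr
  have h6 : (5 / 4 * ‖w‖) * ((2 / 3) * ‖w‖⁻¹ ^ 3) = (5 / 6) * (1 / ‖w‖ ^ 2) := by
    field_simp
    norm_num
  have h7 : ‖(1 / 4 : ℂ)‖ * ‖w‖⁻¹ ^ 2 = (1 / 4) * (1 / ‖w‖ ^ 2) := by
    rw [inv_pow, one_div (‖w‖ ^ 2)]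
    norm_num
  have h8 : 0 ≤ 1 / ‖w‖ ^ 2 := by positivity
  rw [h7, show 2 / ‖w‖ ^ 2 = 2 * (1 / ‖w‖ ^ 2) by ring]
  linarith

lemma norm_add_natCast_sq_ge {s : ℂ} (hs : 0 ≤ s.re) (j : ℕ) :
    (‖s‖ + j) ^ 2 ≤ 2 * ‖s + j‖ ^ 2 := by
  have h1 : ‖s‖ ≤ s.re + |s.im| := by
    have := Complex.norm_le_abs_re_add_abs_im s
    rwa [abs_of_nonneg hs] at this
  have h2 : ‖s + j‖ ^ 2 = (s.re + j) ^ 2 + |s.im| ^ 2 := by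
    rw [← Complex.normSq_eq_norm_sq, Complex.normSq_apply, sq_abs]
    simp
    ring
  have h3 : (0 : ℝ) ≤ j := j.cast_nonneg
  rw [h2]
  have h4 : (‖s‖ + j) ^ 2 ≤ (s.re + |s.im| + j) ^ 2 := by gcongr
  nlinarith [sq_nonneg (s.re + j - |s.im|)]

lemma norm_stirlingTerm_add_le {s : ℂ} (hs : 2 ≤ s.re) (j : ℕ) :
    ‖stirlingTerm (s + j)‖ ≤ 4 / (‖s‖ + j) ^ 2 := by
  have hn : 2 ≤ ‖s‖ := hs.trans (Complex.re_le_norm s)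
  have hj : (0 : ℝ) ≤ j := j.cast_nonneg
  have h1 := norm_stirlingTerm_le (w := s + j) (by simp; linarith)
  have h2 := norm_add_natCast_sq_ge (by linarith : 0 ≤ s.re) j
  have h3 : 0 < ‖s + j‖ := by
    refine lt_of_lt_of_le ?_ (Complex.re_le_norm _)
    simp
    linarith
  refine h1.trans ?_
  rw [div_le_div_iff₀ (by positivity) (by positivity)]
  linarith

lemma four_div_sq_le (a : ℝ) (ha : 2 ≤ a) (j : ℕ) :
    4 / (a + j) ^ 2 ≤ 4 * (1 / (a + j - 1) - 1 / (a + (j + 1 : ℕ) - 1)) := by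
  have hj : (0 : ℝ) ≤ j := j.cast_nonneg
  push_cast
  rw [div_sub_div _ _ (by linarith) (by linarith), ← mul_div_assoc,
    div_le_div_iff₀ (by nlinarith) (by nlinarith)]
  nlinarith

lemma summable_four_div_sq {a : ℝ} (ha : 2 ≤ a) : Summable fun j : ℕ => 4 / (a + j) ^ 2 := by
  refine summable_of_sum_range_le (c := 4 * (1 / (a - 1))) (fun j => by positivity) fun n => ?_
  refine (Finset.sum_le_sum fun j _ => four_div_sq_le a ha j).trans ?_
  rw [← Finset.mul_sum, Finset.sum_range_sub' (fun j : ℕ => 1 / (a + j - 1))]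
  have : 0 ≤ 1 / (a + n - 1) := by
    have hj : (0 : ℝ) ≤ n := n.cast_nonneg
    exact div_nonneg zero_le_one (by linarith)
  simp only [Nat.cast_zero, add_zero]
  linarith

lemma tsum_four_div_sq_le {a : ℝ} (ha : 2 ≤ a) : ∑' j : ℕ, 4 / (a + j) ^ 2 ≤ 8 / a := by
  have h8 : 4 * (1 / (a - 1)) ≤ 8 / a := by
    rw [mul_one_div, div_le_div_iff₀ (by linarith) (by linarith)]
    linarith
  refine le_trans ?_ h8
  refine Real.tsum_le_of_sum_range_le (fun j => by positivity) fun n => ?_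
  refine (Finset.sum_le_sum fun j _ => four_div_sq_le a ha j).trans ?_
  rw [← Finset.mul_sum, Finset.sum_range_sub' (fun j : ℕ => 1 / (a + j - 1))]
  have : 0 ≤ 1 / (a + n - 1) := by
    have hj : (0 : ℝ) ≤ n := n.cast_nonneg
    exact div_nonneg zero_le_one (by linarith)
  simp only [Nat.cast_zero, add_zero]
  linarith

/-- The correction term in Stirling's formula. -/
def stirlingMu (s : ℂ) : ℂ := ∑' j : ℕ, stirlingTerm (s + j)

lemma summable_stirlingTerm {s : ℂ} (hs : 2 ≤ s.re) :
    Summable fun j : ℕ => stirlingTerm (s + j) :=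
  Summable.of_norm_bounded (summable_four_div_sq (hs.trans (Complex.re_le_norm s)))
    (norm_stirlingTerm_add_le hs)

lemma norm_stirlingMu_le {s : ℂ} (hs : 2 ≤ s.re) : ‖stirlingMu s‖ ≤ 8 / ‖s‖ := by
  have hn := hs.trans (Complex.re_le_norm s)
  exact (tsum_of_norm_bounded (summable_four_div_sq hn).hasSum (norm_stirlingTerm_add_le hs)).trans
    (tsum_four_div_sq_le hn)

lemma differentiableOn_stirlingMu : DifferentiableOn ℂ stirlingMu {s | 2 < s.re} := by
  refine Complex.differentiableOn_tsum_of_summable_norm (summable_four_div_sq le_rfl)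
    (fun j s hs => ?_) (isOpen_lt continuous_const Complex.continuous_re) fun j s hs => ?_
  · have hs' : 2 < s.re := hs
    have hj : (0 : ℝ) ≤ j := j.cast_nonneg
    have h1 : s + j ∈ Complex.slitPlane := Or.inl (by simp; linarith)
    have h2 : s + j + 1 ∈ Complex.slitPlane := Or.inl (by simp; linarith)
    unfold stirlingTerm
    refine DifferentiableAt.differentiableWithinAt ?_
    refine ((by fun_prop : DifferentiableAt ℂ (fun s : ℂ => s + j + 1 / 2) s).mul
      (DifferentiableAt.sub ?_ ?_)).sub_const 1
    · exact DifferentiableAt.clog (by fun_prop) h2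
    · exact DifferentiableAt.clog (by fun_prop) h1
  · have hs' : 2 < s.re := hs
    refine (norm_stirlingTerm_add_le hs'.le j).trans ?_
    have hn := hs'.le.trans (Complex.re_le_norm s)
    gcongr

lemma stirlingMu_add_one {s : ℂ} (hs : 2 ≤ s.re) :
    stirlingMu s = stirlingTerm s + stirlingMu (s + 1) := by
  unfold stirlingMu
  rw [(summable_stirlingTerm hs).tsum_eq_zero_add]
  congr 1
  · simp
  · refine tsum_congr fun j => ?_
    push_cast
    ring_nf

/-- A logarithm of the Gamma function, up to an additive constant. -/
def stirlingLog (s : ℂ) : ℂ := (s - 1 / 2) * Complex.log s - s + stirlingMu s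

lemma stirlingLog_add_one {s : ℂ} (hs : 2 ≤ s.re) :
    stirlingLog (s + 1) = stirlingLog s + Complex.log s := by
  unfold stirlingLog
  rw [stirlingMu_add_one hs, stirlingTerm]
  ring

lemma hasDerivAt_stirlingLog {s : ℂ} (hs : 2 < s.re) :
    HasDerivAt stirlingLog (Complex.log s - 1 / (2 * s) + deriv stirlingMu s) s := by
  have h0 : s ∈ Complex.slitPlane := Or.inl (by linarith)
  have hs0 : s ≠ 0 := Complex.slitPlane_ne_zero h0
  have hμ := (differentiableOn_stirlingMu.differentiableAt
    ((isOpen_lt continuous_const Complex.continuous_re).mem_nhds hs)).hasDerivAt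
  refine (((((hasDerivAt_id' s).sub_const (1 / 2)).mul (Complex.hasDerivAt_log h0)).sub
    (hasDerivAt_id' s)).add hμ).congr_deriv ?_
  field_simp
  ring

lemma norm_deriv_stirlingLog_sub_log_le {s : ℂ} (hs : 3 < s.re) :
    ‖deriv stirlingLog s - Complex.log s‖ ≤ 17 / ‖s‖ := by
  rw [(hasDerivAt_stirlingLog (by linarith)).deriv]
  have h1 := norm_deriv_le_of_norm_le_div one_le_two differentiableOn_stirlingMu
    (fun s hs => norm_stirlingMu_le (le_of_lt hs)) (s := s) (by linarith)
  have e : Complex.log s - 1 / (2 * s) + deriv stirlingMu s - Complex.log s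
      = deriv stirlingMu s - 1 / (2 * s) := by ring
  rw [e]
  refine (norm_sub_le _ _).trans ?_
  have h2 : ‖1 / (2 * s)‖ = (1 / 2) / ‖s‖ := by
    rw [norm_div, norm_mul]
    norm_num
    ring
  rw [h2]
  have h3 : 0 ≤ 1 / ‖s‖ := by positivity
  calc ‖deriv stirlingMu s‖ + 1 / 2 / ‖s‖ ≤ 2 * 8 / ‖s‖ + 1 / 2 / ‖s‖ := by gcongr
    _ = 16.5 * (1 / ‖s‖) := by ring
    _ ≤ 17 * (1 / ‖s‖) := by gcongr; norm_num
    _ = _ := by ring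

lemma differentiableOn_stirlingLog : DifferentiableOn ℂ stirlingLog {s | 2 < s.re} := fun _ hs =>
  (hasDerivAt_stirlingLog hs).differentiableAt.differentiableWithinAt

lemma norm_deriv_deriv_stirlingLog_le {s : ℂ} (hs : 4 < s.re) :
    ‖deriv (deriv stirlingLog) s‖ ≤ 35 / ‖s‖ := by
  have hopen : IsOpen {s : ℂ | 2 < s.re} := isOpen_lt continuous_const Complex.continuous_re
  have hdd := differentiableOn_stirlingLog.deriv hopen
  have hlog : ∀ s : ℂ, 3 < s.re → HasDerivAt Complex.log s⁻¹ s := fun s hs =>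
    Complex.hasDerivAt_log (Or.inl (by linarith))
  have hd : DifferentiableOn ℂ (fun s => deriv stirlingLog s - Complex.log s) {s | 3 < s.re} :=
    (hdd.mono fun s (hs : 3 < s.re) => (by simp; linarith)).sub fun s hs =>
      (hlog s hs).differentiableAt.differentiableWithinAt
  have h1 := norm_deriv_le_of_norm_le_div (by norm_num) hd
    (fun s hs => norm_deriv_stirlingLog_sub_log_le hs) (s := s) (by linarith)
  have h2 : deriv (fun s => deriv stirlingLog s - Complex.log s) s
      = deriv (deriv stirlingLog) s - s⁻¹ := by
    rw [deriv_fun_sub (hdd.differentiableAt (hopen.mem_nhds (by simp; linarith)))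
      (hlog s (by linarith)).differentiableAt, (hlog s (by linarith)).deriv]
  rw [h2] at h1
  have h3 := norm_add_le (deriv (deriv stirlingLog) s - s⁻¹) s⁻¹
  rw [sub_add_cancel, norm_inv] at h3
  refine h3.trans ?_
  calc _ ≤ 2 * 17 / ‖s‖ + ‖s‖⁻¹ := by gcongr
    _ = _ := by ring

lemma exp_stirlingLog_add_nat {s : ℂ} (hs : 2 ≤ s.re) (n : ℕ) :
    Complex.exp (stirlingLog (s + n)) = Complex.exp (stirlingLog s) *
      ∏ j ∈ Finset.range n, (s + j) := by
  induction n with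
  | zero => simp
  | succ n ih =>
    have hn : (0 : ℝ) ≤ n := n.cast_nonneg
    have h2 : 2 ≤ (s + n).re := by simp; linarith
    have h0 : s + n ≠ 0 := fun h => by rw [h] at h2; norm_num at h2
    rw [Finset.prod_range_succ, ← mul_assoc, ← ih, Nat.cast_succ, ← add_assoc,
      stirlingLog_add_one h2, Complex.exp_add, Complex.exp_log h0]

lemma tendsto_stirlingLog_sub {s : ℂ} (hs : 3 < s.re) :
    Tendsto (fun n : ℕ => stirlingLog (s + (n + 1 : ℕ)) - stirlingLog (4 + (n + 1 : ℕ))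
      - (s - 4) * Complex.log n) atTop (𝓝 0) := by
  set B := ‖s‖ + 5
  have hbound : ∀ᶠ n : ℕ in atTop, ‖stirlingLog (s + (n + 1 : ℕ)) - stirlingLog (4 + (n + 1 : ℕ))
      - (s - 4) * Complex.log n‖ ≤ ((17 + 2 * B) * ‖s - 4‖) / n := by
    filter_upwards [eventually_ge_atTop 1, eventually_ge_atTop ⌈2 * B⌉₊] with n hn1 hnB
    have hn : (1 : ℝ) ≤ n := by exact_mod_cast hn1
    have hB : 2 * B ≤ n := (Nat.le_ceil _).trans (by exact_mod_cast hnB)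
    have hB0 : 0 < B := by positivity
    set U : Set ℂ := segment ℝ (4 : ℂ) s
    have hU : ∀ w ∈ U, 3 < w.re ∧ ‖w‖ ≤ ‖s‖ + 4 := by
      intro w hw
      have hconv : Convex ℝ {w : ℂ | 3 < w.re ∧ ‖w‖ ≤ ‖s‖ + 4} := by
        have h1 : Convex ℝ {w : ℂ | 3 < w.re} := convex_halfSpace_re_gt 3
        have h2 : Convex ℝ (Metric.closedBall (0 : ℂ) (‖s‖ + 4)) := convex_closedBall _ _
        convert h1.inter h2 using 1
        ext w
        simp
      refine hconv.segment_subset ⟨by norm_num, ?_⟩ ⟨hs, by linarith [norm_nonneg s]⟩ hw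
      simp
    have hder : ∀ w ∈ U, HasDerivWithinAt
        (fun w => stirlingLog (w + (n + 1 : ℕ)) - w * Complex.log n)
        (deriv stirlingLog (w + (n + 1 : ℕ)) - Complex.log n) U w := by
      intro w hw
      have hw3 := (hU w hw).1
      have h2 : 2 < (w + (n + 1 : ℕ)).re := by simp; linarith
      have h3 := (hasDerivAt_stirlingLog h2).differentiableAt.hasDerivAt.comp_add_const w
        ((n + 1 : ℕ) : ℂ)
      refine (h3.sub ((hasDerivAt_id' w).mul_const (Complex.log n))).hasDerivWithinAt.congr_deriv ?_
      ring
    have hdb : ∀ w ∈ U, ‖deriv stirlingLog (w + (n + 1 : ℕ)) - Complex.log n‖ ≤ (17 + 2 * B) / n := by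
      intro w hw
      obtain ⟨hw3, hwB⟩ := hU w hw
      have hre : 3 < (w + (n + 1 : ℕ)).re := by simp; linarith
      have hnorm : (n : ℝ) ≤ ‖w + (n + 1 : ℕ)‖ := by
        refine le_trans ?_ (Complex.re_le_norm _)
        simp
        linarith
      have h1 := norm_deriv_stirlingLog_sub_log_le hre
      have h2 : Complex.log (w + (n + 1 : ℕ)) - Complex.log n = Complex.log (1 + (w + 1) / n) := by
        have hn0 : (n : ℂ) ≠ 0 := by
          have : n ≠ 0 := by omega
          exact_mod_cast this
        have e : w + (n + 1 : ℕ) = ((n : ℝ) : ℂ) * (1 + (w + 1) / n) := by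
          push_cast
          field_simp
          ring
        have hne : 1 + (w + 1) / n ≠ 0 := fun h => by
          rw [h, mul_zero] at e
          rw [e] at hre
          norm_num at hre
        rw [e, Complex.log_ofReal_mul (by linarith) hne, Complex.natCast_log.symm]
        ring
      have h3 : ‖(w + 1) / (n : ℂ)‖ ≤ B / n := by
        rw [norm_div, Complex.norm_natCast]
        gcongr
        refine (norm_add_le _ _).trans ?_
        rw [norm_one]
        linarith
      have h4 : B / n ≤ 1 / 2 := by
        rw [div_le_div_iff₀ (by linarith) two_pos]
        linarith
      have h5 := Complex.norm_log_one_add_half_le_self (h3.trans h4)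
      have e : deriv stirlingLog (w + (n + 1 : ℕ)) - Complex.log n
          = (deriv stirlingLog (w + (n + 1 : ℕ)) - Complex.log (w + (n + 1 : ℕ)))
            + Complex.log (1 + (w + 1) / n) := by rw [← h2]; ring
      rw [e]
      refine (norm_add_le _ _).trans ?_
      have h6 : 17 / ‖w + (n + 1 : ℕ)‖ ≤ 17 / n := by gcongr
      have h7 : (17 + 2 * B) / n = 17 / n + 2 * (B / n) := by ring
      have h8 : 0 ≤ B / n := by positivity
      rw [h7]
      linarith
    have h := (convex_segment (4 : ℂ) s).norm_image_sub_le_of_norm_hasDerivWithin_le hder hdb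
      (left_mem_segment ℝ _ _) (right_mem_segment ℝ _ _)
    have e : stirlingLog (s + (n + 1 : ℕ)) - stirlingLog (4 + (n + 1 : ℕ)) - (s - 4) * Complex.log n
        = (stirlingLog (s + (n + 1 : ℕ)) - s * Complex.log n)
          - (stirlingLog (4 + (n + 1 : ℕ)) - 4 * Complex.log n) := by ring
    rw [e]
    refine h.trans (le_of_eq ?_)
    ring
  exact squeeze_zero_norm' hbound (tendsto_const_div_atTop_nhds_zero_nat _)

/-- Stirling's formula: `exp ∘ stirlingLog` is a constant multiple of the Gamma function. -/
lemma Gamma_eq_const_mul_exp : ∃ c : ℂ, c ≠ 0 ∧ ∀ s : ℂ, 3 < s.re →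
    Complex.Gamma s = c * Complex.exp (stirlingLog s) := by
  have hG4 : Complex.Gamma 4 ≠ 0 := Complex.Gamma_ne_zero_of_re_pos (by norm_num)
  refine ⟨Complex.Gamma 4 / Complex.exp (stirlingLog 4), div_ne_zero hG4 (Complex.exp_ne_zero _),
    fun s hs => ?_⟩
  have hlim := (Complex.continuous_exp.tendsto 0).comp (tendsto_stirlingLog_sub hs)
  rw [Complex.exp_zero] at hlim
  -- both sides satisfy the functional equation and have the same growth along `s + ℕ`, which is
  -- compared through Euler's limit formula
  have hs' := Complex.GammaSeq_tendsto_Gamma s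
  have h4' := Complex.GammaSeq_tendsto_Gamma 4
  have hprod := (hs'.mul hlim).mul (tendsto_const_nhds (x := Complex.exp (stirlingLog 4)))
  have hprod2 := h4'.mul (tendsto_const_nhds (x := Complex.exp (stirlingLog s)))
  have hEq : ∀ᶠ n : ℕ in atTop, Complex.GammaSeq s n * (Complex.exp ∘ fun n : ℕ =>
      stirlingLog (s + (n + 1 : ℕ)) - stirlingLog (4 + (n + 1 : ℕ)) - (s - 4) * Complex.log n) n
      * Complex.exp (stirlingLog 4) = Complex.GammaSeq 4 n * Complex.exp (stirlingLog s) := by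
    filter_upwards [eventually_gt_atTop 0] with n hn
    have hn0 : (n : ℂ) ≠ 0 := by exact_mod_cast hn.ne'
    have hne : ∀ s : ℂ, 3 < s.re → ∏ j ∈ Finset.range (n + 1), (s + j) ≠ 0 := by
      intro s hs
      refine Finset.prod_ne_zero_iff.2 fun j _ h => ?_
      have := congrArg Complex.re h
      simp at this
      linarith [(Nat.cast_nonneg j : (0 : ℝ) ≤ j)]
    have h1 := hne s hs
    have h2 := hne 4 (by norm_num)
    simp only [Function.comp_apply, Complex.GammaSeq]
    rw [Complex.exp_sub, Complex.exp_sub, exp_stirlingLog_add_nat (by linarith),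
      exp_stirlingLog_add_nat (s := 4) (by norm_num), Complex.cpow_def_of_ne_zero hn0,
      Complex.cpow_def_of_ne_zero hn0, sub_mul, Complex.exp_sub]
    have h3 := Complex.exp_ne_zero (stirlingLog 4)
    rw [mul_comm (Complex.log n) s, mul_comm (Complex.log n) 4]
    have h5 := Complex.exp_ne_zero (s * Complex.log n)
    have h6 := Complex.exp_ne_zero (4 * Complex.log n)
    field_simp
  have := tendsto_nhds_unique (hprod.congr' hEq) hprod2
  rw [mul_one] at this
  have h3 := Complex.exp_ne_zero (stirlingLog 4)
  field_simp
  exact this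

/-! ### `H_0` in terms of the Gamma and zeta functions -/

lemma image_mul_exp_four_mul {c : ℝ} (hc : 0 < c) :
    (fun u : ℝ => c * Real.exp (4 * u)) '' univ = Ioi 0 := by
  ext x
  simp only [image_univ, mem_range, mem_Ioi]
  refine ⟨fun ⟨u, hu⟩ => hu ▸ by positivity, fun hx => ⟨Real.log (x / c) / 4, ?_⟩⟩
  rw [mul_div_cancel₀ _ (by norm_num), Real.exp_log (by positivity)]
  field_simp

lemma gammaKernel_comp {c : ℝ} (hc : 0 < c) (w : ℂ) (u : ℝ) :
    |c * (4 * Real.exp (4 * u))| • (((Real.exp (-(c * Real.exp (4 * u))) : ℝ) : ℂ)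
      * ((c * Real.exp (4 * u) : ℝ) : ℂ) ^ (w - 1))
      = 4 * (c : ℂ) ^ w * Complex.exp (4 * w * u - c * Real.exp (4 * u)) := by
  have hx : 0 < c * Real.exp (4 * u) := by positivity
  have hxc : ((c * Real.exp (4 * u) : ℝ) : ℂ) ≠ 0 := by exact_mod_cast hx.ne'
  have hcc : (c : ℂ) ≠ 0 := by exact_mod_cast hc.ne'
  rw [abs_of_pos (by positivity), Complex.real_smul, Complex.cpow_sub _ _ hxc, Complex.cpow_one,
    Complex.ofReal_mul c (Real.exp (4 * u)),
    Complex.mul_cpow_ofReal_nonneg hc.le (Real.exp_pos _).le]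
  have he : ((Real.exp (4 * u) : ℝ) : ℂ) ^ w = Complex.exp (4 * w * u) := by
    rw [Complex.cpow_def_of_ne_zero (by exact_mod_cast (Real.exp_pos _).ne'), ← Complex.ofReal_log
      (Real.exp_pos _).le, Real.log_exp]
    congr 1
    push_cast
    ring
  rw [he, Complex.exp_sub, Complex.ofReal_exp (-(c * Real.exp (4 * u))), Complex.ofReal_neg,
    Complex.exp_neg]
  have h1 := Complex.exp_ne_zero (((c * Real.exp (4 * u) : ℝ)) : ℂ)
  have h2 : ((Real.exp (4 * u) : ℝ) : ℂ) ≠ 0 := by exact_mod_cast (Real.exp_pos _).ne'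
  push_cast at *
  field_simp

lemma integrable_cexp_sub_exp {c : ℝ} (hc : 0 < c) {w : ℂ} (hw : 0 < w.re) :
    Integrable (fun u : ℝ => Complex.exp (4 * w * u - c * Real.exp (4 * u))) ∧
      ∫ u : ℝ, Complex.exp (4 * w * u - c * Real.exp (4 * u))
        = Complex.Gamma w / (4 * (c : ℂ) ^ w) := by
  have hder : ∀ u ∈ (univ : Set ℝ), HasDerivWithinAt (fun u : ℝ => c * Real.exp (4 * u))
      (c * (4 * Real.exp (4 * u))) univ u := fun u _ =>
    ((hasDerivAt_exp_four_mul u).const_mul c).hasDerivWithinAt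
  have hinj : InjOn (fun u : ℝ => c * Real.exp (4 * u)) univ := by
    intro a _ b _ hab
    have h1 : c * Real.exp (4 * a) = c * Real.exp (4 * b) := hab
    have := Real.exp_injective (mul_left_cancel₀ hc.ne' h1)
    linarith
  have hcc : 4 * (c : ℂ) ^ w ≠ 0 :=
    mul_ne_zero (by norm_num) ((Complex.cpow_ne_zero_iff_of_exponent_ne_zero
      (fun h => by simp [h] at hw)).2 (by exact_mod_cast hc.ne'))
  have hI := Complex.GammaIntegral_convergent hw
  rw [← image_mul_exp_four_mul hc,
    integrableOn_image_iff_integrableOn_abs_deriv_smul MeasurableSet.univ hder hinj] at hI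
  simp only [gammaKernel_comp hc, integrableOn_univ] at hI
  have hE := integral_image_eq_integral_abs_deriv_smul MeasurableSet.univ hder hinj
    (fun x : ℝ => ((Real.exp (-x) : ℝ) : ℂ) * (x : ℂ) ^ (w - 1))
  rw [image_mul_exp_four_mul hc] at hE
  simp only [gammaKernel_comp hc, setIntegral_univ] at hE
  have hG : Complex.Gamma w = ∫ x in Ioi (0 : ℝ), ((Real.exp (-x) : ℝ) : ℂ) * (x : ℂ) ^ (w - 1) :=
    Complex.Gamma_eq_integral hw
  rw [← hG, integral_const_mul] at hE
  refine ⟨?_, ?_⟩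
  · refine (hI.const_mul (4 * (c : ℂ) ^ w)⁻¹).congr (Eventually.of_forall fun u => ?_)
    simp only
    rw [inv_mul_cancel_left₀ hcc]
  · rw [hE, mul_div_cancel_left₀ _ hcc]

lemma integral_norm_cexp_sub_exp {c : ℝ} (hc : 0 < c) {w : ℂ} (hw : 0 < w.re) :
    ∫ u : ℝ, ‖Complex.exp (4 * w * u - c * Real.exp (4 * u))‖
      = ‖Complex.Gamma w.re‖ / (4 * c ^ w.re) := by
  have h := (integrable_cexp_sub_exp hc (w := (w.re : ℂ)) (by simpa using hw)).2
  have e : ∀ u : ℝ, Complex.exp (4 * (w.re : ℂ) * u - c * Real.exp (4 * u))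
      = ((‖Complex.exp (4 * w * u - c * Real.exp (4 * u))‖ : ℝ) : ℂ) := by
    intro u
    have hre : (4 * w * u - c * Real.exp (4 * u) : ℂ).re = 4 * w.re * u - c * Real.exp (4 * u) := by
      rw [Complex.sub_re, ← Complex.ofReal_mul, Complex.ofReal_re, Complex.re_mul_ofReal]
      simp
    rw [Complex.norm_exp, hre]
    push_cast
    rfl
  simp only [e] at h
  rw [integral_complex_ofReal] at h
  have h2 := congrArg norm h
  rw [Complex.norm_real, Real.norm_of_nonneg (integral_nonneg fun u => norm_nonneg _)] at h2
  rw [h2, norm_div, norm_mul, Complex.norm_cpow_eq_rpow_re_of_pos hc]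
  simp

/-- The integrand of the `n`-th term of `H_0(iw)`, in terms of Gamma kernels with
`c = π (n + 1)²`. -/
def phiTerm (w : ℂ) (n : ℕ) (u : ℝ) : ℂ :=
  (Real.pi * ((n : ℝ) + 1) ^ 2 : ℝ) ^ 2 * Complex.exp (4 * ((w + 9) / 4) * u
      - (Real.pi * ((n : ℝ) + 1) ^ 2 : ℝ) * Real.exp (4 * u))
    - 3 / 2 * (Real.pi * ((n : ℝ) + 1) ^ 2 : ℝ) * Complex.exp (4 * ((w + 5) / 4) * u
      - (Real.pi * ((n : ℝ) + 1) ^ 2 : ℝ) * Real.exp (4 * u))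

lemma hasSum_phiTerm (w : ℂ) (u : ℝ) :
    HasSum (fun n => phiTerm w n u) (Complex.exp (w * u) * weight 0 u) := by
  have h := (hasSum_Phi u).mapL Complex.ofRealCLM
  rw [← Phi_eq_thetaSeries] at h
  have h2 := h.mul_left (Complex.exp (w * u) / 2)
  have e : Complex.exp (w * u) * weight 0 u = Complex.exp (w * u) / 2 * Complex.ofRealCLM (Phi u) := by
    simp [weight]
    ring
  rw [e]
  refine Eq.mpr (congrArg (fun f => HasSum f _) (funext fun n => ?_)) h2
  have e1 : Complex.exp (4 * ((w + 9) / 4) * u - (Real.pi * ((n : ℝ) + 1) ^ 2 : ℝ) * Real.exp (4 * u))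
      = Complex.exp (w * u) * Complex.exp (9 * u)
        * Complex.exp (-(Real.pi : ℂ) * ((n : ℂ) + 1) ^ 2 * Complex.exp (4 * u)) := by
    rw [← Complex.exp_add, ← Complex.exp_add]
    push_cast
    ring_nf
  have e2 : Complex.exp (4 * ((w + 5) / 4) * u - (Real.pi * ((n : ℝ) + 1) ^ 2 : ℝ) * Real.exp (4 * u))
      = Complex.exp (w * u) * Complex.exp (5 * u)
        * Complex.exp (-(Real.pi : ℂ) * ((n : ℂ) + 1) ^ 2 * Complex.exp (4 * u)) := by
    rw [← Complex.exp_add, ← Complex.exp_add]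
    push_cast
    ring_nf
  rw [phiTerm, e1, e2]
  simp only [Complex.ofRealCLM_apply]
  push_cast
  ring

lemma integral_phiTerm {w : ℂ} (hw : 1 < w.re) (n : ℕ) :
    Integrable (phiTerm w n) ∧ ∫ u, phiTerm w n u
      = 1 / 8 * ((w - 1) / 2) * Complex.Gamma ((w + 5) / 4) * (Real.pi : ℂ) ^ (-(w + 1) / 4)
        * (1 / ((n : ℂ) + 1) ^ ((w + 1) / 2)) := by
  set c : ℝ := Real.pi * ((n : ℝ) + 1) ^ 2
  have hc : 0 < c := by positivity
  have hcc : (c : ℂ) ≠ 0 := by exact_mod_cast hc.ne'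
  set b : ℂ := (w + 5) / 4 with hb
  have hbre : 0 < b.re := by
    have : b.re = (w.re + 5) / 4 := by simp [hb]
    rw [this]
    linarith
  have hb0 : b ≠ 0 := fun h => by simp [h] at hbre
  have ha : (w + 9) / 4 = b + 1 := by rw [hb]; ring
  obtain ⟨hI1, hE1⟩ := integrable_cexp_sub_exp hc (w := b + 1)
    (by rw [Complex.add_re, Complex.one_re]; linarith)
  obtain ⟨hI2, hE2⟩ := integrable_cexp_sub_exp hc hbre
  have hI1' := hI1.const_mul ((c : ℂ) ^ 2)
  have hI2' := hI2.const_mul (3 / 2 * (c : ℂ))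
  have e : phiTerm w n = fun u : ℝ => (c : ℂ) ^ 2 *
      Complex.exp (4 * (b + 1) * u - c * Real.exp (4 * u))
      - 3 / 2 * (c : ℂ) * Complex.exp (4 * b * u - c * Real.exp (4 * u)) := by
    ext u
    rw [phiTerm, ha]
  rw [e]
  refine ⟨hI1'.sub hI2', ?_⟩
  rw [integral_sub hI1' hI2', integral_const_mul, integral_const_mul, hE1, hE2,
    Complex.Gamma_add_one b hb0, Complex.cpow_add _ _ hcc, Complex.cpow_one]
  have hn : (0 : ℝ) ≤ (n : ℝ) + 1 := by positivity
  have hn0 : ((n : ℂ) + 1) ≠ 0 := by exact_mod_cast (Nat.succ_ne_zero n)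
  have hcb : (c : ℂ) ^ b = c * ((Real.pi : ℂ) ^ (-(w + 1) / 4)
      * (1 / ((n : ℂ) + 1) ^ ((w + 1) / 2)))⁻¹ := by
    have h1 : (c : ℂ) ^ b * (c : ℂ) ^ (-(w + 1) / 4) = c := by
      rw [← Complex.cpow_add _ _ hcc, show b + -(w + 1) / 4 = 1 by rw [hb]; ring, Complex.cpow_one]
    have h2 : (c : ℂ) ^ (-(w + 1) / 4) = (Real.pi : ℂ) ^ (-(w + 1) / 4)
        * (1 / ((n : ℂ) + 1) ^ ((w + 1) / 2)) := by
      have e1 : (c : ℂ) = ((Real.pi : ℝ) : ℂ) * ((((n : ℝ) + 1) * ((n : ℝ) + 1) : ℝ) : ℂ) := by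
        simp only [c]
        push_cast
        ring
      rw [e1, Complex.mul_cpow_ofReal_nonneg Real.pi_pos.le (by positivity), Complex.ofReal_mul,
        Complex.mul_cpow_ofReal_nonneg hn hn]
      push_cast
      rw [← Complex.cpow_add _ _ hn0, one_div, ← Complex.cpow_neg]
      congr 2
      ring
    have h3 : (c : ℂ) ^ (-(w + 1) / 4) ≠ 0 := by
      rw [Complex.cpow_def_of_ne_zero hcc]
      exact Complex.exp_ne_zero _
    rw [← h2]
    exact (eq_mul_inv_iff_mul_eq₀ h3).2 h1
  rw [hcb]
  have hp : (Real.pi : ℂ) ^ (-(w + 1) / 4) ≠ 0 := by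
    rw [Complex.cpow_def_of_ne_zero (by exact_mod_cast Real.pi_ne_zero)]
    exact Complex.exp_ne_zero _
  have hq : ((n : ℂ) + 1) ^ ((w + 1) / 2) ≠ 0 := by
    rw [Complex.cpow_def_of_ne_zero hn0]
    exact Complex.exp_ne_zero _
  field_simp
  rw [hb]
  ring

lemma summable_integral_norm_phiTerm {w : ℂ} (hw : 1 < w.re) :
    Summable fun n => ∫ u, ‖phiTerm w n u‖ := by
  have hbre : ((w + 5) / 4).re = (w.re + 5) / 4 := by simp
  have hare : ((w + 9) / 4).re = (w.re + 5) / 4 + 1 := by simp; ring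
  set σ := (w.re + 5) / 4 with hσ
  set K := ‖Complex.Gamma ((σ + 1 : ℝ) : ℂ)‖ + 2 * ‖Complex.Gamma (σ : ℂ)‖
  have hs : Summable fun n : ℕ => K * ((n : ℝ) + 1) ^ (-((w.re + 1) / 2)) := by
    have h := (summable_nat_add_iff 1).2
      (Real.summable_nat_rpow (p := -((w.re + 1) / 2)).2 (by linarith))
    refine (h.mul_left K).congr fun n => ?_
    push_cast
    rfl
  refine Summable.of_nonneg_of_le (fun n => integral_nonneg fun u => norm_nonneg _) (fun n => ?_) hs
  set c : ℝ := Real.pi * ((n : ℝ) + 1) ^ 2 with hcdef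
  have hc : 0 < c := by positivity
  have h1 : 0 < ((w + 9) / 4).re := by rw [hare]; linarith
  have h2 : 0 < ((w + 5) / 4).re := by rw [hbre]; linarith
  have hI1 := ((integrable_cexp_sub_exp hc h1).1.norm.const_mul (c ^ 2))
  have hI2 := ((integrable_cexp_sub_exp hc h2).1.norm.const_mul (3 / 2 * c))
  have hle : ∫ u, ‖phiTerm w n u‖ ≤ ∫ u : ℝ,
      (c ^ 2 * ‖Complex.exp (4 * ((w + 9) / 4) * u - c * Real.exp (4 * u))‖
        + 3 / 2 * c * ‖Complex.exp (4 * ((w + 5) / 4) * u - c * Real.exp (4 * u))‖) := by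
    refine integral_mono (integral_phiTerm hw n).1.norm (hI1.add hI2) fun u => ?_
    have e : phiTerm w n u = (c : ℂ) ^ 2 *
        Complex.exp (4 * ((w + 9) / 4) * u - c * Real.exp (4 * u))
        - 3 / 2 * (c : ℂ) * Complex.exp (4 * ((w + 5) / 4) * u - c * Real.exp (4 * u)) := rfl
    have e32 : ‖(3 / 2 : ℂ)‖ = 3 / 2 := by norm_num
    rw [e]
    refine (norm_sub_le _ _).trans (le_of_eq ?_)
    rw [norm_mul, norm_mul (3 / 2 * (c : ℂ)), norm_mul (3 / 2 : ℂ), norm_pow, Complex.norm_real,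
      Real.norm_of_nonneg hc.le, e32]
  refine hle.trans ?_
  rw [integral_add hI1 hI2, integral_const_mul, integral_const_mul, integral_norm_cexp_sub_exp hc h1,
    integral_norm_cexp_sub_exp hc h2, hare, hbre]
  have hcσ : c ^ (σ + 1) = c ^ σ * c := by rw [Real.rpow_add hc, Real.rpow_one]
  have hpow : c / c ^ σ ≤ ((n : ℝ) + 1) ^ (-((w.re + 1) / 2)) := by
    have hn : (0 : ℝ) < (n : ℝ) + 1 := by positivity
    have e1 : c / c ^ σ = c ^ (-((w.re + 1) / 4)) := by
      rw [← Real.rpow_one_sub' hc.le (by rw [hσ]; linarith)]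
      congr 1
      rw [hσ]
      ring
    have e2 : ((n : ℝ) + 1) ^ (-((w.re + 1) / 2)) = (((n : ℝ) + 1) ^ 2) ^ (-((w.re + 1) / 4)) := by
      rw [← Real.rpow_natCast, ← Real.rpow_mul hn.le]
      congr 1
      push_cast
      ring
    rw [e1, e2]
    refine Real.rpow_le_rpow_of_nonpos (by positivity) ?_ (by linarith)
    rw [hcdef]
    have := Real.pi_gt_three
    nlinarith [sq_nonneg ((n : ℝ) + 1)]
  have hcs : 0 < c ^ σ := Real.rpow_pos_of_pos hc _
  have hG1 := norm_nonneg (Complex.Gamma ((σ + 1 : ℝ) : ℂ))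
  have hG2 := norm_nonneg (Complex.Gamma (σ : ℂ))
  have e3 : c ^ 2 * (‖Complex.Gamma ((σ + 1 : ℝ) : ℂ)‖ / (4 * c ^ (σ + 1)))
      + 3 / 2 * c * (‖Complex.Gamma (σ : ℂ)‖ / (4 * c ^ σ))
      = (‖Complex.Gamma ((σ + 1 : ℝ) : ℂ)‖ / 4 + 3 / 8 * ‖Complex.Gamma (σ : ℂ)‖)
        * (c / c ^ σ) := by
    rw [hcσ]
    field_simp
    ring
  rw [e3]
  have h0 : 0 ≤ c / c ^ σ := by positivity
  refine mul_le_mul ?_ hpow h0 (by positivity)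
  simp only [K]
  linarith

/-- `H_0` is the completed zeta function. -/
lemma H_zero_eq {w : ℂ} (hw : 1 < w.re) :
    H 0 (Complex.I * w) = 1 / 8 * ((w - 1) / 2) * Complex.Gamma ((w + 5) / 4)
      * (Real.pi : ℂ) ^ (-(w + 1) / 4) * riemannZeta ((w + 1) / 2) := by
  have h := hasSum_integral_of_summable_integral_norm (fun n => (integral_phiTerm hw n).1)
    (summable_integral_norm_phiTerm hw)
  have h1 : H 0 (Complex.I * w) = ∫ u, ∑' n, phiTerm w n u := by
    rw [← H_neg, H_eq_fourierExp, fourierExp]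
    congr 1
    ext u
    rw [(hasSum_phiTerm w u).tsum_eq]
    congr 2
    linear_combination (-(w * u)) * Complex.I_mul_I
  rw [h1, ← h.tsum_eq, zeta_eq_tsum_one_div_nat_add_one_cpow (by simp; linarith), ← tsum_mul_left]
  exact tsum_congr fun n => (integral_phiTerm hw n).2

/-! ### The logarithm of `H_0` in a half-plane -/

lemma norm_riemannZeta_sub_one_le {s : ℂ} (hs : 2 ≤ s.re) :
    ‖riemannZeta s - 1‖ ≤ 4 * (2 : ℝ) ^ (-s.re) := by
  have h2 : HasSum (fun n : ℕ => 1 / ((n : ℝ) + 2) ^ 2) (Real.pi ^ 2 / 6 - 1) := by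
    have h := (hasSum_nat_add_iff' 2).2 hasSum_zeta_two
    simp only [Finset.sum_range_succ, Finset.sum_range_zero] at h
    norm_num at h
    simpa using h
  have hsum : Summable fun n : ℕ => 1 / ((n : ℂ) + 1) ^ s := by
    have h := (summable_nat_add_iff 1).2 (Complex.summable_one_div_nat_cpow (p := s)|>.2
      (by linarith))
    refine h.congr fun n => ?_
    push_cast
    rfl
  rw [zeta_eq_tsum_one_div_nat_add_one_cpow (by linarith), hsum.tsum_eq_zero_add]
  simp only [Nat.cast_zero, zero_add, Complex.one_cpow, div_one, add_sub_cancel_left]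
  have hb : ∀ n : ℕ, ‖1 / (((n + 1 : ℕ) : ℂ) + 1) ^ s‖
      ≤ (4 * (2 : ℝ) ^ (-s.re)) * (1 / ((n : ℝ) + 2) ^ 2) := by
    intro n
    have hn : (0 : ℝ) ≤ n := n.cast_nonneg
    have e : ((n + 1 : ℕ) : ℂ) + 1 = (((n : ℝ) + 2 : ℝ) : ℂ) := by
      push_cast
      ring
    rw [e, norm_div, norm_one, Complex.norm_cpow_eq_rpow_re_of_pos (by linarith), one_div,
      ← Real.rpow_neg (by linarith)]
    have e2 : ((n : ℝ) + 2) ^ (-s.re)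
        = ((n : ℝ) + 2) ^ (-(s.re - 2)) * (1 / ((n : ℝ) + 2) ^ 2) := by
      rw [one_div, ← Real.rpow_natCast, ← Real.rpow_neg (by linarith), ← Real.rpow_add (by linarith)]
      congr 1
      push_cast
      ring
    have e3 : (4 : ℝ) * (2 : ℝ) ^ (-s.re) = (2 : ℝ) ^ (-(s.re - 2)) := by
      rw [show (4 : ℝ) = (2 : ℝ) ^ (2 : ℝ) by norm_num, ← Real.rpow_add two_pos]
      congr 1
      ring
    rw [e2, e3]
    gcongr ?_ * _
    exact Real.rpow_le_rpow_of_nonpos two_pos (by linarith) (by linarith)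
  refine (tsum_of_norm_bounded (h2.mul_left _) hb).trans ?_
  have hpi : Real.pi ^ 2 / 6 - 1 ≤ 1 := by nlinarith [Real.pi_lt_d2, Real.pi_gt_three]
  have h0 : (0 : ℝ) ≤ 4 * (2 : ℝ) ^ (-s.re) := by positivity
  nlinarith

lemma two_rpow_neg_le {a b : ℝ} (h : a ≤ b) : (2 : ℝ) ^ (-b) ≤ (2 : ℝ) ^ (-a) :=
  Real.rpow_le_rpow_of_exponent_le one_le_two (neg_le_neg h)

lemma norm_riemannZeta_sub_one_le_quarter {s : ℂ} (hs : 4 ≤ s.re) :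
    ‖riemannZeta s - 1‖ ≤ 1 / 4 := by
  refine (norm_riemannZeta_sub_one_le (by linarith)).trans ?_
  have h := two_rpow_neg_le hs
  have e : (2 : ℝ) ^ (-(4 : ℝ)) = 1 / 16 := by
    rw [Real.rpow_neg two_pos.le]
    norm_num
  rw [e] at h
  linarith

/-- The logarithm of the zeta function far to the right. -/
def logZeta (s : ℂ) : ℂ := Complex.log (riemannZeta s)

lemma riemannZeta_mem_slitPlane {s : ℂ} (hs : 4 ≤ s.re) : riemannZeta s ∈ Complex.slitPlane := by
  have h := norm_riemannZeta_sub_one_le_quarter hs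
  have := Complex.mem_slitPlane_of_norm_lt_one (z := riemannZeta s - 1) (by linarith)
  simpa using this

lemma differentiableOn_logZeta : DifferentiableOn ℂ logZeta {s | 4 < s.re} := by
  intro s hs
  have hs' : 4 < s.re := hs
  have h1 : s ≠ 1 := fun h => by rw [h] at hs'; norm_num at hs'
  exact ((differentiableAt_riemannZeta h1).clog
    (riemannZeta_mem_slitPlane hs'.le)).differentiableWithinAt

lemma norm_logZeta_le {s : ℂ} (hs : 4 ≤ s.re) : ‖logZeta s‖ ≤ 6 * (2 : ℝ) ^ (-s.re) := by
  have h := norm_riemannZeta_sub_one_le_quarter hs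
  have h1 := Complex.norm_log_one_add_half_le_self (z := riemannZeta s - 1) (by linarith)
  rw [add_sub_cancel] at h1
  have h2 := norm_riemannZeta_sub_one_le (s := s) (by linarith)
  rw [logZeta]
  linarith

lemma norm_deriv_le_of_norm_le_two_rpow {f : ℂ → ℂ} {a C : ℝ}
    (hf : DifferentiableOn ℂ f {s | a < s.re})
    (hfC : ∀ s : ℂ, a < s.re → ‖f s‖ ≤ C * (2 : ℝ) ^ (-s.re)) {s : ℂ} (hs : a + 1 < s.re) :
    ‖deriv f s‖ ≤ 2 * C * (2 : ℝ) ^ (-s.re) := by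
  have hre : ∀ w ∈ Metric.closedBall s 1, s.re - 1 ≤ w.re := by
    intro w hw
    have h1 : ‖w - s‖ ≤ 1 := by simpa [dist_eq_norm] using hw
    have h2 := (abs_le.1 ((Complex.abs_re_le_norm (w - s)).trans h1)).1
    rw [Complex.sub_re] at h2
    linarith
  have h0 : 0 ≤ C := by
    have h := (norm_nonneg _).trans (hfC s (by linarith))
    have : (0 : ℝ) < 2 ^ (-s.re) := by positivity
    by_contra hc
    exact absurd h (not_le.2 (mul_neg_of_neg_of_pos (not_le.1 hc) this))
  have h := Complex.norm_deriv_le_of_forall_mem_sphere_norm_le (c := s) (R := 1) (f := f)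
    (C := 2 * C * (2 : ℝ) ^ (-s.re)) one_pos ?_ fun w hw => ?_
  · simpa using h
  · refine DifferentiableOn.diffContOnCl (s := Metric.ball s 1) (hf.mono fun w hw => ?_)
    rw [closure_ball s one_ne_zero] at hw
    have := hre w hw
    simp only [mem_ofPred_eq]
    linarith
  · have hw' := hre w (Metric.sphere_subset_closedBall hw)
    refine (hfC w (by linarith)).trans ?_
    have h1 := two_rpow_neg_le hw'
    have e : (2 : ℝ) ^ (-(s.re - 1)) = 2 * (2 : ℝ) ^ (-s.re) := by
      rw [show -(s.re - 1) = 1 + -s.re by ring, Real.rpow_add two_pos, Real.rpow_one]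
    rw [e] at h1
    calc _ ≤ C * (2 * (2 : ℝ) ^ (-s.re)) := by gcongr
      _ = _ := by ring

lemma norm_deriv_logZeta_le {s : ℂ} (hs : 5 < s.re) :
    ‖deriv logZeta s‖ ≤ 12 * (2 : ℝ) ^ (-s.re) := by
  have := norm_deriv_le_of_norm_le_two_rpow differentiableOn_logZeta
    (fun s hs => norm_logZeta_le (le_of_lt hs)) (s := s) (by linarith)
  norm_num at this ⊢
  exact this

lemma norm_deriv_deriv_logZeta_le {s : ℂ} (hs : 6 < s.re) :
    ‖deriv (deriv logZeta) s‖ ≤ 24 * (2 : ℝ) ^ (-s.re) := by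
  have hd : DifferentiableOn ℂ (deriv logZeta) {s | 5 < s.re} :=
    (differentiableOn_logZeta.deriv (isOpen_lt continuous_const Complex.continuous_re)).mono
      fun s (hs : 5 < s.re) => by simp; linarith
  have := norm_deriv_le_of_norm_le_two_rpow hd
    (fun s hs => norm_deriv_logZeta_le hs) (s := s) (by linarith)
  norm_num at this ⊢
  exact this

/-- A logarithm of `w ↦ H_0(iw)` in the half-plane `Re w > 11`, up to an additive constant. -/
def logH (w : ℂ) : ℂ := Complex.log ((w - 1) / 2) - (w + 1) / 4 * Complex.log Real.pi
  + stirlingLog ((w + 5) / 4) + logZeta ((w + 1) / 2)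

/-- The relative size of the errors in the asymptotics of `H_0`. -/
def errSize (w : ℂ) : ℝ := 1 / ‖w‖ + Real.exp (-w.re / 4)

lemma exists_H_zero_eq : ∃ k : ℂ, ∀ w : ℂ, 11 < w.re →
    H 0 (Complex.I * w) = Complex.exp (k + logH w) := by
  obtain ⟨c, hc, hG⟩ := Gamma_eq_const_mul_exp
  refine ⟨Complex.log (c / 8), fun w hw => ?_⟩
  have h5 : 3 < ((w + 5) / 4).re := by simp; linarith
  have h1 : 4 ≤ ((w + 1) / 2).re := by simp; linarith
  have hw1 : (w - 1) / 2 ≠ 0 := fun h => by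
    have := congrArg Complex.re h
    simp at this
    linarith
  have hz : riemannZeta ((w + 1) / 2) ≠ 0 :=
    Complex.slitPlane_ne_zero (riemannZeta_mem_slitPlane h1)
  rw [H_zero_eq (by linarith), hG _ h5, logH, logZeta, Complex.exp_add, Complex.exp_add,
    Complex.exp_add, Complex.exp_sub, Complex.exp_log (div_ne_zero hc (by norm_num)),
    Complex.exp_log hw1, Complex.exp_log hz, Complex.cpow_def_of_ne_zero
      (by exact_mod_cast Real.pi_ne_zero)]
  rw [show Complex.log Real.pi * (-(w + 1) / 4) = -((w + 1) / 4 * Complex.log Real.pi) by ring,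
    Complex.exp_neg]
  ring

lemma hasDerivAt_logH {w : ℂ} (hw : 11 < w.re) :
    HasDerivAt logH (1 / (w - 1) - 1 / 4 * Complex.log Real.pi
      + 1 / 4 * deriv stirlingLog ((w + 5) / 4) + 1 / 2 * deriv logZeta ((w + 1) / 2)) w := by
  have h5 : 2 < ((w + 5) / 4).re := by simp; linarith
  have h1 : 4 < ((w + 1) / 2).re := by simp; linarith
  have hs : (w - 1) / 2 ∈ Complex.slitPlane := Or.inl (by simp; linarith)
  have hw1 : w - 1 ≠ 0 := fun h => by
    have := congrArg Complex.re h
    simp at this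
    linarith
  have d1 := (((hasDerivAt_id' w).sub_const 1).div_const 2).clog hs
  have d2 := (((hasDerivAt_id' w).add_const 1).div_const 4).mul_const (Complex.log Real.pi)
  have d3 := (hasDerivAt_stirlingLog h5).differentiableAt.hasDerivAt.comp w
    (((hasDerivAt_id' w).add_const 5).div_const 4)
  have d4 := (differentiableOn_logZeta.differentiableAt
    ((isOpen_lt continuous_const Complex.continuous_re).mem_nhds h1)).hasDerivAt.comp w
    (((hasDerivAt_id' w).add_const 1).div_const 2)
  refine (((d1.sub d2).add d3).add d4).congr_deriv ?_
  field_simp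

lemma log_add_five_div_four {w : ℂ} (hw : 11 < w.re) :
    Complex.log ((w + 5) / 4) - Complex.log (w / (4 * Real.pi)) - Complex.log Real.pi
      = Complex.log (1 + 5 / w) := by
  have hw0 : w ≠ 0 := fun h => by rw [h] at hw; norm_num at hw
  have hpi := Real.pi_pos
  have hpi0 : (Real.pi : ℂ) ≠ 0 := by exact_mod_cast hpi.ne'
  have e1 : w / 4 = (Real.pi : ℝ) * (w / (4 * Real.pi)) := by field_simp
  have e2 : (w + 5) / 4 = w / 4 * (1 + 5 / w) := by field_simp
  have hn : w / (4 * Real.pi) ≠ 0 := div_ne_zero hw0 (mul_ne_zero (by norm_num) hpi0)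
  have h1 : 0 < (w / 4).re := by simp; linarith
  have h2 : 0 < (1 + 5 / w).re := by
    have : 0 < ((5 : ℝ) / w : ℂ).re := by
      rw [Complex.div_re]
      simp only [Complex.ofReal_re, Complex.ofReal_im, zero_mul, zero_div, add_zero]
      have := Complex.normSq_pos.2 hw0
      positivity
    rw [Complex.add_re, Complex.one_re]
    push_cast at this
    linarith
  have h3 := abs_lt.1 (Complex.abs_arg_lt_pi_div_two_iff.2 (Or.inl h1))
  have h4 := abs_lt.1 (Complex.abs_arg_lt_pi_div_two_iff.2 (Or.inl h2))
  have n1 : w / 4 ≠ 0 := fun h => by rw [h] at h1; exact lt_irrefl _ h1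
  have n2 : 1 + 5 / w ≠ 0 := fun h => by rw [h] at h2; exact lt_irrefl _ h2
  rw [e2, Complex.log_mul n1 n2 ⟨by linarith [h3.1, h4.1], by linarith [h3.2, h4.2]⟩, e1,
    Complex.log_ofReal_mul hpi hn, Complex.ofReal_log hpi.le]
  ring

lemma two_rpow_le_exp {w : ℂ} (hw : 0 < w.re) :
    (2 : ℝ) ^ (-((w + 1) / 2).re) ≤ Real.exp (-w.re / 4) := by
  rw [Real.rpow_def_of_pos two_pos]
  refine Real.exp_le_exp.2 ?_
  have h : ((w + 1) / 2).re = (w.re + 1) / 2 := by simp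
  have := Real.log_two_gt_d9
  rw [h]
  nlinarith

lemma norm_deriv_logH_sub_le {w : ℂ} (hw : 11 < w.re) :
    ‖deriv logH w - 1 / 4 * Complex.log (w / (4 * Real.pi))‖ ≤ 40 * errSize w := by
  have hn : 11 < ‖w‖ := hw.trans_le (Complex.re_le_norm w)
  have hw0 : w ≠ 0 := norm_pos_iff.1 (by linarith)
  have h5 : 3 < ((w + 5) / 4).re := by simp; linarith
  have h1 : 5 < ((w + 1) / 2).re := by simp; linarith
  rw [(hasDerivAt_logH hw).deriv]
  have e : 1 / (w - 1) - 1 / 4 * Complex.log Real.pi + 1 / 4 * deriv stirlingLog ((w + 5) / 4)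
      + 1 / 2 * deriv logZeta ((w + 1) / 2) - 1 / 4 * Complex.log (w / (4 * Real.pi))
      = 1 / (w - 1) + 1 / 4 * (deriv stirlingLog ((w + 5) / 4) - Complex.log ((w + 5) / 4))
        + 1 / 4 * Complex.log (1 + 5 / w) + 1 / 2 * deriv logZeta ((w + 1) / 2) := by
    rw [← log_add_five_div_four hw]
    ring
  have b1 : ‖1 / (w - 1)‖ ≤ 2 * (1 / ‖w‖) := by
    have := norm_sub_norm_le w 1
    rw [norm_one] at this
    rw [norm_div, norm_one, mul_one_div, div_le_div_iff₀ (by linarith) (by linarith)]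
    linarith
  have b2 : ‖deriv stirlingLog ((w + 5) / 4) - Complex.log ((w + 5) / 4)‖ ≤ 68 * (1 / ‖w‖) := by
    refine (norm_deriv_stirlingLog_sub_log_le h5).trans ?_
    have h : ‖w‖ ≤ ‖w + 5‖ := by
      have hsq : ‖w‖ ^ 2 ≤ ‖w + 5‖ ^ 2 := by
        rw [← Complex.normSq_eq_norm_sq, ← Complex.normSq_eq_norm_sq, Complex.normSq_apply,
          Complex.normSq_apply]
        simp
        nlinarith
      exact (pow_le_pow_iff_left₀ (norm_nonneg _) (norm_nonneg _) two_ne_zero).1 hsq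
    rw [norm_div, mul_one_div]
    norm_num
    rw [div_div_eq_mul_div, div_le_div_iff₀ (by linarith) (by linarith)]
    linarith
  have b3 : ‖Complex.log (1 + 5 / w)‖ ≤ 15 / 2 * (1 / ‖w‖) := by
    have hx : ‖5 / w‖ = 5 * (1 / ‖w‖) := by
      rw [norm_div]
      norm_num
      ring
    have hx' : ‖5 / w‖ ≤ 1 / 2 := by
      rw [hx, mul_one_div, div_le_div_iff₀ (by linarith) (by linarith)]
      linarith
    have := Complex.norm_log_one_add_half_le_self hx'
    rw [hx] at this
    linarith
  have b4 := (norm_deriv_logZeta_le h1).trans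
    (mul_le_mul_of_nonneg_left (two_rpow_le_exp (w := w) (by linarith)) (by norm_num))
  rw [e]
  refine (norm_add₄_le).trans ?_
  rw [norm_mul, norm_mul, norm_mul, errSize]
  have n4 : ‖(1 / 4 : ℂ)‖ = 1 / 4 := by norm_num
  have n2 : ‖(1 / 2 : ℂ)‖ = 1 / 2 := by norm_num
  rw [n4, n2]
  have p1 : 0 < 1 / ‖w‖ := by positivity
  have p2 := Real.exp_pos (-w.re / 4)
  linarith

lemma differentiableOn_logH : DifferentiableOn ℂ logH {w | 11 < w.re} := fun _ hw =>
  (hasDerivAt_logH hw).differentiableAt.differentiableWithinAt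

lemma norm_deriv_deriv_logH_le {w : ℂ} (hw : 11 < w.re) :
    ‖deriv (deriv logH) w‖ ≤ 40 * errSize w := by
  have hn : 11 < ‖w‖ := hw.trans_le (Complex.re_le_norm w)
  have hw0 : w ≠ 0 := norm_pos_iff.1 (by linarith)
  have h5 : 4 < ((w + 5) / 4).re := by simp; linarith
  have h1 : 6 < ((w + 1) / 2).re := by simp; linarith
  have hev : deriv logH =ᶠ[𝓝 w] fun w => 1 / (w - 1) - 1 / 4 * Complex.log Real.pi
      + 1 / 4 * deriv stirlingLog ((w + 5) / 4) + 1 / 2 * deriv logZeta ((w + 1) / 2) := by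
    filter_upwards [(isOpen_lt continuous_const Complex.continuous_re).mem_nhds hw] with v hv
    exact (hasDerivAt_logH hv).deriv
  have hw1 : w - 1 ≠ 0 := fun h => by
    have := congrArg Complex.re h
    simp at this
    linarith
  have o2 : IsOpen {s : ℂ | 2 < s.re} := isOpen_lt continuous_const Complex.continuous_re
  have o4 : IsOpen {s : ℂ | 4 < s.re} := isOpen_lt continuous_const Complex.continuous_re
  have d1 := ((hasDerivAt_id' w).sub_const 1).inv hw1
  have d3 := ((differentiableOn_stirlingLog.deriv o2).differentiableAt
    (o2.mem_nhds (by simp; linarith : (w + 5) / 4 ∈ {s : ℂ | 2 < s.re}))).hasDerivAt.comp w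
    (((hasDerivAt_id' w).add_const 5).div_const 4)
  have d4 := ((differentiableOn_logZeta.deriv o4).differentiableAt
    (o4.mem_nhds (by simp; linarith : (w + 1) / 2 ∈ {s : ℂ | 4 < s.re}))).hasDerivAt.comp w
    (((hasDerivAt_id' w).add_const 1).div_const 2)
  have hd : HasDerivAt (fun w : ℂ => 1 / (w - 1) - 1 / 4 * Complex.log Real.pi
      + 1 / 4 * deriv stirlingLog ((w + 5) / 4) + 1 / 2 * deriv logZeta ((w + 1) / 2))
      (-(1 / (w - 1) ^ 2) + 1 / 16 * deriv (deriv stirlingLog) ((w + 5) / 4)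
        + 1 / 4 * deriv (deriv logZeta) ((w + 1) / 2)) w := by
    simp only [one_div (_ - 1 : ℂ)]
    refine (((d1.sub_const (1 / 4 * Complex.log Real.pi)).add (d3.const_mul (1 / 4))).add
      (d4.const_mul (1 / 2))).congr_deriv ?_
    ring
  rw [hev.deriv_eq, hd.deriv]
  have hns : ‖w‖ / 2 ≤ ‖w - 1‖ := by
    have := norm_sub_norm_le w 1
    rw [norm_one] at this
    linarith
  have b1 : ‖-(1 / (w - 1) ^ 2)‖ ≤ 1 * (1 / ‖w‖) := by
    rw [norm_neg, norm_div, norm_one, norm_pow, one_mul, div_le_div_iff₀ (by positivity)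
      (by linarith)]
    nlinarith
  have b2 : ‖deriv (deriv stirlingLog) ((w + 5) / 4)‖ ≤ 140 * (1 / ‖w‖) := by
    refine (norm_deriv_deriv_stirlingLog_le h5).trans ?_
    have h : ‖w‖ ≤ ‖w + 5‖ := by
      have hsq : ‖w‖ ^ 2 ≤ ‖w + 5‖ ^ 2 := by
        rw [← Complex.normSq_eq_norm_sq, ← Complex.normSq_eq_norm_sq, Complex.normSq_apply,
          Complex.normSq_apply]
        simp
        nlinarith
      exact (pow_le_pow_iff_left₀ (norm_nonneg _) (norm_nonneg _) two_ne_zero).1 hsq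
    rw [norm_div, mul_one_div]
    norm_num
    rw [div_div_eq_mul_div, div_le_div_iff₀ (by linarith) (by linarith)]
    linarith
  have b4 := (norm_deriv_deriv_logZeta_le h1).trans
    (mul_le_mul_of_nonneg_left (two_rpow_le_exp (w := w) (by linarith)) (by norm_num))
  refine (norm_add₃_le).trans ?_
  rw [norm_mul, norm_mul, errSize]
  have n4 : ‖(1 / 4 : ℂ)‖ = 1 / 4 := by norm_num
  have n2 : ‖(1 / 16 : ℂ)‖ = 1 / 16 := by norm_num
  rw [n4, n2]
  have p1 : 0 < 1 / ‖w‖ := by positivity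
  have p2 := Real.exp_pos (-w.re / 4)
  linarith

/-! ### Asymptotics of `H_t` above the real axis -/

lemma integral_gaussian_mul_cexp (c : ℂ) :
    ∫ v : ℝ, Complex.exp (-(v : ℂ) ^ 2 / 2 + c * v)
      = (√(2 * Real.pi) : ℝ) * Complex.exp (c ^ 2 / 2) := by
  have h := integral_cexp_quadratic (b := -1 / 2) (by norm_num) c 0
  have e : ∀ v : ℝ, -(v : ℂ) ^ 2 / 2 + c * v = -1 / 2 * (v : ℂ) ^ 2 + c * v + 0 := fun v => by ring
  simp_rw [e]
  rw [h]
  congr 1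
  · rw [Real.sqrt_eq_rpow, Complex.ofReal_cpow (by positivity)]
    push_cast
    congr 1
    ring
  · congr 1
    ring

lemma integrable_gaussian_mul_cexp (c : ℂ) :
    Integrable fun v : ℝ => Complex.exp (-(v : ℂ) ^ 2 / 2 + c * v) := by
  have h := integrable_cexp_quadratic (b := 1 / 2) (by norm_num) c 0
  refine h.congr (Eventually.of_forall fun v => ?_)
  simp only
  congr 1
  ring

/-- The backward heat flow as a Gaussian average: `H_t` for `t = -τ²/2` is an average of `H_0` over
a horizontal line, in which the Gaussian may be tilted by an arbitrary complex drift `b`. -/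
lemma integral_gaussian_mul_H_zero (τ : ℝ) (b ω : ℂ) :
    ∫ v : ℝ, Complex.exp (-(v : ℂ) ^ 2 / 2 + -(Complex.I * τ * b) * v)
        * H 0 (Complex.I * (ω + Complex.I * τ * v))
      = (√(2 * Real.pi) : ℝ) * Complex.exp (-(τ : ℂ) ^ 2 * b ^ 2 / 2)
        * H (-τ ^ 2 / 2) (Complex.I * (ω + (τ : ℂ) ^ 2 * b)) := by
  have hv := integrable_gaussian_mul_cexp (-(Complex.I * τ * b))
  have hu := ((isRapid_weight 0).mul_cexp_I (Complex.I * ω)).integrable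
  set F : ℝ → ℝ → ℂ := fun v u => Complex.exp (-(v : ℂ) ^ 2 / 2 + -(Complex.I * τ * b) * v)
    * (Complex.exp (Complex.I * (ω + Complex.I * τ * v) * (Complex.I * u)) * weight 0 u) with hF
  have hint : Integrable (Function.uncurry F) (volume.prod volume) := by
    have h := (hv.mul_prod hu).bdd_mul (c := 1)
      (f := fun p : ℝ × ℝ => Complex.exp ((-(τ * p.1 * p.2) : ℝ) * Complex.I))
      (by fun_prop) (Eventually.of_forall fun p => by rw [Complex.norm_exp_ofReal_mul_I])
    refine h.congr (Eventually.of_forall fun p => ?_)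
    simp only [hF, Function.uncurry]
    have e : Complex.I * (ω + Complex.I * τ * p.1) * (Complex.I * p.2)
        = (-(τ * p.1 * p.2) : ℝ) * Complex.I + Complex.I * ω * (Complex.I * p.2) := by
      push_cast
      linear_combination (Complex.I * τ * p.1 * p.2 : ℂ) * Complex.I_sq
    rw [e, Complex.exp_add (_ * Complex.I), mul_left_comm, mul_assoc (Complex.exp (_ * Complex.I))]
  calc _ = ∫ v : ℝ, ∫ u : ℝ, F v u := by
        congr 1
        ext v
        rw [H_eq_fourierExp, fourierExp, ← integral_const_mul]
    _ = ∫ u : ℝ, ∫ v : ℝ, F v u := integral_integral_swap hint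
    _ = _ := by
        rw [H_eq_fourierExp, fourierExp, ← integral_const_mul]
        congr 1
        ext u
        have e : ∀ v : ℝ, F v u = Complex.exp (Complex.I * ω * (Complex.I * u)) * weight 0 u
            * Complex.exp (-(v : ℂ) ^ 2 / 2 + -(Complex.I * τ * (b + u)) * v) := by
          intro v
          rw [mul_right_comm, ← Complex.exp_add]
          simp only [hF]
          rw [← mul_assoc, ← Complex.exp_add]
          congr 2
          linear_combination (Complex.I * τ * v * u : ℂ) * Complex.I_sq
        simp_rw [e]
        rw [integral_const_mul, integral_gaussian_mul_cexp]
        simp only [weight]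
        have e2 : Complex.exp (Complex.I * ω * (Complex.I * u))
            * Complex.exp ((-(Complex.I * τ * (b + u))) ^ 2 / 2)
            = Complex.exp (-(τ : ℂ) ^ 2 * b ^ 2 / 2)
              * Complex.exp (Complex.I * (ω + (τ : ℂ) ^ 2 * b) * (Complex.I * u))
              * Complex.exp (((-τ ^ 2 / 2 : ℝ) : ℂ) * (u : ℂ) ^ 2) := by
          rw [← Complex.exp_add, ← Complex.exp_add, ← Complex.exp_add]
          congr 1
          push_cast
          linear_combination (τ ^ 2 * (b + u) ^ 2 / 2 - (τ : ℂ) ^ 2 * b * u : ℂ) * Complex.I_sq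
        rw [show (((0 : ℝ) : ℂ) * (u : ℂ) ^ 2) = 0 by simp, Complex.exp_zero, one_mul]
        linear_combination (((Phi u / 2 : ℝ) : ℂ) * (√(2 * Real.pi) : ℝ)) * e2

/-- Second-order Taylor estimate for `logH` along a vertical line. -/
lemma norm_logH_vertical_le {ω b : ℂ} {τ δ M v : ℝ} (hω : 11 < ω.re)
    (hδ : ‖deriv logH ω - b‖ ≤ δ)
    (hM : ∀ y : ℝ, |y| ≤ |τ * v| → errSize (ω + Complex.I * y) ≤ M) :
    ‖logH (ω + Complex.I * τ * v) - logH ω - Complex.I * τ * b * v‖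
      ≤ (δ + 40 * M * |τ * v|) * |τ * v| := by
  set S : Set ℝ := Set.Icc (-|τ * v|) |τ * v| with hS
  have hSc : Convex ℝ S := convex_Icc _ _
  have h0 : (0 : ℝ) ∈ S := ⟨neg_nonpos.2 (abs_nonneg _), abs_nonneg _⟩
  have hv : τ * v ∈ S := ⟨neg_abs_le _, le_abs_self _⟩
  have hre : ∀ y : ℝ, 11 < (ω + Complex.I * y).re := fun y => by simpa using hω
  have hline : ∀ y : ℝ, HasDerivAt (fun y : ℝ => ω + Complex.I * y) Complex.I y := fun y => by
    have := ((hasDerivAt_id' y).ofReal_comp.const_mul Complex.I).const_add ω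
    simpa using this
  have o : IsOpen {s : ℂ | 11 < s.re} := isOpen_lt continuous_const Complex.continuous_re
  have hd2 : ∀ y : ℝ, HasDerivAt (fun y : ℝ => deriv logH (ω + Complex.I * y))
      (deriv (deriv logH) (ω + Complex.I * y) * Complex.I) y := fun y =>
    HasDerivAt.comp (h₂ := deriv logH) y ((differentiableOn_logH.deriv o).differentiableAt
      (o.mem_nhds (hre y))).hasDerivAt (hline y)
  have hd1 : ∀ y : ℝ, HasDerivAt (fun y : ℝ => logH (ω + Complex.I * y) - b * (Complex.I * y))
      (deriv logH (ω + Complex.I * y) * Complex.I - b * Complex.I) y := fun y => by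
    have h1 : HasDerivAt (fun y : ℝ => logH (ω + Complex.I * y)) _ y :=
      HasDerivAt.comp (h₂ := logH) y (hasDerivAt_logH (hre y)).differentiableAt.hasDerivAt (hline y)
    have h2 : HasDerivAt (fun y : ℝ => b * (Complex.I * y)) _ y :=
      ((hasDerivAt_id' y).ofReal_comp.const_mul Complex.I).const_mul b
    exact (h1.fun_sub h2).congr_deriv (by simp)
  have hdiff : ∀ y ∈ S, ‖deriv logH (ω + Complex.I * y) - deriv logH ω‖ ≤ 40 * M * |τ * v| := by
    intro y hy
    have hM0 : 0 ≤ M := by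
      refine le_trans ?_ (hM 0 (by rw [abs_zero]; exact abs_nonneg _))
      unfold errSize
      positivity
    have h := hSc.norm_image_sub_le_of_norm_hasDerivWithin_le (C := 40 * M)
      (fun x _ => (hd2 x).hasDerivWithinAt) (fun x hx => ?_) h0 hy
    · simp only [Complex.ofReal_zero, mul_zero, add_zero, sub_zero, Real.norm_eq_abs] at h
      exact h.trans (mul_le_mul_of_nonneg_left (abs_le.2 hy)
        (mul_nonneg (by norm_num) hM0))
    · rw [norm_mul, Complex.norm_I, mul_one]
      exact (norm_deriv_deriv_logH_le (hre x)).trans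
        (mul_le_mul_of_nonneg_left (hM x (abs_le.2 hx)) (by norm_num))
  have h := hSc.norm_image_sub_le_of_norm_hasDerivWithin_le (C := δ + 40 * M * |τ * v|)
    (fun x _ => (hd1 x).hasDerivWithinAt) (fun x hx => ?_) h0 hv
  · simp only [Complex.ofReal_zero, mul_zero, add_zero, sub_zero, Real.norm_eq_abs] at h
    refine le_trans (le_of_eq ?_) h
    congr 1
    push_cast
    ring_nf
  · rw [← sub_mul, norm_mul, Complex.norm_I, mul_one]
    calc _ = ‖(deriv logH ω - b) + (deriv logH (ω + Complex.I * x) - deriv logH ω)‖ := by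
          congr 1
          ring
      _ ≤ _ := (norm_add_le _ _).trans (add_le_add hδ (hdiff x hx))

lemma log_two_add_bounds {r A : ℝ} (hr0 : 0 ≤ r) (hA : 1000 ≤ A) (h : A * Real.log (2 + r) ≤ r) :
    2 ≤ Real.log (2 + r) ∧ A ≤ r := by
  have hl : Real.log 2 ≤ Real.log (2 + r) := Real.log_le_log two_pos (by linarith)
  have h2 := Real.log_two_gt_d9
  have h3 : 600 ≤ r := by nlinarith
  have h4 : 2 ≤ Real.log (2 + r) := by
    rw [Real.le_log_iff_exp_le (by linarith)]
    have := Real.exp_one_lt_d9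
    have e : Real.exp 2 = Real.exp 1 ^ 2 := by rw [← Real.exp_nat_mul]; norm_num
    rw [e]
    nlinarith [Real.exp_pos 1]
  exact ⟨h4, by nlinarith⟩

lemma norm_quarter_log_le {w : ℂ} (hw : 4 * Real.pi ≤ ‖w‖) (hl : 2 ≤ Real.log (2 + ‖w‖)) :
    ‖1 / 4 * Complex.log (w / (4 * Real.pi))‖ ≤ Real.log (2 + ‖w‖) := by
  have hpi := Real.pi_gt_three
  have hn : ‖w / (4 * Real.pi)‖ = ‖w‖ / (4 * Real.pi) := by
    rw [norm_div]
    congr 1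
    rw [show (4 * Real.pi : ℂ) = ((4 * Real.pi : ℝ) : ℂ) by push_cast; ring, Complex.norm_real,
      Real.norm_of_nonneg (by positivity)]
  have h1 : 1 ≤ ‖w‖ / (4 * Real.pi) := by rwa [one_le_div (by positivity)]
  have h2 : |(Complex.log (w / (4 * Real.pi))).re| ≤ Real.log (2 + ‖w‖) := by
    rw [Complex.log_re, hn, abs_of_nonneg (Real.log_nonneg h1)]
    refine Real.log_le_log (by linarith) ?_
    refine (div_le_self (norm_nonneg _) (by linarith)).trans (by linarith)
  have h3 : |(Complex.log (w / (4 * Real.pi))).im| ≤ 4 := by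
    rw [Complex.log_im]
    exact (Complex.abs_arg_le_pi _).trans Real.pi_le_four
  have h4 := Complex.norm_le_abs_re_add_abs_im (Complex.log (w / (4 * Real.pi)))
  rw [norm_mul]
  norm_num
  linarith

lemma norm_log_div_sub_log_div_le {s w : ℂ} {m c : ℝ} (hc : 0 < c) (hm : 0 < m) (hs : 0 < s.re)
    (hw : 0 < w.re) (h : ∀ x ∈ segment ℝ s w, m ≤ ‖x‖) :
    ‖Complex.log (s / c) - Complex.log (w / c)‖ ≤ ‖s - w‖ / m := by
  have hre : ∀ x ∈ segment ℝ s w, 0 < x.re := fun x hx =>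
    (convex_halfSpace_re_gt 0).segment_subset hs hw hx
  have key := (convex_segment (𝕜 := ℝ) s w).norm_image_sub_le_of_norm_hasDerivWithin_le
    (f := Complex.log) (f' := fun x => x⁻¹) (C := 1 / m)
    (fun x hx => (Complex.hasDerivAt_log (Or.inl (hre x hx))).hasDerivWithinAt)
    (fun x hx => by rw [norm_inv, ← one_div]; exact one_div_le_one_div_of_le hm (h x hx))
    (right_mem_segment ℝ s w) (left_mem_segment ℝ s w)
  have e : ∀ x : ℂ, 0 < x.re → Complex.log (x / c) = ((Real.log c⁻¹ : ℝ) : ℂ) + Complex.log x := by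
    intro x hx
    have hx0 : x ≠ 0 := fun h => by rw [h] at hx; exact lt_irrefl _ hx
    rw [div_eq_inv_mul, ← Complex.ofReal_inv, Complex.log_ofReal_mul (by positivity) hx0]
  rw [e s hs, e w hw, add_sub_add_left_eq_sub]
  refine key.trans (le_of_eq ?_)
  ring

/-- Points near `w₀`, on a scale that is logarithmic in `|w₀|`, when `Re w₀` is a large multiple
of `log |w₀|`. The constant `K` bounds the size `|τ|` of the evolution. -/
structure NearFar (K A : ℝ) (w₀ ω : ℂ) : Prop where
  one_le : 1 ≤ K
  le : 1000 * K ^ 3 ≤ A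
  le_re : A * Real.log (2 + ‖w₀‖) ≤ w₀.re
  norm_sub_le : ‖ω - w₀‖ ≤ 2 * K ^ 2 * Real.log (2 + ‖w₀‖)

section NearFar

variable {K A : ℝ} {w₀ ω : ℂ}

lemma NearFar.pow (h : NearFar K A w₀ ω) : 1 ≤ K ∧ K ≤ K ^ 2 ∧ K ^ 2 ≤ K ^ 3 := by
  have := h.one_le
  exact ⟨this, by nlinarith, by nlinarith [sq_nonneg K]⟩

lemma NearFar.log_bounds (h : NearFar K A w₀ ω) : 2 ≤ Real.log (2 + ‖w₀‖) ∧ A ≤ ‖w₀‖ := by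
  obtain ⟨h1, h2, h3⟩ := h.pow
  exact log_two_add_bounds (norm_nonneg _) (by linarith [h.le])
    (h.le_re.trans (Complex.re_le_norm _))

lemma NearFar.le_re' (h : NearFar K A w₀ ω) : A / 2 * Real.log (2 + ‖w₀‖) ≤ ω.re := by
  obtain ⟨h1, h2, h3⟩ := h.pow
  obtain ⟨hl, -⟩ := h.log_bounds
  have h4 := (abs_le.1 ((Complex.abs_re_le_norm (ω - w₀)).trans h.norm_sub_le)).1
  rw [Complex.sub_re] at h4
  have := h.le
  have := h.le_re
  nlinarith

lemma NearFar.self (h : NearFar K A w₀ ω) : NearFar K A w₀ w₀ := by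
  refine ⟨h.one_le, h.le, h.le_re, ?_⟩
  have := h.log_bounds.1
  rw [sub_self, norm_zero]
  positivity

lemma NearFar.re_gt (h : NearFar K A w₀ ω) : 11 < ω.re := by
  obtain ⟨h1, h2, h3⟩ := h.pow
  have := h.le
  nlinarith [h.le_re', h.log_bounds.1]

lemma NearFar.half_le (h : NearFar K A w₀ ω) : ‖w₀‖ / 2 ≤ ‖ω‖ := by
  obtain ⟨h1, h2, h3⟩ := h.pow
  obtain ⟨hl, -⟩ := h.log_bounds
  have h4 := h.norm_sub_le
  have h5 := norm_sub_norm_le w₀ (w₀ - ω)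
  rw [sub_sub_cancel, norm_sub_rev] at h5
  have := h.le
  have := h.le_re.trans (Complex.re_le_norm _)
  nlinarith

lemma NearFar.exp_le (h : NearFar K A w₀ ω) : Real.exp (-ω.re / 4) ≤ 1 / ‖w₀‖ := by
  obtain ⟨h1, h2, h3⟩ := h.pow
  obtain ⟨hl, hA⟩ := h.log_bounds
  have hle := h.le
  have h4 : -ω.re / 4 ≤ -Real.log (2 + ‖w₀‖) := by nlinarith [h.le_re']
  refine (Real.exp_le_exp.2 h4).trans ?_
  rw [Real.exp_neg, Real.exp_log (by linarith [norm_nonneg w₀]), ← one_div]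
  exact one_div_le_one_div_of_le (by linarith) (by linarith)

lemma NearFar.errSize_le (h : NearFar K A w₀ ω) (y : ℝ) :
    errSize (ω + Complex.I * y) ≤ 3 / A ∧ errSize (ω + Complex.I * y) ≤ 3 * (1 + |y|) / ‖w₀‖ := by
  obtain ⟨h1, h2, h3⟩ := h.pow
  obtain ⟨hl, hA⟩ := h.log_bounds
  have hle := h.le
  have hA0 : 0 < A := by linarith
  have hr0 : 0 < ‖w₀‖ := by linarith
  have hre : (ω + Complex.I * y).re = ω.re := by simp
  have hn : ω.re ≤ ‖ω + Complex.I * y‖ := by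
    simpa using Complex.re_le_norm (ω + Complex.I * (y : ℂ))
  have hre2 : A ≤ ω.re := by nlinarith [h.le_re']
  have hexp := h.exp_le
  unfold errSize
  rw [hre]
  constructor
  · have e1 : 1 / ‖ω + Complex.I * y‖ ≤ 1 / A := one_div_le_one_div_of_le hA0 (hre2.trans hn)
    have e2 : 1 / ‖w₀‖ ≤ 1 / A := one_div_le_one_div_of_le hA0 hA
    have e3 : (0 : ℝ) < 1 / A := by positivity
    have e4 : 3 / A = 3 * (1 / A) := by ring
    linarith
  · have e1 : ‖ω‖ ≤ ‖ω + Complex.I * y‖ + |y| := by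
      have := _root_.norm_sub_le (ω + Complex.I * (y : ℂ)) (Complex.I * (y : ℂ))
      rw [add_sub_cancel_right] at this
      simpa using this
    have e2 : 1 / ‖ω + Complex.I * y‖ ≤ 2 * (1 + |y|) / ‖w₀‖ := by
      rw [div_le_div_iff₀ (by linarith) hr0]
      have := h.half_le
      nlinarith [abs_nonneg y]
    have e3 : 1 / ‖w₀‖ ≤ (1 + |y|) / ‖w₀‖ := by
      gcongr
      linarith [abs_nonneg y]
    have e4 : 3 * (1 + |y|) / ‖w₀‖ = 2 * (1 + |y|) / ‖w₀‖ + (1 + |y|) / ‖w₀‖ := by ring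
    linarith

lemma NearFar.of_segment (h : NearFar K A w₀ ω) {x : ℂ} (hx : x ∈ segment ℝ ω w₀) :
    NearFar K A w₀ x := by
  refine ⟨h.one_le, h.le, h.le_re, ?_⟩
  have hc := (convex_closedBall w₀ (2 * K ^ 2 * Real.log (2 + ‖w₀‖))).segment_subset
    (x := ω) (y := w₀) (by rw [mem_closedBall_iff_norm]; exact h.norm_sub_le)
    (by rw [mem_closedBall_iff_norm]; exact h.self.norm_sub_le) hx
  rwa [mem_closedBall_iff_norm] at hc

lemma NearFar.norm_deriv_logH_sub_le (h : NearFar K A w₀ ω) :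
    ‖deriv logH ω - 1 / 4 * Complex.log (w₀ / (4 * Real.pi))‖
      ≤ 121 * K ^ 2 * (Real.log (2 + ‖w₀‖) / ‖w₀‖) := by
  obtain ⟨h1, h2, h3⟩ := h.pow
  obtain ⟨hl, hA⟩ := h.log_bounds
  have hle := h.le
  have hA0 : 0 < A := by linarith
  have hr0 : 0 < ‖w₀‖ := by linarith
  have b1 := DeBruijnNewman.norm_deriv_logH_sub_le h.re_gt
  have b2 : errSize ω ≤ 3 / ‖w₀‖ := by simpa using (h.errSize_le 0).2
  have b3 := norm_log_div_sub_log_div_le (s := ω) (w := w₀) (c := 4 * Real.pi) (m := ‖w₀‖ / 2)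
    (by positivity) (by positivity) (by linarith [h.re_gt]) (by linarith [h.self.re_gt])
    (fun x hx => (h.of_segment hx).half_le)
  have b4 : ‖ω - w₀‖ / (‖w₀‖ / 2) ≤ 4 * K ^ 2 * (Real.log (2 + ‖w₀‖) / ‖w₀‖) := by
    rw [div_div_eq_mul_div, ← mul_div_assoc]
    refine div_le_div_of_nonneg_right ?_ hr0.le
    linarith [h.norm_sub_le]
  have b5 : 1 / ‖w₀‖ ≤ K ^ 2 * (Real.log (2 + ‖w₀‖) / ‖w₀‖) / 2 := by
    rw [← mul_div_assoc, div_div, div_le_div_iff₀ hr0 (by positivity)]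
    have : 2 ≤ K ^ 2 * Real.log (2 + ‖w₀‖) := by nlinarith
    nlinarith
  push_cast at b3
  calc _ = ‖(deriv logH ω - 1 / 4 * Complex.log (ω / (4 * Real.pi)))
          + 1 / 4 * (Complex.log (ω / (4 * Real.pi)) - Complex.log (w₀ / (4 * Real.pi)))‖ := by
        congr 1
        ring
    _ ≤ 40 * (3 / ‖w₀‖) + 1 / 4 * (4 * K ^ 2 * (Real.log (2 + ‖w₀‖) / ‖w₀‖)) := by
        refine (norm_add_le _ _).trans (add_le_add (b1.trans (by linarith)) ?_)
        rw [norm_mul]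
        norm_num
        linarith
    _ ≤ _ := by
        have e : 40 * (3 / ‖w₀‖) = 120 * (1 / ‖w₀‖) := by ring
        rw [e]
        have : 0 ≤ K ^ 2 * (Real.log (2 + ‖w₀‖) / ‖w₀‖) := by positivity
        nlinarith

/-- The exponent `Q(v)` of the Gaussian average, after removal of its linear part, is tamed by the
Gaussian, and it is small for bounded `v`. -/
lemma NearFar.norm_exponent_le (h : NearFar K A w₀ ω) {τ : ℝ} (hτ : |τ| ≤ K) (v : ℝ) :
    ‖logH (ω + Complex.I * τ * v) - logH ω
        - Complex.I * τ * (1 / 4 * Complex.log (w₀ / (4 * Real.pi))) * v‖ ≤ (1 + v ^ 2) / 4 ∧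
    ‖logH (ω + Complex.I * τ * v) - logH ω
        - Complex.I * τ * (1 / 4 * Complex.log (w₀ / (4 * Real.pi))) * v‖
      ≤ 121 * K ^ 3 * (Real.log (2 + ‖w₀‖) / ‖w₀‖) * (1 + |v|) ^ 3 := by
  obtain ⟨h1, h2, h3⟩ := h.pow
  obtain ⟨hl, hA⟩ := h.log_bounds
  have hle := h.le
  have hA0 : 0 < A := by linarith
  have hr0 : 0 < ‖w₀‖ := by linarith
  have hK0 : 0 < K := by linarith
  have hv0 := abs_nonneg v
  have hτv : |τ * v| ≤ K * |v| := by rw [abs_mul]; gcongr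
  have q : Real.log (2 + ‖w₀‖) / ‖w₀‖ ≤ 1 / A := by
    rw [div_le_div_iff₀ hr0 hA0]
    linarith [h.le_re.trans (Complex.re_le_norm _)]
  have q0 : 0 < Real.log (2 + ‖w₀‖) / ‖w₀‖ := by positivity
  have hA1 : K ^ 3 * (1 / A) ≤ 1 / 1000 := by
    rw [mul_one_div, div_le_div_iff₀ hA0 (by norm_num)]
    linarith
  have hA2 : 0 < 1 / A := by positivity
  -- the first estimate uses that `errSize` is `O(1 / A)` on the whole vertical line, the second one
  -- that it is `O(1 / |w₀|)` at bounded distance from `ω`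
  constructor
  · have e := norm_logH_vertical_le (τ := τ) (v := v) h.re_gt h.norm_deriv_logH_sub_le
      (fun y _ => (h.errSize_le y).1)
    refine e.trans ?_
    calc _ ≤ (121 * K ^ 2 * (1 / A) + 40 * (3 / A) * (K * |v|)) * (K * |v|) := by gcongr
      _ = 121 * (K ^ 3 * (1 / A)) * |v| + 120 * (K ^ 2 * (1 / A)) * |v| ^ 2 := by ring
      _ ≤ 121 * (1 / 1000) * |v| + 120 * (1 / 1000) * |v| ^ 2 := by
          have : K ^ 2 * (1 / A) ≤ K ^ 3 * (1 / A) := by gcongr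
          gcongr
          linarith
      _ ≤ _ := by
          rw [← sq_abs v]
          nlinarith [sq_nonneg (|v| - 1)]
  · have e := norm_logH_vertical_le (τ := τ) (v := v) (M := 3 * (1 + K * |v|) / ‖w₀‖) h.re_gt
      h.norm_deriv_logH_sub_le (fun y hy => (h.errSize_le y).2.trans (by
        gcongr
        exact hy.trans hτv))
    refine e.trans ?_
    have q2 : 1 / ‖w₀‖ ≤ Real.log (2 + ‖w₀‖) / ‖w₀‖ := by
      gcongr
      linarith
    set p := Real.log (2 + ‖w₀‖) / ‖w₀‖
    calc _ ≤ (121 * K ^ 2 * p + 40 * (3 * (1 + K * |v|) / ‖w₀‖) * (K * |v|)) * (K * |v|) := by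
          gcongr
      _ = 121 * K ^ 3 * p * |v| + 120 * (1 / ‖w₀‖) * (K ^ 2 * |v| ^ 2 + K ^ 3 * |v| ^ 3) := by ring
      _ ≤ 121 * K ^ 3 * p * |v| + 121 * p * (K ^ 3 * |v| ^ 2 + K ^ 3 * |v| ^ 3) := by
          gcongr
          norm_num
      _ = 121 * K ^ 3 * p * (|v| + |v| ^ 2 + |v| ^ 3) := by ring
      _ ≤ _ := by
          gcongr
          nlinarith [sq_nonneg |v|]

end NearFar

/-- The third moment of the damped Gaussian `exp (1/4 - v²/4)`, which dominates the average of the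
error. -/
def gaussMoment : ℝ := ∫ v : ℝ, (1 + |v|) ^ 3 * Real.exp (1 / 4 - v ^ 2 / 4)

lemma integrable_gaussMoment :
    Integrable fun v : ℝ => (1 + |v|) ^ 3 * Real.exp (1 / 4 - v ^ 2 / 4) := by
  refine Integrable.mono' ((integrable_exp_neg_mul_sq (b := 1 / 8) (by norm_num)).const_mul
    (Real.exp 100)) (by fun_prop) (Eventually.of_forall fun v => ?_)
  rw [Real.norm_of_nonneg (by positivity)]
  have h1 : (1 + |v|) ^ 3 ≤ Real.exp (3 * |v|) := by
    rw [show 3 * |v| = (3 : ℕ) * |v| by norm_num, Real.exp_nat_mul]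
    gcongr
    linarith [Real.add_one_le_exp |v|]
  calc _ ≤ Real.exp (3 * |v|) * Real.exp (1 / 4 - v ^ 2 / 4) := by gcongr
    _ ≤ _ := by
      rw [← Real.exp_add, ← Real.exp_add]
      refine Real.exp_le_exp.2 ?_
      rw [← sq_abs v]
      nlinarith [sq_nonneg (|v| - 12)]

lemma norm_cexp_sub_one_le (x : ℂ) : ‖Complex.exp x - 1‖ ≤ ‖x‖ * Real.exp ‖x‖ := by
  simpa using Complex.norm_exp_sub_sum_le_norm_mul_exp x 1

section NearFar

variable {K A : ℝ} {w₀ ω : ℂ}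

/-- The evolved function equals its saddle point approximation up to a small relative error. -/
lemma NearFar.norm_H_div_sub_one_le (h : NearFar K A w₀ ω) {τ : ℝ} (hτ : |τ| ≤ K) {k : ℂ}
    (hk : ∀ w : ℂ, 11 < w.re → H 0 (Complex.I * w) = Complex.exp (k + logH w)) {b : ℂ}
    (hb : b = 1 / 4 * Complex.log (w₀ / (4 * Real.pi))) :
    ‖H (-τ ^ 2 / 2) (Complex.I * (ω + (τ : ℂ) ^ 2 * b))
        * Complex.exp (-(τ : ℂ) ^ 2 * b ^ 2 / 2 - k - logH ω) - 1‖
      ≤ 121 * K ^ 3 * (Real.log (2 + ‖w₀‖) / ‖w₀‖) * gaussMoment := by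
  set p := 121 * K ^ 3 * (Real.log (2 + ‖w₀‖) / ‖w₀‖)
  -- `H_0(i(ω + iτv)) e^{-iτbv} = H_0(iω) e^{Q(v)}`
  set Q : ℝ → ℂ := fun v => logH (ω + Complex.I * τ * v) - logH ω - Complex.I * τ * b * v with hQ
  have hQ1 : ∀ v, ‖Q v‖ ≤ (1 + v ^ 2) / 4 := fun v => by
    have := (h.norm_exponent_le hτ v).1
    rwa [← hb] at this
  have hQ2 : ∀ v, ‖Q v‖ ≤ p * (1 + |v|) ^ 3 := fun v => by
    have := (h.norm_exponent_le hτ v).2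
    rwa [← hb] at this
  set g : ℝ → ℂ := fun v => Complex.exp (-(v : ℂ) ^ 2 / 2) with hg
  have hgn : ∀ v, ‖g v‖ = Real.exp (-v ^ 2 / 2) := fun v => by
    simp only [hg]
    rw [show -(v : ℂ) ^ 2 / 2 = ((-v ^ 2 / 2 : ℝ) : ℂ) by push_cast; ring, ← Complex.ofReal_exp,
      Complex.norm_real, Real.norm_of_nonneg (Real.exp_pos _).le]
  have hgi : Integrable g := by simpa [hg] using integrable_gaussian_mul_cexp 0
  have hgm : ∫ v, g v = (√(2 * Real.pi) : ℝ) := by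
    simpa [hg] using integral_gaussian_mul_cexp 0
  have hs1 : 1 ≤ √(2 * Real.pi) := by
    rw [Real.one_le_sqrt]
    linarith [Real.pi_gt_three]
  have hs0 : ((√(2 * Real.pi) : ℝ) : ℂ) ≠ 0 := by
    rw [Complex.ofReal_ne_zero]
    linarith
  have hre : ∀ v : ℝ, 11 < (ω + Complex.I * τ * v).re := fun v => by
    have := h.re_gt
    simpa using this
  have hQc : Continuous Q := by
    have hd : ContinuousOn logH {w | 11 < w.re} := differentiableOn_logH.continuousOn
    have hc : Continuous fun v : ℝ => logH (ω + Complex.I * τ * v) :=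
      hd.comp_continuous (by fun_prop) hre
    fun_prop
  have hb1 : ∀ v, ‖g v * (Complex.exp (Q v) - 1)‖
      ≤ p * ((1 + |v|) ^ 3 * Real.exp (1 / 4 - v ^ 2 / 4)) := by
    intro v
    rw [norm_mul, hgn]
    have h1 : ‖Q v‖ * Real.exp ‖Q v‖ ≤ p * (1 + |v|) ^ 3 * Real.exp ((1 + v ^ 2) / 4) := by
      gcongr
      · exact (norm_nonneg _).trans (hQ2 v)
      · exact hQ2 v
      · exact hQ1 v
    calc _ ≤ Real.exp (-v ^ 2 / 2) * (p * (1 + |v|) ^ 3 * Real.exp ((1 + v ^ 2) / 4)) := by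
          gcongr
          exact (norm_cexp_sub_one_le _).trans h1
      _ = p * (1 + |v|) ^ 3 * (Real.exp (-v ^ 2 / 2) * Real.exp ((1 + v ^ 2) / 4)) := by ring
      _ = _ := by
          rw [← Real.exp_add, mul_assoc]
          ring_nf
  have hEi : Integrable fun v => g v * (Complex.exp (Q v) - 1) :=
    (integrable_gaussMoment.const_mul p).mono' (by fun_prop) (Eventually.of_forall hb1)
  have hE : ‖∫ v, g v * (Complex.exp (Q v) - 1)‖ ≤ p * gaussMoment := by
    rw [gaussMoment, ← integral_const_mul]
    exact norm_integral_le_of_norm_le (integrable_gaussMoment.const_mul p)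
      (Eventually.of_forall hb1)
  have hid := integral_gaussian_mul_H_zero τ b ω
  have e : ∀ v : ℝ, Complex.exp (-(v : ℂ) ^ 2 / 2 + -(Complex.I * τ * b) * v)
      * H 0 (Complex.I * (ω + Complex.I * τ * v))
      = Complex.exp (k + logH ω) * (g v * (Complex.exp (Q v) - 1) + g v) := by
    intro v
    rw [hk _ (hre v), mul_sub, mul_one, sub_add_cancel, ← Complex.exp_add]
    simp only [hg, hQ]
    rw [← Complex.exp_add, ← Complex.exp_add]
    congr 1
    ring
  simp_rw [e] at hid
  rw [integral_const_mul, integral_add hEi hgi, hgm] at hid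
  set E := ∫ v, g v * (Complex.exp (Q v) - 1)
  have hfin : H (-τ ^ 2 / 2) (Complex.I * (ω + (τ : ℂ) ^ 2 * b))
        * Complex.exp (-(τ : ℂ) ^ 2 * b ^ 2 / 2 - k - logH ω) - 1
        = E / (√(2 * Real.pi) : ℝ) := by
    rw [eq_div_iff hs0]
    have e3 : Complex.exp (-(τ : ℂ) ^ 2 * b ^ 2 / 2 - k - logH ω)
        = Complex.exp (-(τ : ℂ) ^ 2 * b ^ 2 / 2) * Complex.exp (-(k + logH ω)) := by
      rw [← Complex.exp_add]
      congr 1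
      ring
    have e4 : Complex.exp (k + logH ω) * Complex.exp (-(k + logH ω)) = 1 := by
      rw [← Complex.exp_add, add_neg_cancel, Complex.exp_zero]
    rw [e3]
    linear_combination -Complex.exp (-(k + logH ω)) * hid
      + (E + (√(2 * Real.pi) : ℝ)) * e4
  rw [hfin, norm_div, Complex.norm_real, Real.norm_of_nonneg (by positivity)]
  exact (div_le_self (norm_nonneg _) hs1).trans hE

end NearFar

/-- Uniform asymptotics of the logarithmic derivative of `H_t` far above the real axis; in the
variable `w = -iz` it is that of a Gamma function. -/
theorem exists_norm_logDeriv_H_sub_le :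
    ∃ A C : ℝ, 1 ≤ A ∧ 0 < C ∧ ∀ t : ℝ, Lam < t → t ≤ 0 → ∀ w : ℂ,
      A * Real.log (2 + ‖w‖) ≤ w.re →
      ‖Complex.I * logDeriv (H t) (Complex.I * w) - 1 / 4 * Complex.log (w / (4 * Real.pi))‖
        ≤ C * (Real.log (2 + ‖w‖) / ‖w‖) := by
  obtain ⟨k, hk⟩ := exists_H_zero_eq
  set K := 1 + √(-(2 * Lam))
  have hs := Real.sqrt_nonneg (-(2 * Lam))
  have hK1 : 1 ≤ K := by simp only [K]; linarith
  have hg0 : 0 ≤ gaussMoment := integral_nonneg fun v => by positivity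
  set A := 1000 * K ^ 3 * (1 + gaussMoment)
  have hA : 1000 * K ^ 3 ≤ A := le_mul_of_one_le_right (by positivity) (by linarith)
  have hK3 : 1 ≤ K ^ 3 := one_le_pow₀ hK1
  refine ⟨A, 121 * K ^ 2 + 242 * K ^ 3 * gaussMoment, by linarith, by positivity,
    fun t ht ht0 w₀ hw => ?_⟩
  have hself : NearFar K A w₀ w₀ := by
    refine ⟨hK1, hA, hw, ?_⟩
    have := Real.log_nonneg (by linarith [norm_nonneg w₀] : 1 ≤ 2 + ‖w₀‖)
    rw [sub_self, norm_zero]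
    positivity
  obtain ⟨hl, hAr⟩ := hself.log_bounds
  set l := Real.log (2 + ‖w₀‖) with hl_def
  have hr0 : 0 < ‖w₀‖ := by linarith
  set τ := √(-(2 * t)) with hτdef
  have hτ0 : 0 ≤ τ := Real.sqrt_nonneg _
  have hτ2 : τ ^ 2 = -(2 * t) := Real.sq_sqrt (by linarith)
  have ht' : t = -τ ^ 2 / 2 := by rw [hτ2]; ring
  have hτK : |τ| ≤ K := by
    rw [abs_of_nonneg hτ0]
    have : τ ≤ √(-(2 * Lam)) := Real.sqrt_le_sqrt (by linarith)
    simp only [K]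
    linarith
  -- the drift that cancels the linear term of the exponent at `w₀`, to leading order; it is kept
  -- fixed while `w` varies in a disc, so that Cauchy's estimate applies
  set b := 1 / 4 * Complex.log (w₀ / (4 * Real.pi)) with hb
  have hbl : ‖b‖ ≤ l := norm_quarter_log_le (by
    have := Real.pi_lt_d2
    nlinarith) hl
  have hnear : ∀ w ∈ Metric.closedBall w₀ 1, NearFar K A w₀ (w - (τ : ℂ) ^ 2 * b) := by
    intro w hw1
    refine ⟨hK1, hA, hw, ?_⟩
    have h1 : ‖w - w₀‖ ≤ 1 := by rwa [mem_closedBall_iff_norm] at hw1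
    have h2 : ‖(τ : ℂ) ^ 2 * b‖ ≤ K ^ 2 * l := by
      rw [norm_mul, norm_pow, Complex.norm_real, Real.norm_eq_abs]
      gcongr
    have h3 := norm_sub_le (w - w₀) ((τ : ℂ) ^ 2 * b)
    rw [show w - w₀ - (τ : ℂ) ^ 2 * b = w - (τ : ℂ) ^ 2 * b - w₀ by ring] at h3
    nlinarith [one_le_pow₀ hK1 (n := 2)]
  set q := l / ‖w₀‖
  have hq0 : 0 < q := by positivity
  set η := 121 * K ^ 3 * q * gaussMoment
  have hη0 : 0 ≤ η := by positivity
  have hη : η ≤ 1 / 2 := by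
    have h1 : q * A ≤ 1 := by
      rw [div_mul_eq_mul_div, div_le_one hr0]
      linarith [hw.trans (Complex.re_le_norm _)]
    have h2 : 0 ≤ q * K ^ 3 := by positivity
    have h3 : 0 ≤ q * K ^ 3 * gaussMoment := by positivity
    simp only [A] at h1
    simp only [η]
    nlinarith
  -- the quotient of `H_t` by its saddle point approximation
  set P : ℂ → ℂ := fun w => H t (Complex.I * w)
    * Complex.exp (-(τ : ℂ) ^ 2 * b ^ 2 / 2 - k - logH (w - (τ : ℂ) ^ 2 * b)) with hP
  have hPle : ∀ w ∈ Metric.closedBall w₀ 1, ‖P w - 1‖ ≤ η := by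
    intro w hw1
    have := (hnear w hw1).norm_H_div_sub_one_le hτK hk hb
    rwa [sub_add_cancel, ← ht'] at this
  have hGd : ∀ w, HasDerivAt (fun w => H t (Complex.I * w)) (deriv (H t) (Complex.I * w) * Complex.I)
      w := fun w => by
    have h2 : HasDerivAt (fun w : ℂ => Complex.I * w) Complex.I w := by
      simpa using (hasDerivAt_id' w).const_mul Complex.I
    exact HasDerivAt.comp (h₂ := H t) w ((differentiable_H t) _).hasDerivAt h2
  have hXd : ∀ w ∈ Metric.closedBall w₀ 1,
      HasDerivAt (fun w => -(τ : ℂ) ^ 2 * b ^ 2 / 2 - k - logH (w - (τ : ℂ) ^ 2 * b))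
        (-deriv logH (w - (τ : ℂ) ^ 2 * b)) w := fun w hw1 => by
    have h1 := (hasDerivAt_logH (hnear w hw1).re_gt).differentiableAt.hasDerivAt
    have h2 : HasDerivAt (fun w : ℂ => logH (w - (τ : ℂ) ^ 2 * b)) _ w :=
      h1.comp_sub_const w _
    exact h2.const_sub _
  have hPd : ∀ w ∈ Metric.closedBall w₀ 1, HasDerivAt P
      (deriv (H t) (Complex.I * w) * Complex.I
        * Complex.exp (-(τ : ℂ) ^ 2 * b ^ 2 / 2 - k - logH (w - (τ : ℂ) ^ 2 * b))
        + H t (Complex.I * w) * (Complex.exp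
          (-(τ : ℂ) ^ 2 * b ^ 2 / 2 - k - logH (w - (τ : ℂ) ^ 2 * b))
          * -deriv logH (w - (τ : ℂ) ^ 2 * b))) w := fun w hw1 =>
    (hGd w).mul (hXd w hw1).cexp
  have hc : w₀ ∈ Metric.closedBall w₀ 1 := Metric.mem_closedBall_self zero_le_one
  have hcauchy : ‖deriv P w₀‖ ≤ η := by
    have h := Complex.norm_deriv_le_of_forall_mem_sphere_norm_le (c := w₀) (R := 1)
      (f := fun w => P w - 1) (C := η) one_pos ?_
      (fun w hw1 => hPle w (Metric.sphere_subset_closedBall hw1))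
    · simpa using h
    · refine DifferentiableOn.diffContOnCl ?_
      rw [closure_ball w₀ one_ne_zero]
      exact fun w hw1 => ((hPd w hw1).differentiableAt.sub_const 1).differentiableWithinAt
  have hP0 : 1 / 2 ≤ ‖P w₀‖ := by
    have h1 := hPle w₀ hc
    have h2 := norm_sub_norm_le 1 (1 - P w₀)
    rw [sub_sub_cancel, norm_one, norm_sub_rev] at h2
    linarith
  have hPne : P w₀ ≠ 0 := fun h0 => by rw [h0, norm_zero] at hP0; linarith
  have hHne : H t (Complex.I * w₀) ≠ 0 := fun h0 => hPne (by simp only [hP, h0, zero_mul])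
  have hlog : Complex.I * logDeriv (H t) (Complex.I * w₀)
      = deriv P w₀ / P w₀ + deriv logH (w₀ - (τ : ℂ) ^ 2 * b) := by
    have hex := Complex.exp_ne_zero (-(τ : ℂ) ^ 2 * b ^ 2 / 2 - k - logH (w₀ - (τ : ℂ) ^ 2 * b))
    rw [(hPd w₀ hc).deriv, logDeriv_apply]
    simp only [hP]
    field_simp
    ring
  have hdiv : ‖deriv P w₀ / P w₀‖ ≤ 2 * η := by
    rw [norm_div, div_le_iff₀ (by linarith)]
    nlinarith
  rw [hlog, add_sub_assoc]
  refine (norm_add_le _ _).trans ((add_le_add hdiv (hnear w₀ hc).norm_deriv_logH_sub_le).trans ?_)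
  simp only [η]
  refine le_of_eq ?_
  ring

/-! ### Sums over the zeros -/

/-- A real-rooted entire function all of whose zeros are simple. -/
structure SimplyRealRooted (F : ℂ → ℂ) : Prop extends RealRooted F where
  deriv_ne_zero : ∀ x : ℝ, F x = 0 → deriv F x ≠ 0

/-- The set of real zeros of a function. -/
def realZeros (F : ℂ → ℂ) : Set ℝ := {x : ℝ | F x = 0}

/-- Without multiple zeros, no linear factor is repeated. -/
lemma ZeroFactorization.nodup {F : ℂ → ℂ} {c : ℂ} {R : ℝ} {Z : Multiset ℂ} {g : ℂ → ℂ}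
    (h : ZeroFactorization F c R Z g) (hd : ∀ x ∈ Z, deriv F x ≠ 0) : Z.Nodup := by
  rw [Multiset.nodup_iff_le]
  intro x hx
  obtain ⟨Z', rfl⟩ := Multiset.le_iff_exists_add.1 hx
  refine hd x (by simp) ?_
  set k : ℂ → ℂ := fun z => (Z'.map fun x => z - x).prod * g z
  have e : F = fun z => (z - x) ^ 2 * k z := by
    ext z
    rw [h.eq_mul]
    simp only [k, Multiset.map_add, Multiset.prod_add, Multiset.map_cons, Multiset.map_zero,
      Multiset.prod_cons, Multiset.prod_zero]
    ring
  have hk : DifferentiableAt ℂ k x := by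
    refine DifferentiableAt.mul ?_ (h.differentiable x)
    clear e hx hd h
    clear k
    induction Z' using Multiset.induction_on with
    | empty => simp
    | cons a Z' ih =>
      simp only [Multiset.map_cons, Multiset.prod_cons]
      exact (differentiableAt_id.sub_const a).mul ih
  have hd2 := (((hasDerivAt_id' x).sub_const x).fun_pow 2).fun_mul hk.hasDerivAt
  rw [e, hd2.deriv]
  simp

namespace SimplyRealRooted

variable {F : ℂ → ℂ}

lemma finite_realZeros_ball (hF : SimplyRealRooted F) (R : ℝ) :
    {x : realZeros F | ((x : ℝ) : ℂ) ∈ Metric.closedBall Complex.I R}.Finite := by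
  have h := finite_zeros_closedBall hF.differentiable hF.I_ne_zero R
  refine Set.Finite.of_finite_image (f := fun x : realZeros F => ((x : ℝ) : ℂ))
    (h.subset ?_) fun x _ y _ hxy => Subtype.ext (Complex.ofReal_injective hxy)
  rintro _ ⟨x, hx, rfl⟩
  exact ⟨x.2, hx⟩

/-- The real zeros in the disc of radius `R` about `i`. -/
def zerosFinset (hF : SimplyRealRooted F) (R : ℝ) : Finset (realZeros F) :=
  (hF.finite_realZeros_ball R).toFinset

lemma zerosFinset_mono (hF : SimplyRealRooted F) : Monotone hF.zerosFinset := by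
  intro R R' h x hx
  simp only [zerosFinset, Finite.mem_toFinset, Set.mem_ofPred_eq] at hx ⊢
  exact Metric.closedBall_subset_closedBall h hx

lemma tendsto_zerosFinset (hF : SimplyRealRooted F) : Tendsto hF.zerosFinset atTop atTop := by
  refine tendsto_atTop_finset_of_monotone hF.zerosFinset_mono fun x =>
    ⟨dist ((x : ℝ) : ℂ) Complex.I, ?_⟩
  simp [zerosFinset]

lemma tendsto_sum_zerosFinset (hF : SimplyRealRooted F) {z z' : ℂ} (hz : z.im ≠ 0)
    (hz' : z'.im ≠ 0) :
    Tendsto (fun R => ∑ x ∈ hF.zerosFinset R, (1 / (z - (x : ℝ)) - 1 / (z' - (x : ℝ)))) atTop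
      (𝓝 (logDeriv F z - logDeriv F z')) := by
  rw [Metric.tendsto_nhds]
  intro ε hε
  obtain ⟨R₀, hR₀⟩ := exists_forall_norm_logDeriv_sub_le hF.growth hF.I_ne_zero (hF.ne_zero hz)
    (hF.ne_zero hz') (half_pos hε)
  filter_upwards [eventually_ge_atTop R₀] with R hR
  obtain ⟨Z, g, hfac⟩ := exists_zeroFactorization hF.differentiable hF.I_ne_zero R
  have hreal : ∀ x ∈ Z, ((x.re : ℝ) : ℂ) = x := fun x hx => by
    apply Complex.ext
    · simp
    · simpa using (hF.im_eq_zero x (hfac.apply_eq_zero hx)).symm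
  have hnd : Z.Nodup := hfac.nodup fun x hx => by
    rw [← hreal x hx]
    refine hF.deriv_ne_zero x.re ?_
    rw [hreal x hx]
    exact hfac.apply_eq_zero hx
  have hZ : Z = (hF.zerosFinset R).1.map fun x : realZeros F => ((x : ℝ) : ℂ) := by
    refine (Multiset.Nodup.ext hnd (Multiset.Nodup.map
      (fun x y hxy => Subtype.ext (Complex.ofReal_injective hxy)) (Finset.nodup _))).2 fun x => ?_
    rw [Multiset.mem_map]
    constructor
    · intro hx
      have h0 : F (x.re : ℝ) = 0 := by
        rw [hreal x hx]
        exact hfac.apply_eq_zero hx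
      refine ⟨⟨x.re, h0⟩, ?_, hreal x hx⟩
      have := hfac.mem_closedBall x hx
      rw [← hreal x hx] at this
      simpa [zerosFinset] using this
    · rintro ⟨y, hy, rfl⟩
      refine hfac.mem_of_apply_eq_zero y.2 ?_
      simpa [zerosFinset] using hy
  have h := hR₀ R hR Z g hfac
  rw [hZ, Multiset.map_map] at h
  rw [dist_comm, dist_eq_norm]
  refine lt_of_le_of_lt ?_ (half_lt_self hε)
  exact h

lemma one_div_sub_conj_im (z : ℂ) (x : ℝ) :
    (1 / (z - x) - 1 / ((starRingEnd ℂ) z - x)).im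
      = -(2 * (z.im / ((x - z.re) ^ 2 + z.im ^ 2))) := by
  rw [Complex.sub_im, im_one_div_sub, im_one_div_sub]
  simp only [Complex.conj_re, Complex.conj_im]
  ring

lemma tendsto_sum_poisson (hF : SimplyRealRooted F) {z : ℂ} (hz : 0 < z.im) :
    Tendsto (fun R => ∑ x ∈ hF.zerosFinset R, z.im / (((x : ℝ) - z.re) ^ 2 + z.im ^ 2)) atTop
      (𝓝 (-(logDeriv F z).im)) := by
  have hz' : ((starRingEnd ℂ) z).im ≠ 0 := by simpa using hz.ne'
  have h := Complex.continuous_im.continuousAt.tendsto.comp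
    (hF.tendsto_sum_zerosFinset hz.ne' hz')
  have h2 := h.const_mul (-(1 / 2))
  have e : ∀ R, -(1 / 2) * (Complex.im ∘ fun R => ∑ x ∈ hF.zerosFinset R,
      (1 / (z - (x : ℝ)) - 1 / ((starRingEnd ℂ) z - (x : ℝ)))) R
      = ∑ x ∈ hF.zerosFinset R, z.im / (((x : ℝ) - z.re) ^ 2 + z.im ^ 2) := by
    intro R
    rw [Function.comp_apply, Complex.im_sum, Finset.mul_sum]
    refine Finset.sum_congr rfl fun x _ => ?_
    rw [one_div_sub_conj_im]
    ring
  simp_rw [e] at h2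
  convert h2 using 2
  rw [hF.logDeriv_conj, Complex.sub_im, Complex.conj_im]
  ring

lemma summable_poisson (hF : SimplyRealRooted F) {z : ℂ} (hz : 0 < z.im) :
    Summable fun x : realZeros F => z.im / (((x : ℝ) - z.re) ^ 2 + z.im ^ 2) := by
  have h2 := hF.tendsto_sum_poisson hz
  refine summable_of_sum_le (fun x => by positivity) (c := -(logDeriv F z).im) fun u => ?_
  · obtain ⟨R, hR⟩ := (hF.tendsto_zerosFinset.eventually_ge_atTop u).exists
    refine (Finset.sum_le_sum_of_subset_of_nonneg hR fun x _ _ => by positivity).trans ?_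
    refine Monotone.ge_of_tendsto (f := fun R => ∑ x ∈ hF.zerosFinset R,
      z.im / (((x : ℝ) - z.re) ^ 2 + z.im ^ 2)) (fun R R' h => ?_) h2 R
    exact Finset.sum_le_sum_of_subset_of_nonneg (hF.zerosFinset_mono h) fun x _ _ => by positivity

lemma norm_one_div_sub_sq (z : ℂ) (x : ℝ) :
    ‖1 / (z - x)‖ ^ 2 = 1 / ((x - z.re) ^ 2 + z.im ^ 2) := by
  rw [norm_div, norm_one, div_pow, one_pow, ← Complex.normSq_eq_norm_sq, Complex.normSq_apply]
  simp only [Complex.sub_re, Complex.sub_im, Complex.ofReal_re, Complex.ofReal_im, sub_zero]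
  congr 1
  ring

/-- The partial fraction expansion of the logarithmic derivative; for simple zeros on the line it
converges unconditionally. -/
theorem hasSum_one_div_sub (hF : SimplyRealRooted F) {z z' : ℂ} (hz : 0 < z.im) (hz' : 0 < z'.im) :
    HasSum (fun x : realZeros F => 1 / (z - (x : ℝ)) - 1 / (z' - (x : ℝ)))
      (logDeriv F z - logDeriv F z') := by
  have hs : Summable fun x : realZeros F => 1 / (z - (x : ℝ)) - 1 / (z' - (x : ℝ)) := by
    have h1 := (hF.summable_poisson hz).mul_left (‖z' - z‖ / z.im)
    have h2 := (hF.summable_poisson hz').mul_left (‖z' - z‖ / z'.im)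
    refine Summable.of_norm_bounded (h1.add h2) fun x => ?_
    have n1 : z - (x : ℝ) ≠ 0 := fun h => by
      have := congrArg Complex.im h
      simp at this
      linarith
    have n2 : z' - (x : ℝ) ≠ 0 := fun h => by
      have := congrArg Complex.im h
      simp at this
      linarith
    have e : 1 / (z - (x : ℝ)) - 1 / (z' - (x : ℝ))
        = (z' - z) * ((1 / (z - (x : ℝ))) * (1 / (z' - (x : ℝ)))) := by
      field_simp
      ring
    have e1 : ‖z' - z‖ / z.im * (z.im / (((x : ℝ) - z.re) ^ 2 + z.im ^ 2))
        = ‖z' - z‖ * ‖1 / (z - (x : ℝ))‖ ^ 2 := by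
      rw [norm_one_div_sub_sq]
      field_simp
    have e2 : ‖z' - z‖ / z'.im * (z'.im / (((x : ℝ) - z'.re) ^ 2 + z'.im ^ 2))
        = ‖z' - z‖ * ‖1 / (z' - (x : ℝ))‖ ^ 2 := by
      rw [norm_one_div_sub_sq]
      field_simp
    rw [e, norm_mul, norm_mul, e1, e2, ← mul_add]
    refine mul_le_mul_of_nonneg_left ?_ (norm_nonneg _)
    nlinarith [sq_nonneg (‖1 / (z - (x : ℝ))‖ - ‖1 / (z' - (x : ℝ))‖),
      norm_nonneg (1 / (z - (x : ℝ))), norm_nonneg (1 / (z' - (x : ℝ)))]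
  have h := hs.hasSum.comp hF.tendsto_zerosFinset
  have h' := tendsto_nhds_unique h (hF.tendsto_sum_zerosFinset hz.ne' hz'.ne')
  rw [← h']
  exact hs.hasSum

/-- The Poisson sum over the zeros is `-Im F'/F`. -/
theorem hasSum_poisson (hF : SimplyRealRooted F) {z : ℂ} (hz : 0 < z.im) :
    HasSum (fun x : realZeros F => z.im / (((x : ℝ) - z.re) ^ 2 + z.im ^ 2))
      (-(logDeriv F z).im) := by
  have hs := (hF.summable_poisson hz).hasSum
  rwa [tendsto_nhds_unique (hs.comp hF.tendsto_zerosFinset) (hF.tendsto_sum_poisson hz)] at hs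

lemma countable_realZeros (hF : SimplyRealRooted F) : Countable (realZeros F) := by
  have h := (hF.summable_poisson (z := Complex.I) (by simp)).countable_support
  rw [← Set.countable_univ_iff]
  refine h.mono fun x _ => ?_
  simp only [Function.mem_support, Complex.I_im, Complex.I_re]
  positivity

end SimplyRealRooted

/-! ### Counting zeros by the argument of the logarithmic derivative -/

/-- The sign of a real number, with the value `1` at `0`, so that `stepSign (T - x) + stepSign x` is
`2` on the closed interval `[0, T]` and `0` elsewhere. -/
def stepSign (u : ℝ) : ℝ := if 0 ≤ u then 1 else -1

lemma abs_arctan_sub_of_nonneg {q : ℝ} (hq : 0 ≤ q) :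
    |Real.arctan q - Real.pi / 2 + q / (1 + q ^ 2)| ≤ 5 / (1 + q ^ 2) := by
  have h0 : 0 < 1 + q ^ 2 := by positivity
  rcases le_total q 1 with h1 | h1
  · have a1 := Real.arctan_nonneg.2 hq
    have a2 := Real.arctan_lt_pi_div_two q
    have a3 : q / (1 + q ^ 2) ≤ 1 / 2 := by
      rw [div_le_div_iff₀ h0 two_pos]
      nlinarith [sq_nonneg (q - 1)]
    have a4 : 0 ≤ q / (1 + q ^ 2) := by positivity
    have a5 : 5 / 2 ≤ 5 / (1 + q ^ 2) := by
      rw [div_le_div_iff₀ two_pos h0]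
      nlinarith
    have := Real.pi_lt_d2
    rw [abs_le]
    constructor <;> linarith
  · have hq0 : 0 < q := by linarith
    have hp := Real.arctan_inv_of_pos hq0
    set p := q⁻¹ with hpdef
    have hp0 : 0 < p := inv_pos.2 hq0
    have hp1 : p ≤ 1 := inv_le_one_of_one_le₀ h1
    have e1 : q / (1 + q ^ 2) = p / (1 + p ^ 2) := by
      rw [hpdef]
      field_simp
      ring
    have e2 : 5 / (1 + q ^ 2) = 5 * p ^ 2 / (1 + p ^ 2) := by
      rw [hpdef]
      field_simp
      ring
    have hle : Real.arctan p ≤ p := by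
      have := Real.le_tan (Real.arctan_nonneg.2 hp0.le) (Real.arctan_lt_pi_div_two p)
      rwa [Real.tan_arctan] at this
    have hge : p / (1 + p ^ 2) ≤ Real.arctan p := by
      have h := Real.sin_le (x := 2 * Real.arctan p)
        (by have := Real.arctan_nonneg.2 hp0.le; linarith)
      rw [Real.sin_two_mul, Real.sin_arctan, Real.cos_arctan] at h
      have hs : √(1 + p ^ 2) * √(1 + p ^ 2) = 1 + p ^ 2 := Real.mul_self_sqrt (by positivity)
      have e : 2 * (p / √(1 + p ^ 2)) * (1 / √(1 + p ^ 2)) = 2 * (p / (1 + p ^ 2)) := by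
        rw [mul_assoc, div_mul_div_comm, hs, mul_one]
      linarith
    have e3 : p - p / (1 + p ^ 2) ≤ 5 * p ^ 2 / (1 + p ^ 2) := by
      rw [sub_le_iff_le_add, ← add_div, le_div_iff₀ (by positivity)]
      nlinarith
    have e4 : 0 ≤ 5 * p ^ 2 / (1 + p ^ 2) := by positivity
    rw [e1, e2, abs_le]
    constructor <;> linarith

/-- The arctangent is a smoothed step, up to the kernel of the conjugate function and a multiple of
the Poisson kernel. -/
lemma abs_arctan_sub_stepSign_le (u : ℝ) {Y : ℝ} (hY : 0 < Y) :
    |Real.arctan (u / Y) - Real.pi / 2 * stepSign u + Y * (u / (u ^ 2 + Y ^ 2))|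
      ≤ 5 * Y * (Y / (u ^ 2 + Y ^ 2)) := by
  have key : ∀ u : ℝ, 0 ≤ u → |Real.arctan (u / Y) - Real.pi / 2 + Y * (u / (u ^ 2 + Y ^ 2))|
      ≤ 5 * Y * (Y / (u ^ 2 + Y ^ 2)) := by
    intro u hu
    have h := abs_arctan_sub_of_nonneg (div_nonneg hu hY.le)
    have e1 : u / Y / (1 + (u / Y) ^ 2) = Y * (u / (u ^ 2 + Y ^ 2)) := by
      field_simp
      ring
    have e2 : 5 / (1 + (u / Y) ^ 2) = 5 * Y * (Y / (u ^ 2 + Y ^ 2)) := by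
      field_simp
      ring
    rwa [e1, e2] at h
  unfold stepSign
  split_ifs with hu
  · simpa using key u hu
  · have h := key (-u) (by linarith)
    rw [neg_div, Real.arctan_neg, neg_sq, neg_div, ← abs_neg] at h
    convert h using 2
    ring

namespace SimplyRealRooted

variable {F : ℂ → ℂ}

lemma finite_zeros_Icc (hF : SimplyRealRooted F) (a b : ℝ) :
    {x : ℝ | x ∈ Icc a b ∧ F x = 0}.Finite := by
  have h := finite_zeros_closedBall hF.differentiable hF.I_ne_zero (|a| + |b| + 1)
  refine Set.Finite.of_finite_image (f := fun x : ℝ => (x : ℂ)) (h.subset ?_)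
    fun x _ y _ hxy => Complex.ofReal_injective hxy
  rintro _ ⟨x, ⟨hx, hx0⟩, rfl⟩
  refine ⟨hx0, ?_⟩
  rw [Metric.mem_closedBall, dist_eq_norm]
  refine (norm_sub_le _ _).trans ?_
  rw [Complex.norm_real, Complex.norm_I, Real.norm_eq_abs]
  gcongr
  exact abs_le.2 ⟨by linarith [hx.1, neg_abs_le a, abs_nonneg b],
    by linarith [hx.2, le_abs_self b, abs_nonneg a]⟩

open Classical in
lemma hasSum_indicator_Icc (hF : SimplyRealRooted F) (a b c : ℝ) :
    HasSum (fun x : realZeros F => if (x : ℝ) ∈ Icc a b then c else 0)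
      (c * ({x : ℝ | x ∈ Icc a b ∧ F x = 0}.ncard : ℝ)) := by
  have hfin := hF.finite_zeros_Icc a b
  have hfin' : {x : realZeros F | (x : ℝ) ∈ Icc a b}.Finite := by
    refine Set.Finite.of_finite_image (f := Subtype.val) (hfin.subset ?_)
      Subtype.val_injective.injOn
    rintro _ ⟨x, hx, rfl⟩
    exact ⟨hx, x.2⟩
  have h := hasSum_sum_of_ne_finset_zero (f := fun x : realZeros F =>
    if (x : ℝ) ∈ Icc a b then c else 0) (s := hfin'.toFinset) (L := .unconditional _) fun x hx => by
      have : ¬ (x : ℝ) ∈ Icc a b := by simpa using hx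
      rw [if_neg this]
  convert h using 1
  rw [Finset.sum_congr rfl fun x hx => if_pos (by simpa using hx), Finset.sum_const, nsmul_eq_mul,
    mul_comm]
  congr 2
  rw [← Set.ncard_eq_toFinset_card _ hfin', ← Set.ncard_image_of_injective _ Subtype.val_injective]
  congr 1
  ext x
  constructor
  · rintro ⟨hx, hx0⟩
    exact ⟨⟨x, hx0⟩, hx, rfl⟩
  · rintro ⟨x, hx, rfl⟩
    exact ⟨hx, x.2⟩

lemma continuous_logDeriv_line (hF : SimplyRealRooted F) {Y : ℝ} (hY : 0 < Y) :
    Continuous fun s : ℝ => logDeriv F (s + Y * Complex.I) := by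
  have h1 : Continuous (deriv F) := (hF.differentiable.contDiff (n := 1)).continuous_deriv le_rfl
  have h2 := hF.differentiable.continuous
  simp only [logDeriv_apply]
  exact (h1.comp (by fun_prop)).div (h2.comp (by fun_prop)) fun s =>
    hF.ne_zero (by simpa using hY.ne')

/-- Integration of the partial fractions along a horizontal line. -/
lemma hasSum_arctan (hF : SimplyRealRooted F) (T : ℝ) {Y : ℝ} (hY : 0 < Y) :
    HasSum (fun x : realZeros F => Real.arctan ((T - x) / Y) + Real.arctan (x / Y))
      (∫ s in (0 : ℝ)..T, -(logDeriv F (s + Y * Complex.I)).im) := by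
  have := hF.countable_realZeros
  have hpo : ∀ s : ℝ, HasSum (fun x : realZeros F => Y / (((x : ℝ) - s) ^ 2 + Y ^ 2))
      (-(logDeriv F (s + Y * Complex.I)).im) := fun s => by
    simpa using hF.hasSum_poisson (z := s + Y * Complex.I) (by simpa using hY)
  have hc : Continuous fun s : ℝ => -(logDeriv F (s + Y * Complex.I)).im := by
    have := hF.continuous_logDeriv_line hY
    fun_prop
  have hcx : ∀ x : realZeros F, Continuous fun s : ℝ => Y / (((x : ℝ) - s) ^ 2 + Y ^ 2) := fun x => by
    refine continuous_const.div (by fun_prop) fun s => ?_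
    positivity
  have h := intervalIntegral.hasSum_integral_of_dominated_convergence (μ := volume) (a := 0) (b := T)
    (F := fun (x : realZeros F) (s : ℝ) => Y / (((x : ℝ) - s) ^ 2 + Y ^ 2))
    (f := fun s : ℝ => -(logDeriv F (s + Y * Complex.I)).im)
    (fun (x : realZeros F) (s : ℝ) => Y / (((x : ℝ) - s) ^ 2 + Y ^ 2))
    (fun x => (hcx x).aestronglyMeasurable)
    (fun x => Eventually.of_forall fun s _ => by rw [Real.norm_of_nonneg (by positivity)])
    (Eventually.of_forall fun s _ => (hpo s).summable)
    (by simp_rw [fun s => (hpo s).tsum_eq]; exact hc.intervalIntegrable _ _)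
    (Eventually.of_forall fun s _ => hpo s)
  refine h.congr_fun fun x => ?_
  have hd : ∀ s ∈ uIcc 0 T, HasDerivAt (fun s : ℝ => Real.arctan ((s - x) / Y))
      (Y / (((x : ℝ) - s) ^ 2 + Y ^ 2)) s := by
    intro s _
    refine ((((hasDerivAt_id' s).sub_const (x : ℝ)).div_const Y).arctan).congr_deriv ?_
    field_simp
    ring
  rw [intervalIntegral.integral_eq_sub_of_hasDerivAt hd ((hcx x).intervalIntegrable _ _), zero_sub,
    neg_div, Real.arctan_neg, sub_neg_eq_add]

/-- The number of zeros in `[0, T]` in terms of the logarithmic derivative `L` on the line at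
height `Y`. The error is a Poisson sum and a conjugate Poisson sum at the two endpoints, that is, a
combination of the values of `L` there. -/
theorem abs_pi_mul_ncard_sub_le (hF : SimplyRealRooted F) {T Y : ℝ} (hT : 0 ≤ T) (hY : 0 < Y) :
    |Real.pi * ({x : ℝ | x ∈ Icc 0 T ∧ F x = 0}.ncard : ℝ)
        - ∫ s in (0 : ℝ)..T, -(logDeriv F (s + Y * Complex.I)).im|
      ≤ 6 * Y * (‖logDeriv F (T + Y * Complex.I)‖ + ‖logDeriv F (Y * Complex.I)‖) := by
  classical
  have hN := hF.hasSum_indicator_Icc 0 T Real.pi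
  have hA := hF.hasSum_arctan T hY
  have him : ∀ s : ℝ, 0 < (s + Y * Complex.I : ℂ).im := fun s => by simpa using hY
  have hL := (Complex.hasSum_re (hF.hasSum_one_div_sub (him T) (him 0))).mul_left Y
  have hpo : ∀ s : ℝ, HasSum (fun x : realZeros F => Y / (((x : ℝ) - s) ^ 2 + Y ^ 2))
      (-(logDeriv F (s + Y * Complex.I)).im) := fun s => by
    simpa using hF.hasSum_poisson (him s)
  have hP1 := hpo T
  have hP0 := hpo 0
  have hP := (hP1.add hP0).mul_left (5 * Y)
  have hD := (hA.sub hN).add hL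
  have hre : ∀ s x : ℝ, (1 / ((s : ℂ) + Y * Complex.I - x)).re
      = (s - x) / ((s - x) ^ 2 + Y ^ 2) := fun s x => by
    rw [one_div, Complex.inv_re, Complex.normSq_apply]
    simp
    congr 1
    ring
  have hb : ∀ x : realZeros F, |(Real.arctan ((T - x) / Y) + Real.arctan (x / Y)
      - (if (x : ℝ) ∈ Icc 0 T then Real.pi else 0))
      + Y * (1 / ((T : ℂ) + Y * Complex.I - (x : ℝ))
        - 1 / (((0 : ℝ) : ℂ) + Y * Complex.I - (x : ℝ))).re|
      ≤ 5 * Y * (Y / (((x : ℝ) - T) ^ 2 + Y ^ 2) + Y / (((x : ℝ) - 0) ^ 2 + Y ^ 2)) := by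
    rintro ⟨x, hx⟩
    have h1 := abs_arctan_sub_stepSign_le (T - x) hY
    have h2 := abs_arctan_sub_stepSign_le x hY
    have hs : (if x ∈ Icc 0 T then Real.pi else 0)
        = Real.pi / 2 * stepSign (T - x) + Real.pi / 2 * stepSign x := by
      unfold stepSign
      simp only [mem_Icc, sub_nonneg]
      split_ifs <;> grind
    simp only [Complex.sub_re, hre, hs, zero_sub]
    rw [show (x - T) ^ 2 = (T - x) ^ 2 by ring, sub_zero, neg_sq, mul_add]
    refine le_trans (le_of_eq ?_) ((abs_add_le _ _).trans (add_le_add h1 h2))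
    congr 1
    ring
  have hsum := hD.norm_le_of_bounded hP hb
  rw [Complex.ofReal_zero, zero_add] at hsum
  set L1 := logDeriv F (T + Y * Complex.I)
  set L0 := logDeriv F (Y * Complex.I)
  have a1 := abs_le.1 (Complex.abs_re_le_norm L1)
  have a2 := abs_le.1 (Complex.abs_re_le_norm L0)
  have a3 := abs_le.1 (Complex.abs_im_le_norm L1)
  have a4 := abs_le.1 (Complex.abs_im_le_norm L0)
  have a5 : |Y * (L1 - L0).re| ≤ Y * (‖L1‖ + ‖L0‖) := by
    rw [abs_mul, abs_of_pos hY]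
    gcongr
    exact (Complex.abs_re_le_norm _).trans (norm_sub_le _ _)
  have a6 : 5 * Y * (-L1.im + -L0.im) ≤ 5 * Y * (‖L1‖ + ‖L0‖) := by
    gcongr <;> linarith
  have a7 := abs_le.1 a5
  have a8 := abs_le.1 hsum
  rw [abs_le]
  constructor <;> linarith
end SimplyRealRooted

/-! ### The Riemann–von Mangoldt formula -/

lemma simplyRealRooted_H (hLam : Lam < 0) {t : ℝ} (ht : Lam < t) : SimplyRealRooted (H t) := by
  have h := (hasOnlyRealZeros_of_Lam_lt hLam ht).realRooted
  rw [← funext (H_eq_fourierExp t)] at h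
  exact ⟨h, fun x hx => deriv_H_ne_zero (fun s hs => hasOnlyRealZeros_of_Lam_lt hLam hs) ht hx⟩

/-- Uniform asymptotics of the logarithmic derivative of `H_t` above a logarithmic curve. -/
lemma exists_abs_im_logDeriv_H_sub_le : ∃ A C : ℝ, 1 ≤ A ∧ 0 < C ∧ ∀ t : ℝ, Lam < t → t ≤ 0 →
    ∀ z : ℂ, A * Real.log (2 + ‖z‖) ≤ z.im →
      |-(logDeriv (H t) z).im - 1 / 4 * Real.log (‖z‖ / (4 * Real.pi))|
        ≤ C * (Real.log (2 + ‖z‖) / ‖z‖) ∧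
      ‖logDeriv (H t) z‖ ≤ (1 + C) * Real.log (2 + ‖z‖) := by
  obtain ⟨A, C, hA, hC, h⟩ := exists_norm_logDeriv_H_sub_le
  refine ⟨max A 1000, C, hA.trans (le_max_left _ _), hC, fun t ht ht0 z hz => ?_⟩
  have hl0 : 0 ≤ Real.log (2 + ‖z‖) := Real.log_nonneg (by linarith [norm_nonneg z])
  obtain ⟨hl, hAz⟩ := log_two_add_bounds (norm_nonneg z) (le_max_right A 1000)
    (hz.trans ((le_abs_self _).trans (Complex.abs_im_le_norm z)))
  have hz1 : 1000 ≤ ‖z‖ := (le_max_right _ _).trans hAz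
  set w := -Complex.I * z with hw
  have hwn : ‖w‖ = ‖z‖ := by simp [hw]
  have hwre : w.re = z.im := by simp [hw]
  have hwz : Complex.I * w = z := by
    rw [hw]
    linear_combination (-z) * Complex.I_sq
  have hb := h t ht ht0 w (by
    rw [hwn, hwre]
    exact (mul_le_mul_of_nonneg_right (le_max_left _ _) hl0).trans hz)
  rw [hwz, hwn] at hb
  have hlog : ‖1 / 4 * Complex.log (w / (4 * Real.pi))‖ ≤ Real.log (2 + ‖z‖) := by
    rw [← hwn]
    refine norm_quarter_log_le ?_ (by rwa [hwn])
    rw [hwn]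
    linarith [Real.pi_lt_d2]
  constructor
  · have hre : (Complex.I * logDeriv (H t) z - 1 / 4 * Complex.log (w / (4 * Real.pi))).re
        = -(logDeriv (H t) z).im - 1 / 4 * Real.log (‖z‖ / (4 * Real.pi)) := by
      have hn : ‖w / (4 * Real.pi)‖ = ‖z‖ / (4 * Real.pi) := by
        rw [norm_div, hwn]
        congr 1
        rw [show (4 * Real.pi : ℂ) = ((4 * Real.pi : ℝ) : ℂ) by push_cast; ring, Complex.norm_real,
          Real.norm_of_nonneg (by positivity)]
      have e : (1 / 4 * Complex.log (w / (4 * Real.pi))).re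
          = 1 / 4 * Real.log (‖z‖ / (4 * Real.pi)) := by
        rw [show (1 / 4 : ℂ) = ((1 / 4 : ℝ) : ℂ) by push_cast; ring, Complex.re_ofReal_mul,
          Complex.log_re, hn]
      rw [Complex.sub_re, e]
      simp
    rw [← hre]
    exact (Complex.abs_re_le_norm _).trans hb
  · have h1 := norm_sub_norm_le (Complex.I * logDeriv (H t) z)
      (1 / 4 * Complex.log (w / (4 * Real.pi)))
    rw [norm_mul, Complex.norm_I, one_mul] at h1
    have h2 : Real.log (2 + ‖z‖) / ‖z‖ ≤ Real.log (2 + ‖z‖) := div_le_self hl0 (by linarith)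
    nlinarith

lemma logPlus_of_nonneg {T : ℝ} (hT : 0 ≤ T) : logPlus T = Real.log (2 + T) := by
  rw [logPlus, abs_of_nonneg hT]

lemma half_le_logPlus {T : ℝ} : 1 / 2 ≤ logPlus T := by
  have h : Real.log 2 ≤ logPlus T := Real.log_le_log two_pos (by linarith [abs_nonneg T])
  linarith [Real.log_two_gt_d9]

lemma logPlus_le {T : ℝ} (hT : 0 ≤ T) : logPlus T ≤ 2 + T := by
  rw [logPlus_of_nonneg hT]
  linarith [Real.log_le_sub_one_of_pos (by linarith : 0 < 2 + T)]

lemma log_two_add_le {T D n : ℝ} (hT : 0 ≤ T) (hD : 0 ≤ D) (hn0 : 0 ≤ n)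
    (hn : n ≤ T + D * logPlus T) : Real.log (2 + n) ≤ logPlus T + Real.log (1 + D) := by
  rw [logPlus_of_nonneg hT, ← Real.log_mul (by linarith) (by linarith)]
  refine Real.log_le_log (by linarith) ?_
  nlinarith [logPlus_le hT]

lemma log_two_add_le_mul {T D n : ℝ} (hT : 0 ≤ T) (hD : 0 ≤ D) (hn0 : 0 ≤ n)
    (hn : n ≤ T + D * logPlus T) :
    Real.log (2 + n) ≤ (1 + 2 * Real.log (1 + D)) * logPlus T := by
  have := log_two_add_le hT hD hn0 hn
  nlinarith [half_le_logPlus (T := T), Real.log_nonneg (by linarith : 1 ≤ 1 + D)]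

/-- The condition under which the points of height `m log₊ T` over `[0, T + β log₊ T]` lie in the
region where the asymptotics hold; it is met by all large `m`. -/
lemma exists_forall_mul_log_le {A β : ℝ} (hA : 1 ≤ A) (hβ : 0 ≤ β) : ∃ m₀ : ℝ, 100 ≤ m₀ ∧
    ∀ m, m₀ ≤ m → A * (1 + 2 * Real.log (1 + (β + m))) ≤ m := by
  set p := Real.log (4 * A)
  have hp : 0 ≤ p := Real.log_nonneg (by linarith)
  refine ⟨100 + β + 4 * A * p, by nlinarith, fun m hm => ?_⟩
  have hm0 : 0 < 1 + (β + m) := by nlinarith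
  have h1 := Real.log_le_sub_one_of_pos (x := (1 + (β + m)) / (4 * A)) (by positivity)
  rw [Real.log_div hm0.ne' (by positivity)] at h1
  have h2 : A * ((1 + (β + m)) / (4 * A)) = (1 + (β + m)) / 4 := by field_simp
  nlinarith

lemma integral_log_sq_add_sq (T : ℝ) {Y : ℝ} (hY : 0 < Y) :
    ∫ s in (0 : ℝ)..T, Real.log (s ^ 2 + Y ^ 2)
      = T * Real.log (T ^ 2 + Y ^ 2) - 2 * T + 2 * Y * Real.arctan (T / Y) := by
  have hd : ∀ s ∈ uIcc 0 T, HasDerivAt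
      (fun s : ℝ => s * Real.log (s ^ 2 + Y ^ 2) - 2 * s + 2 * Y * Real.arctan (s / Y))
      (Real.log (s ^ 2 + Y ^ 2)) s := by
    intro s _
    have h1 := (((hasDerivAt_id' s).fun_pow 2).add_const (Y ^ 2)).log (by positivity)
    have h2 := ((hasDerivAt_id' s).div_const Y).arctan.const_mul (2 * Y)
    refine ((((hasDerivAt_id' s).fun_mul h1).fun_sub ((hasDerivAt_id' s).const_mul 2)).fun_add
      h2).congr_deriv ?_
    field_simp
    ring
  have hc : Continuous fun s : ℝ => Real.log (s ^ 2 + Y ^ 2) :=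
    (by fun_prop : Continuous fun s : ℝ => s ^ 2 + Y ^ 2).log fun s => by positivity
  rw [intervalIntegral.integral_eq_sub_of_hasDerivAt hd (hc.intervalIntegrable _ _)]
  simp

lemma norm_add_mul_I (s Y : ℝ) : ‖(s + Y * Complex.I : ℂ)‖ = √(s ^ 2 + Y ^ 2) := by
  rw [Complex.norm_def, Complex.normSq_apply]
  simp
  ring_nf

/-- The main term: integrating the logarithm along a line of height `Y` gives `π Ψ(T)`. -/
lemma abs_integral_log_norm_sub_le {T Y : ℝ} (hT : 0 < T) (hY : 0 < Y) :
    |(∫ s in (0 : ℝ)..T, 1 / 4 * Real.log (‖(s + Y * Complex.I : ℂ)‖ / (4 * Real.pi)))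
      - Real.pi * Psi T| ≤ Y := by
  have hpi := Real.pi_pos
  have e : ∀ s : ℝ, 1 / 4 * Real.log (‖(s + Y * Complex.I : ℂ)‖ / (4 * Real.pi))
      = 1 / 8 * Real.log (s ^ 2 + Y ^ 2) - 1 / 4 * Real.log (4 * Real.pi) := by
    intro s
    have hp : 0 < s ^ 2 + Y ^ 2 := by positivity
    rw [norm_add_mul_I, Real.log_div (Real.sqrt_pos.2 hp).ne' (by positivity),
      Real.log_sqrt hp.le]
    ring
  have hc : Continuous fun s : ℝ => Real.log (s ^ 2 + Y ^ 2) :=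
    (by fun_prop : Continuous fun s : ℝ => s ^ 2 + Y ^ 2).log fun s => by positivity
  simp_rw [e]
  rw [intervalIntegral.integral_sub ((hc.intervalIntegrable _ _).const_mul _)
    (by simp), intervalIntegral.integral_const_mul, integral_log_sq_add_sq T hY,
    intervalIntegral.integral_const, smul_eq_mul, sub_zero, Psi,
    Real.log_div hT.ne' (by positivity)]
  have hlo : 2 * Real.log T ≤ Real.log (T ^ 2 + Y ^ 2) := by
    rw [show 2 * Real.log T = Real.log (T ^ 2) by rw [Real.log_pow]; norm_num]
    exact Real.log_le_log (by positivity) (by nlinarith)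
  have hhi : Real.log (T ^ 2 + Y ^ 2) ≤ 2 * Real.log T + 2 * (Y / T) := by
    have h1 : Real.log (T ^ 2 + Y ^ 2) ≤ Real.log ((T + Y) ^ 2) :=
      Real.log_le_log (by positivity) (by nlinarith)
    have h2 : Real.log (T + Y) = Real.log T + Real.log (1 + Y / T) := by
      rw [← Real.log_mul hT.ne' (by positivity)]
      congr 1
      field_simp
    have h3 := Real.log_le_sub_one_of_pos (x := 1 + Y / T) (by positivity)
    rw [Real.log_pow] at h1
    push_cast at h1
    linarith
  have ha := Real.arctan_nonneg.2 (div_nonneg hT.le hY.le)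
  have ha' := Real.arctan_lt_pi_div_two (T / Y)
  have hpi4 := Real.pi_le_four
  have hTY : T * (Y / T) = Y := by field_simp
  have e2 : 1 / 8 * (T * Real.log (T ^ 2 + Y ^ 2) - 2 * T + 2 * Y * Real.arctan (T / Y))
      - T * (1 / 4 * Real.log (4 * Real.pi))
      - Real.pi * (T / (4 * Real.pi) * (Real.log T - Real.log (4 * Real.pi)) - T / (4 * Real.pi))
      = 1 / 8 * (T * (Real.log (T ^ 2 + Y ^ 2) - 2 * Real.log T))
        + 1 / 4 * (Y * Real.arctan (T / Y)) := by
    field_simp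
    ring
  rw [e2]
  have b1 : T * (Real.log (T ^ 2 + Y ^ 2) - 2 * Real.log T) ≤ 2 * Y := by
    calc _ ≤ T * (2 * (Y / T)) := by gcongr; linarith
      _ = 2 * Y := by linarith
  have b2 : 0 ≤ T * (Real.log (T ^ 2 + Y ^ 2) - 2 * Real.log T) :=
    mul_nonneg hT.le (by linarith)
  have b3 : 0 ≤ Y * Real.arctan (T / Y) := by positivity
  have b4 : Y * Real.arctan (T / Y) ≤ Y * 2 := by gcongr; linarith
  rw [abs_le]
  constructor <;> linarith

theorem exists_abs_N_sub_Psi_le (hLam : Lam < 0) : ∃ K : ℝ, ∀ t : ℝ, Lam < t → t ≤ 0 →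
    ∀ T : ℝ, 0 < T → |(N t (Icc 0 T) : ℝ) - Psi T| ≤ K * logPlus T ^ 2 := by
  obtain ⟨A, C, hA, hC, h⟩ := exists_abs_im_logDeriv_H_sub_le
  obtain ⟨m, hm, hmA⟩ := exists_forall_mul_log_le hA le_rfl
  have hmA := hmA m le_rfl
  rw [zero_add] at hmA
  set c := 1 + 2 * Real.log (1 + m)
  have hc : 1 ≤ c := by
    have := Real.log_nonneg (by linarith : 1 ≤ 1 + m)
    simp only [c]
    linarith
  refine ⟨12 * m * (1 + C) * c + 2 * m + 2 * C * c, fun t ht ht0 T hT => ?_⟩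
  have hF := simplyRealRooted_H hLam ht
  set l := logPlus T with hl_def
  have hl : 1 / 2 ≤ l := half_le_logPlus
  set Y := m * l with hYdef
  have hY : 50 ≤ Y := by nlinarith
  have hYl : Y ≤ 2 * m * l ^ 2 := by nlinarith
  have hlog : ∀ s ∈ Icc 0 T, Real.log (2 + ‖(s + Y * Complex.I : ℂ)‖) ≤ c * l := by
    intro s hs
    refine log_two_add_le_mul hT.le (by linarith) (norm_nonneg _) ?_
    refine (norm_add_le _ _).trans ?_
    rw [norm_mul, Complex.norm_I, mul_one, Complex.norm_real, Complex.norm_real,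
      Real.norm_of_nonneg hs.1, Real.norm_of_nonneg (by linarith)]
    linarith [hs.2]
  have hreg : ∀ s ∈ Icc 0 T, A * Real.log (2 + ‖(s + Y * Complex.I : ℂ)‖)
      ≤ (s + Y * Complex.I : ℂ).im := by
    intro s hs
    have : A * Real.log (2 + ‖(s + Y * Complex.I : ℂ)‖) ≤ Y := by
      calc _ ≤ A * (c * l) := by gcongr; exact hlog s hs
        _ = A * c * l := by ring
        _ ≤ m * l := by gcongr
    simpa using this
  have hasy := fun s hs => h t ht ht0 _ (hreg s hs)
  have hcount := hF.abs_pi_mul_ncard_sub_le hT.le (by linarith : 0 < Y)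
  have hmain := abs_integral_log_norm_sub_le hT (by linarith : 0 < Y)
  have hL1 := (hasy T ⟨hT.le, le_rfl⟩).2.trans
    (mul_le_mul_of_nonneg_left (hlog T ⟨hT.le, le_rfl⟩) (by linarith))
  have hL0 := (hasy 0 ⟨le_rfl, hT.le⟩).2.trans
    (mul_le_mul_of_nonneg_left (hlog 0 ⟨le_rfl, hT.le⟩) (by linarith))
  rw [Complex.ofReal_zero, zero_add] at hL0
  have hc1 : Continuous fun s : ℝ => -(logDeriv (H t) (s + Y * Complex.I)).im := by
    have := hF.continuous_logDeriv_line (by linarith : 0 < Y)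
    fun_prop
  have hc2 : Continuous fun s : ℝ =>
      1 / 4 * Real.log (‖(s + Y * Complex.I : ℂ)‖ / (4 * Real.pi)) := by
    refine continuous_const.mul (Continuous.log (by fun_prop) fun s => ?_)
    rw [norm_add_mul_I]
    have := Real.pi_pos
    have : 0 < s ^ 2 + Y ^ 2 := by nlinarith [sq_nonneg s]
    positivity
  have hint : ∫ s in (0 : ℝ)..T, C * (c * l) * (2 * (1 / (s + 1)))
      = C * (c * l) * (2 * Real.log (T + 1)) := by
    rw [intervalIntegral.integral_const_mul, intervalIntegral.integral_const_mul,
      intervalIntegral.integral_comp_add_right (fun s => 1 / s), integral_one_div_of_pos (by linarith)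
      (by linarith)]
    simp
  -- `|s + iY|` is at least `(s + 1) / 2`, so the error integrates to another logarithm
  have herr : |(∫ s in (0 : ℝ)..T, -(logDeriv (H t) (s + Y * Complex.I)).im)
      - ∫ s in (0 : ℝ)..T, 1 / 4 * Real.log (‖(s + Y * Complex.I : ℂ)‖ / (4 * Real.pi))|
      ≤ C * (c * l) * (2 * Real.log (T + 1)) := by
    rw [← intervalIntegral.integral_sub (hc1.intervalIntegrable _ _) (hc2.intervalIntegrable _ _),
      ← hint, ← Real.norm_eq_abs]
    refine intervalIntegral.norm_integral_le_of_norm_le hT.le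
      (Eventually.of_forall fun s hs => ?_) ?_
    · have hs' : s ∈ Icc 0 T := ⟨hs.1.le, hs.2⟩
      refine (hasy s hs').1.trans ?_
      rw [mul_assoc]
      refine mul_le_mul_of_nonneg_left ?_ hC.le
      rw [div_eq_mul_one_div]
      have hn1 := (le_abs_self _).trans (Complex.abs_re_le_norm (s + Y * Complex.I : ℂ))
      have hn2 := (le_abs_self _).trans (Complex.abs_im_le_norm (s + Y * Complex.I : ℂ))
      simp at hn1 hn2
      refine mul_le_mul (hlog s hs') ?_ (by positivity) (by positivity)
      rw [mul_one_div, div_le_div_iff₀ (by linarith) (by linarith [hs.1])]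
      linarith
    · refine ContinuousOn.intervalIntegrable ?_
      rw [uIcc_of_le hT.le]
      refine continuousOn_const.mul (continuousOn_const.mul (continuousOn_const.div (by fun_prop)
        fun s hs => ?_))
      linarith [hs.1]
  have hlogT : Real.log (T + 1) ≤ l := by
    rw [hl_def, logPlus_of_nonneg hT.le]
    exact Real.log_le_log (by linarith) (by linarith)
  have herr' : C * (c * l) * (2 * Real.log (T + 1)) ≤ 2 * C * c * l ^ 2 := by
    calc _ ≤ C * (c * l) * (2 * l) := by gcongr
      _ = _ := by ring
  have hcount' : 6 * Y * (‖logDeriv (H t) (T + Y * Complex.I)‖ + ‖logDeriv (H t) (Y * Complex.I)‖)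
      ≤ 12 * m * (1 + C) * c * l ^ 2 := by
    calc _ ≤ 6 * Y * ((1 + C) * (c * l) + (1 + C) * (c * l)) := by
          refine mul_le_mul_of_nonneg_left (add_le_add hL1 hL0) (by linarith)
      _ = _ := by rw [hYdef]; ring
  have hpi : |(N t (Icc 0 T) : ℝ) - Psi T| ≤ |Real.pi * N t (Icc 0 T) - Real.pi * Psi T| := by
    rw [← mul_sub, abs_mul, abs_of_pos Real.pi_pos]
    exact le_mul_of_one_le_left (abs_nonneg _) (by linarith [Real.pi_gt_three])
  refine hpi.trans ?_
  change |Real.pi * (N t (Icc 0 T) : ℝ) - _| ≤ _ at hcount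
  have a1 := abs_le.1 hcount
  have a2 := abs_le.1 herr
  have a3 := abs_le.1 hmain
  rw [abs_le]
  constructor <;> linarith

/-! ### A Tauberian theorem of Karamata type -/

/-- The function `q ↦ 1 / (1 + |a| q)` on the unit interval; the absolute value makes it continuous
for every real `a`. -/
def resolventFn (a : ℝ) : C(Icc (0 : ℝ) 1, ℝ) where
  toFun q := 1 / (1 + |a| * q)
  continuous_toFun := by
    refine continuous_const.div (by fun_prop) fun q => ?_
    have := mul_nonneg (abs_nonneg a) q.2.1
    positivity

/-- The coordinate function on the unit interval. -/
def coordFn : C(Icc (0 : ℝ) 1, ℝ) := ⟨fun q => q, by fun_prop⟩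

/-- Convergence of uniformly bounded functionals on `C([0, 1])` may be tested on the functions
`1 / (1 + a q)`: expanding in powers of `a` recovers all monomials, hence all polynomials. -/
theorem tendsto_of_tendsto_resolventFn {ι : Type*} {l : Filter ι}
    {M : ι → C(Icc (0 : ℝ) 1, ℝ) →ₗ[ℝ] ℝ} {M₀ : C(Icc (0 : ℝ) 1, ℝ) →ₗ[ℝ] ℝ} {B : ℝ}
    (hM : ∀ᶠ i in l, ∀ φ, |M i φ| ≤ B * ‖φ‖) (hM₀ : ∀ φ, |M₀ φ| ≤ B * ‖φ‖)
    (h : ∀ a, 0 ≤ a → Tendsto (fun i => M i (resolventFn a)) l (𝓝 (M₀ (resolventFn a))))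
    (φ : C(Icc (0 : ℝ) 1, ℝ)) : Tendsto (fun i => M i φ) l (𝓝 (M₀ φ)) := by
  have hB : 0 ≤ B := by
    have := (abs_nonneg _).trans (hM₀ 1)
    rw [norm_one, mul_one] at this
    exact this
  have hclosed : ∀ φ : C(Icc (0 : ℝ) 1, ℝ), (∀ ε > 0, ∃ ψ : C(Icc (0 : ℝ) 1, ℝ), ‖φ - ψ‖ ≤ ε ∧
      Tendsto (fun i => M i ψ) l (𝓝 (M₀ ψ))) → Tendsto (fun i => M i φ) l (𝓝 (M₀ φ)) := by
    intro φ hφ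
    rw [Metric.tendsto_nhds]
    intro ε hε
    obtain ⟨ψ, hψ, hψt⟩ := hφ (ε / (3 * (B + 1))) (by positivity)
    filter_upwards [hM, Metric.tendsto_nhds.1 hψt (ε / 3) (by positivity)] with i hi hi2
    have h1 := hi (φ - ψ)
    have h2 := hM₀ (φ - ψ)
    have h3 : B * ‖φ - ψ‖ < ε / 3 := by
      calc _ ≤ B * (ε / (3 * (B + 1))) := by gcongr
        _ < (B + 1) * (ε / (3 * (B + 1))) := by gcongr; linarith
        _ = ε / 3 := by field_simp
    rw [map_sub] at h1 h2
    rw [Real.dist_eq] at hi2 ⊢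
    rw [abs_lt] at hi2 ⊢
    rw [abs_le] at h1 h2
    constructor <;> linarith
  have hmono : ∀ (n : ℕ) (a : ℝ), 0 ≤ a → Tendsto (fun i => M i (coordFn ^ n * resolventFn a)) l
      (𝓝 (M₀ (coordFn ^ n * resolventFn a))) := by
    intro n
    induction n with
    | zero => simpa using h
    | succ n ih =>
      have hpos : ∀ a : ℝ, 0 < a → Tendsto (fun i => M i (coordFn ^ (n + 1) * resolventFn a)) l
          (𝓝 (M₀ (coordFn ^ (n + 1) * resolventFn a))) := by
        intro a ha
        -- `q ^ (n + 1) / (1 + a q) = (q ^ n - q ^ n / (1 + a q)) / a`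
        have e : coordFn ^ (n + 1) * resolventFn a
            = a⁻¹ • (coordFn ^ n * resolventFn 0 - coordFn ^ n * resolventFn a) := by
          ext q
          have hq : (1 + a * q : ℝ) ≠ 0 := by
            have := mul_nonneg ha.le q.2.1
            positivity
          simp [resolventFn, coordFn, abs_of_pos ha]
          field_simp
          ring
        simp_rw [e, map_smul, map_sub]
        exact ((ih 0 le_rfl).sub (ih a ha.le)).const_smul _
      intro a ha
      rcases ha.eq_or_lt with rfl | ha
      -- the case `a = 0` is the uniform limit as `a → 0`
      · refine hclosed _ fun ε hε => ⟨_, ?_, hpos ε hε⟩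
        rw [ContinuousMap.norm_le _ hε.le]
        intro q
        have hq0 := q.2.1
        have hq1 := q.2.2
        have hq : (0 : ℝ) < 1 + ε * q := by positivity
        have hqn : (q : ℝ) ^ (n + 1) ≤ 1 := pow_le_one₀ hq0 hq1
        have hqn0 : 0 ≤ (q : ℝ) ^ (n + 1) := pow_nonneg hq0 _
        have e : (coordFn ^ (n + 1) * resolventFn 0 - coordFn ^ (n + 1) * resolventFn ε) q
            = (q : ℝ) ^ (n + 1) * (ε * q / (1 + ε * q)) := by
          simp [resolventFn, coordFn, abs_of_pos hε]
          field_simp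
          ring
        have h2 : ε * q / (1 + ε * q) ≤ ε := by
          rw [div_le_iff₀ hq]
          nlinarith [mul_nonneg hε.le hq0, mul_nonneg hε.le (mul_nonneg hε.le hq0)]
        have h3 : 0 ≤ ε * q / (1 + ε * q) := by positivity
        rw [e, Real.norm_of_nonneg (mul_nonneg hqn0 h3)]
        nlinarith
      · exact hpos a ha
  have hpow : ∀ n : ℕ, Tendsto (fun i => M i (coordFn ^ n)) l (𝓝 (M₀ (coordFn ^ n))) := by
    intro n
    have h0 : resolventFn 0 = 1 := by
      ext q
      simp [resolventFn]
    simpa [h0] using hmono n 0 le_rfl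
  have hpoly : ∀ p : Polynomial ℝ, Tendsto (fun i => M i (p.toContinuousMapOn (Icc 0 1))) l
      (𝓝 (M₀ (p.toContinuousMapOn (Icc 0 1)))) := by
    intro p
    have e : p.toContinuousMapOn (Icc 0 1)
        = ∑ n ∈ Finset.range (p.natDegree + 1), p.coeff n • coordFn ^ n := by
      ext q
      simp [Polynomial.eval_eq_sum_range, coordFn, ContinuousMap.sum_apply]
    simp_rw [e, map_sum, map_smul]
    exact tendsto_finsetSum _ fun n _ => (hpow n).const_smul _
  refine hclosed φ fun ε hε => ?_
  obtain ⟨p, hp⟩ := exists_polynomial_near_continuousMap 0 1 φ ε hε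
  exact ⟨_, by rw [norm_sub_rev]; exact hp.le, hpoly p⟩

/-- The point `m² / (p² + m²)` of the unit interval, a change of variables compactifying the
line. -/
def cauchyPoint (m p : ℝ) : Icc (0 : ℝ) 1 :=
  ⟨m ^ 2 / (p ^ 2 + m ^ 2), by positivity,
    div_le_one_of_le₀ (by linarith [sq_nonneg p]) (by positivity)⟩

lemma continuous_cauchyPoint {m : ℝ} (hm : 0 < m) : Continuous (cauchyPoint m) := by
  refine Continuous.subtype_mk (continuous_const.div (by fun_prop) fun p => ?_) _
  positivity

lemma cauchyPoint_eq_inv {m : ℝ} (hm : 0 < m) (p : ℝ) :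
    (cauchyPoint m p : ℝ) = (1 + (p / m) ^ 2)⁻¹ := by
  simp only [cauchyPoint]
  field_simp
  ring

lemma integrable_cauchyPoint {m : ℝ} (hm : 0 < m) :
    Integrable fun p => (cauchyPoint m p : ℝ) := by
  simp_rw [cauchyPoint_eq_inv hm]
  exact integrable_inv_one_add_sq.comp_div hm.ne'

lemma integral_cauchyPoint {m : ℝ} (hm : 0 < m) :
    ∫ p, (cauchyPoint m p : ℝ) = m * Real.pi := by
  simp_rw [cauchyPoint_eq_inv hm]
  rw [Measure.integral_comp_div (fun p : ℝ => (1 + p ^ 2)⁻¹), integral_univ_inv_one_add_sq,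
    abs_of_pos hm, smul_eq_mul]

lemma abs_cauchyPoint_mul_le (m p : ℝ) (φ : C(Icc (0 : ℝ) 1, ℝ)) :
    |(cauchyPoint m p : ℝ) * φ (cauchyPoint m p)| ≤ (cauchyPoint m p : ℝ) * ‖φ‖ := by
  rw [abs_mul, abs_of_nonneg (cauchyPoint m p).2.1]
  exact mul_le_mul_of_nonneg_left (φ.norm_coe_le_norm _) (cauchyPoint m p).2.1

lemma integrable_cauchyPoint_mul {m : ℝ} (hm : 0 < m) (φ : C(Icc (0 : ℝ) 1, ℝ)) :
    Integrable fun p => (cauchyPoint m p : ℝ) * φ (cauchyPoint m p) := by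
  have hc := continuous_cauchyPoint hm
  exact ((integrable_cauchyPoint hm).mul_const ‖φ‖).mono'
    ((continuous_subtype_val.comp hc).mul (φ.continuous.comp hc)).aestronglyMeasurable
    (Eventually.of_forall fun p => abs_cauchyPoint_mul_le m p φ)

/-- The functional `φ ↦ (1/4π) ∫ q(p) φ(q(p)) dp` with `q = cauchyPoint m`, which describes zeros
equidistributed with density `1/4π`. -/
def uniformFunctional {m : ℝ} (hm : 0 < m) : C(Icc (0 : ℝ) 1, ℝ) →ₗ[ℝ] ℝ where
  toFun φ := 1 / (4 * Real.pi) * ∫ p, (cauchyPoint m p : ℝ) * φ (cauchyPoint m p)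
  map_add' φ ψ := by
    simp only [ContinuousMap.add_apply, mul_add]
    rw [integral_add (integrable_cauchyPoint_mul hm φ) (integrable_cauchyPoint_mul hm ψ), mul_add]
  map_smul' c φ := by
    simp only [ContinuousMap.smul_apply, smul_eq_mul, RingHom.id_apply]
    simp_rw [mul_left_comm _ c]
    rw [integral_const_mul]
    ring

lemma uniformFunctional_apply {m : ℝ} (hm : 0 < m) (φ : C(Icc (0 : ℝ) 1, ℝ)) :
    uniformFunctional hm φ
      = 1 / (4 * Real.pi) * ∫ p, (cauchyPoint m p : ℝ) * φ (cauchyPoint m p) := rfl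

lemma abs_uniformFunctional_le {m : ℝ} (hm : 0 < m) (φ : C(Icc (0 : ℝ) 1, ℝ)) :
    |uniformFunctional hm φ| ≤ uniformFunctional hm 1 * ‖φ‖ := by
  have hpi := Real.pi_pos
  simp only [uniformFunctional_apply, ContinuousMap.one_apply, mul_one]
  rw [abs_mul, abs_of_pos (by positivity), mul_assoc, ← integral_mul_const]
  gcongr
  rw [← Real.norm_eq_abs]
  exact norm_integral_le_of_norm_le ((integrable_cauchyPoint hm).mul_const _)
    (Eventually.of_forall fun p => abs_cauchyPoint_mul_le m p φ)

lemma cauchyPoint_mul_resolventFn {m a : ℝ} (hm : 0 < m) (ha : 0 ≤ a) (p : ℝ) :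
    (cauchyPoint m p : ℝ) * resolventFn a (cauchyPoint m p)
      = (1 + a)⁻¹ * (cauchyPoint (m * √(1 + a)) p : ℝ) := by
  have hs : √(1 + a) ^ 2 = 1 + a := Real.sq_sqrt (by linarith)
  have h1 : 0 < 1 + a := by linarith
  have h2 : 0 < p ^ 2 + m ^ 2 := by positivity
  have h3 : 0 < p ^ 2 + m ^ 2 + a * m ^ 2 := by positivity
  simp only [cauchyPoint, resolventFn, ContinuousMap.coe_mk, abs_of_nonneg ha, mul_pow, hs]
  have e1 : 1 + a * (m ^ 2 / (p ^ 2 + m ^ 2)) = (p ^ 2 + m ^ 2 + a * m ^ 2) / (p ^ 2 + m ^ 2) := by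
    field_simp
  have e2 : p ^ 2 + m ^ 2 * (1 + a) = p ^ 2 + m ^ 2 + a * m ^ 2 := by ring
  rw [e1, e2]
  field_simp

lemma uniformFunctional_resolventFn {m a : ℝ} (hm : 0 < m) (ha : 0 ≤ a) :
    uniformFunctional hm (resolventFn a) = (1 + a)⁻¹ * (m * √(1 + a)) * (1 / 4) := by
  have hs : 0 < √(1 + a) := Real.sqrt_pos.2 (by linarith)
  have hpi := Real.pi_pos
  rw [uniformFunctional_apply]
  simp_rw [cauchyPoint_mul_resolventFn hm ha]
  rw [integral_const_mul, integral_cauchyPoint (by positivity)]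
  field_simp

namespace SimplyRealRooted

variable {F : ℂ → ℂ}

lemma hasSum_cauchyPoint (hF : SimplyRealRooted F) {m l : ℝ} (hm : 0 < m) (hl : 0 < l) (x₀ : ℝ) :
    HasSum (fun x : realZeros F => (cauchyPoint m ((x - x₀) / l) : ℝ))
      (m * l * -(logDeriv F (x₀ + (m * l : ℝ) * Complex.I)).im) := by
  have h := (hF.hasSum_poisson (z := x₀ + (m * l : ℝ) * Complex.I)
    (by simpa using mul_pos hm hl)).mul_left (m * l)
  refine h.congr_fun fun x => ?_
  simp [cauchyPoint]
  field_simp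

lemma summable_cauchyPoint_mul (hF : SimplyRealRooted F) {m l : ℝ} (hm : 0 < m) (hl : 0 < l)
    (x₀ : ℝ) (φ : C(Icc (0 : ℝ) 1, ℝ)) :
    Summable fun x : realZeros F =>
      (cauchyPoint m ((x - x₀) / l) : ℝ) * φ (cauchyPoint m ((x - x₀) / l)) :=
  Summable.of_norm_bounded ((hF.hasSum_cauchyPoint hm hl x₀).summable.mul_right ‖φ‖) fun _ =>
    abs_cauchyPoint_mul_le m _ φ

/-- The functional given by summation over the zeros, rescaled by `l` about `x₀`. -/
def zeroFunctional (hF : SimplyRealRooted F) {m l : ℝ} (hm : 0 < m) (hl : 0 < l) (x₀ : ℝ) :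
    C(Icc (0 : ℝ) 1, ℝ) →ₗ[ℝ] ℝ where
  toFun φ := 1 / l ^ 2 * ∑' x : realZeros F,
    (cauchyPoint m ((x - x₀) / l) : ℝ) * φ (cauchyPoint m ((x - x₀) / l))
  map_add' φ ψ := by
    simp only [ContinuousMap.add_apply, mul_add]
    rw [(hF.summable_cauchyPoint_mul hm hl x₀ φ).tsum_add (hF.summable_cauchyPoint_mul hm hl x₀ ψ),
      mul_add]
  map_smul' c φ := by
    simp only [ContinuousMap.smul_apply, smul_eq_mul, RingHom.id_apply]
    simp_rw [mul_left_comm _ c]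
    rw [tsum_mul_left]
    ring

lemma zeroFunctional_apply (hF : SimplyRealRooted F) {m l : ℝ} (hm : 0 < m) (hl : 0 < l) (x₀ : ℝ)
    (φ : C(Icc (0 : ℝ) 1, ℝ)) : hF.zeroFunctional hm hl x₀ φ = 1 / l ^ 2 * ∑' x : realZeros F,
      (cauchyPoint m ((x - x₀) / l) : ℝ) * φ (cauchyPoint m ((x - x₀) / l)) := rfl

lemma abs_zeroFunctional_le (hF : SimplyRealRooted F) {m l : ℝ} (hm : 0 < m) (hl : 0 < l) (x₀ : ℝ)
    (φ : C(Icc (0 : ℝ) 1, ℝ)) :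
    |hF.zeroFunctional hm hl x₀ φ| ≤ hF.zeroFunctional hm hl x₀ 1 * ‖φ‖ := by
  simp only [zeroFunctional_apply, ContinuousMap.one_apply, mul_one]
  rw [abs_mul, abs_of_pos (by positivity), mul_assoc, ← tsum_mul_right]
  gcongr
  rw [← Real.norm_eq_abs]
  exact tsum_of_norm_bounded ((hF.hasSum_cauchyPoint hm hl x₀).summable.mul_right ‖φ‖).hasSum
    fun x => abs_cauchyPoint_mul_le m _ φ

/-- On the functions `1 / (1 + a q)` the functional is a Poisson sum at height `m √(1 + a) l`. -/
lemma zeroFunctional_resolventFn (hF : SimplyRealRooted F) {m l a : ℝ} (hm : 0 < m) (hl : 0 < l)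
    (x₀ : ℝ) (ha : 0 ≤ a) : hF.zeroFunctional hm hl x₀ (resolventFn a)
      = (1 + a)⁻¹ * (m * √(1 + a))
        * (-(logDeriv F (x₀ + (m * √(1 + a) * l : ℝ) * Complex.I)).im / l) := by
  have hs : 0 < √(1 + a) := Real.sqrt_pos.2 (by linarith)
  rw [zeroFunctional_apply]
  simp_rw [cauchyPoint_mul_resolventFn hm ha]
  rw [tsum_mul_left, (hF.hasSum_cauchyPoint (by positivity) hl x₀).tsum_eq]
  field_simp

end SimplyRealRooted

lemma cauchyPoint_pos {m : ℝ} (hm : 0 < m) (r : ℝ) : 0 < (cauchyPoint m r : ℝ) := by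
  simp only [cauchyPoint]
  positivity

lemma cauchyPoint_le_iff {m : ℝ} (hm : 0 < m) (r p : ℝ) :
    (cauchyPoint m r : ℝ) ≤ cauchyPoint m p ↔ |p| ≤ |r| := by
  simp only [cauchyPoint]
  rw [div_le_div_iff_of_pos_left (by positivity) (by positivity) (by positivity),
    add_le_add_iff_right, sq_le_sq]

/-- A continuous function which, multiplied by the coordinate, is a trapezoid: it is `1` at
distance at most `r` and `0` at distance at least `s`. The maximum in the denominator only matters
where the numerator vanishes. -/
def trapezoid {m : ℝ} (hm : 0 < m) (r s : ℝ) : C(Icc (0 : ℝ) 1, ℝ) where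
  toFun q := max 0 (min 1 (((q : ℝ) - cauchyPoint m s) / (cauchyPoint m r - cauchyPoint m s)))
    / max (q : ℝ) (cauchyPoint m s : ℝ)
  continuous_toFun := by
    refine Continuous.div (by fun_prop) (by fun_prop) fun q => ?_
    exact (lt_max_of_lt_right (cauchyPoint_pos hm s)).ne'

open Classical in
lemma trapezoid_bounds {m r s : ℝ} (hm : 0 < m) (hr : 0 ≤ r) (hrs : r < s) (p : ℝ) :
    (if p ∈ Icc (-r) r then 1 else 0) ≤ (cauchyPoint m p : ℝ) * trapezoid hm r s (cauchyPoint m p) ∧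
    (cauchyPoint m p : ℝ) * trapezoid hm r s (cauchyPoint m p)
      ≤ (if p ∈ Icc (-s) s then 1 else 0) := by
  have hq := cauchyPoint_pos hm p
  have hqs := cauchyPoint_pos hm s
  have hlt : (cauchyPoint m s : ℝ) < cauchyPoint m r := by
    rw [← not_le, cauchyPoint_le_iff hm, abs_of_nonneg hr, abs_of_pos (hr.trans_lt hrs)]
    exact not_le.2 hrs
  set χ := max 0 (min 1 (((cauchyPoint m p : ℝ) - cauchyPoint m s)
    / (cauchyPoint m r - cauchyPoint m s))) with hχ
  have hχ0 : 0 ≤ χ := le_max_left _ _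
  have hχ1 : χ ≤ 1 := max_le zero_le_one (min_le_left _ _)
  have hs : p ∈ Icc (-s) s ↔ (cauchyPoint m s : ℝ) ≤ cauchyPoint m p := by
    rw [cauchyPoint_le_iff hm, abs_of_pos (hr.trans_lt hrs), abs_le, mem_Icc]
  have hr' : p ∈ Icc (-r) r ↔ (cauchyPoint m r : ℝ) ≤ cauchyPoint m p := by
    rw [cauchyPoint_le_iff hm, abs_of_nonneg hr, abs_le, mem_Icc]
  have e : (cauchyPoint m p : ℝ) * trapezoid hm r s (cauchyPoint m p) = χ := by
    simp only [trapezoid, ContinuousMap.coe_mk]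
    rw [← hχ]
    rcases le_or_gt (cauchyPoint m s : ℝ) (cauchyPoint m p) with h | h
    · rw [max_eq_left h]
      field_simp
    · have : χ = 0 := by
        rw [hχ]
        refine max_eq_left ((min_le_right _ _).trans ?_)
        exact div_nonpos_of_nonpos_of_nonneg (by linarith) (by linarith)
      rw [this, zero_div, mul_zero]
  rw [e]
  constructor
  · split_ifs with h
    · rw [hr'] at h
      rw [hχ]
      refine le_max_of_le_right (le_min le_rfl ?_)
      rw [le_div_iff₀ (by linarith)]
      linarith
    · exact hχ0
  · split_ifs with h
    · exact hχ1
    · rw [hs, not_le] at h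
      rw [hχ]
      refine max_le le_rfl ((min_le_right _ _).trans ?_)
      exact div_nonpos_of_nonpos_of_nonneg (by linarith) (by linarith)

lemma uniformFunctional_trapezoid_bounds {m r s : ℝ} (hm : 0 < m) (hr : 0 ≤ r) (hrs : r < s) :
    r / (2 * Real.pi) ≤ uniformFunctional hm (trapezoid hm r s) ∧
      uniformFunctional hm (trapezoid hm r s) ≤ s / (2 * Real.pi) := by
  classical
  have hpi := Real.pi_pos
  have hind : ∀ c : ℝ, 0 ≤ c → Integrable (fun p : ℝ => if p ∈ Icc (-c) c then (1 : ℝ) else 0) ∧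
      ∫ p : ℝ, (if p ∈ Icc (-c) c then (1 : ℝ) else 0) = 2 * c := by
    intro c hc
    have e : (fun p : ℝ => if p ∈ Icc (-c) c then (1 : ℝ) else 0)
        = (Icc (-c) c).indicator fun _ => 1 := by
      ext p
      simp [Set.indicator_apply]
    rw [e]
    refine ⟨(integrable_indicator_iff measurableSet_Icc).2
      (integrableOn_const (by simp)), ?_⟩
    rw [integral_indicator_const _ measurableSet_Icc, Real.volume_real_Icc_of_le (by linarith)]
    simp
    ring
  have hi := integrable_cauchyPoint_mul hm (trapezoid hm r s)
  rw [uniformFunctional_apply]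
  constructor
  · have h := integral_mono (hind r hr).1 hi fun p => (trapezoid_bounds hm hr hrs p).1
    rw [(hind r hr).2] at h
    calc r / (2 * Real.pi) = 1 / (4 * Real.pi) * (2 * r) := by field_simp; ring
      _ ≤ _ := by gcongr
  · have h := integral_mono hi (hind s (hr.trans hrs.le)).1 fun p =>
      (trapezoid_bounds hm hr hrs p).2
    rw [(hind s (hr.trans hrs.le)).2] at h
    calc _ ≤ 1 / (4 * Real.pi) * (2 * s) := by gcongr
      _ = s / (2 * Real.pi) := by field_simp; ring

lemma SimplyRealRooted.zeroFunctional_trapezoid_bounds {F : ℂ → ℂ} (hF : SimplyRealRooted F)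
    {m l r s : ℝ} (hm : 0 < m) (hl : 0 < l) (x₀ : ℝ) (hr : 0 ≤ r) (hrs : r < s) :
    ({x : ℝ | x ∈ Icc (x₀ - r * l) (x₀ + r * l) ∧ F x = 0}.ncard : ℝ) / l ^ 2
        ≤ hF.zeroFunctional hm hl x₀ (trapezoid hm r s) ∧
      hF.zeroFunctional hm hl x₀ (trapezoid hm r s)
        ≤ ({x : ℝ | x ∈ Icc (x₀ - s * l) (x₀ + s * l) ∧ F x = 0}.ncard : ℝ) / l ^ 2 := by
  classical
  have hmem : ∀ c x : ℝ, (x - x₀) / l ∈ Icc (-c) c ↔ x ∈ Icc (x₀ - c * l) (x₀ + c * l) := by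
    intro c x
    simp only [mem_Icc]
    rw [le_div_iff₀ hl, div_le_iff₀ hl]
    constructor <;> rintro ⟨h1, h2⟩ <;> constructor <;> linarith
  have hs := (hF.summable_cauchyPoint_mul hm hl x₀ (trapezoid hm r s)).hasSum
  have h1 := hF.hasSum_indicator_Icc (x₀ - r * l) (x₀ + r * l) 1
  have h2 := hF.hasSum_indicator_Icc (x₀ - s * l) (x₀ + s * l) 1
  rw [one_mul] at h1 h2
  rw [zeroFunctional_apply, one_div_mul_eq_div]
  constructor
  · refine div_le_div_of_nonneg_right (hasSum_le (fun x => ?_) h1 hs) (sq_nonneg l)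
    have := (trapezoid_bounds hm hr hrs (((x : ℝ) - x₀) / l)).1
    simpa only [hmem] using this
  · refine div_le_div_of_nonneg_right (hasSum_le (fun x => ?_) hs h2) (sq_nonneg l)
    have := (trapezoid_bounds hm hr hrs (((x : ℝ) - x₀) / l)).2
    simpa only [hmem] using this

/-! ### Zeros in intervals of logarithmic length -/

lemma tendsto_logPlus : Tendsto logPlus atTop atTop :=
  Real.tendsto_log_atTop.comp (tendsto_atTop_add_const_left _ _ tendsto_abs_atTop_atTop)

/-- The filter of heights tending to infinity, uniformly in the admissible times. -/
def uniformAtTop : Filter (Ioc Lam 0 × ℝ) := comap Prod.snd atTop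

/-- The Poisson sums over the zeros of `H_t` about `T + β log₊ T`, at height `m log₊ T`. -/
lemma tendsto_neg_im_logDeriv_div {β : ℝ} (hβ : 0 ≤ β) : ∃ m₀ : ℝ, 100 ≤ m₀ ∧ ∀ m, m₀ ≤ m →
    Tendsto (fun i : Ioc Lam 0 × ℝ => -(logDeriv (H i.1) (((i.2 + β * logPlus i.2 : ℝ) : ℂ)
      + (m * logPlus i.2 : ℝ) * Complex.I)).im / logPlus i.2) uniformAtTop (𝓝 (1 / 4)) := by
  obtain ⟨A, C, hA, hC, h⟩ := exists_abs_im_logDeriv_H_sub_le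
  obtain ⟨m₀, hm₀, hm⟩ := exists_forall_mul_log_le hA hβ
  refine ⟨m₀, hm₀, fun m hmm => ?_⟩
  have hmA := hm m hmm
  have hm0 : 0 < m := by linarith
  have hpi := Real.pi_gt_three
  set D := 2 * C + 1 / 4 * (Real.log (1 + (β + m)) + Real.log 2 + Real.log (4 * Real.pi))
  have hb : ∀ T : ℝ, 2 ≤ T → ∀ t : ℝ, Lam < t → t ≤ 0 →
      |-(logDeriv (H t) (((T + β * logPlus T : ℝ) : ℂ) + (m * logPlus T : ℝ) * Complex.I)).im
        - 1 / 4 * logPlus T| ≤ D := by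
    intro T hT t ht ht0
    have hl := half_le_logPlus (T := T)
    set l := logPlus T with hl_def
    set z : ℂ := ((T + β * l : ℝ) : ℂ) + (m * l : ℝ) * Complex.I with hz
    have hx0 : T ≤ T + β * l := by nlinarith
    have hn1 : ‖z‖ ≤ T + (β + m) * l := by
      refine (norm_add_le _ _).trans ?_
      rw [norm_mul, Complex.norm_I, mul_one, Complex.norm_real, Complex.norm_real,
        Real.norm_of_nonneg (by linarith), Real.norm_of_nonneg (by positivity)]
      linarith
    have hn2 : T ≤ ‖z‖ := by
      have := (le_abs_self _).trans (Complex.abs_re_le_norm z)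
      have e : z.re = T + β * l := by simp [hz]
      linarith
    have him : z.im = m * l := by simp [hz]
    have hreg : A * Real.log (2 + ‖z‖) ≤ z.im := by
      rw [him]
      calc _ ≤ A * ((1 + 2 * Real.log (1 + (β + m))) * l) := by
            gcongr
            exact log_two_add_le_mul (by linarith) (by linarith) (norm_nonneg _) hn1
        _ = A * (1 + 2 * Real.log (1 + (β + m))) * l := by ring
        _ ≤ m * l := by gcongr
    have h1 := (h t ht ht0 z hreg).1
    have hz0 : 0 < ‖z‖ := by linarith
    have h2 : C * (Real.log (2 + ‖z‖) / ‖z‖) ≤ 2 * C := by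
      have h3 : Real.log (2 + ‖z‖) / ‖z‖ ≤ 2 := by
        rw [div_le_iff₀ hz0]
        have := Real.log_le_sub_one_of_pos (by linarith : 0 < 2 + ‖z‖)
        linarith
      nlinarith
    have h3 : Real.log ‖z‖ ≤ l + Real.log (1 + (β + m)) :=
      (Real.log_le_log hz0 (by linarith)).trans
        (log_two_add_le (by linarith) (by linarith) (norm_nonneg _) hn1)
    have h4 : l ≤ Real.log ‖z‖ + Real.log 2 := by
      rw [hl_def, logPlus_of_nonneg (by linarith), ← Real.log_mul hz0.ne' two_ne_zero]
      exact Real.log_le_log (by linarith) (by linarith)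
    rw [Real.log_div hz0.ne' (by positivity)] at h1
    have p1 := Real.log_nonneg (by linarith : 1 ≤ 1 + (β + m))
    have p2 := Real.log_nonneg (by norm_num : (1 : ℝ) ≤ 2)
    have p3 := Real.log_nonneg (by linarith : 1 ≤ 4 * Real.pi)
    have h5 := abs_le.1 (h1.trans h2)
    rw [abs_le]
    simp only [D]
    constructor <;> linarith
  have hsnd : Tendsto (fun i : Ioc Lam 0 × ℝ => i.2) uniformAtTop atTop := tendsto_comap
  have hlim : Tendsto (fun i : Ioc Lam 0 × ℝ => D / logPlus i.2) uniformAtTop (𝓝 0) :=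
    (tendsto_logPlus.comp hsnd).const_div_atTop D
  rw [tendsto_iff_dist_tendsto_zero]
  refine squeeze_zero' (Eventually.of_forall fun _ => dist_nonneg) ?_ hlim
  filter_upwards [hsnd.eventually_ge_atTop 2] with i hi
  have hl := half_le_logPlus (T := i.2)
  have hl0 : 0 < logPlus i.2 := by linarith
  have := hb i.2 hi i.1 i.1.2.1 i.1.2.2
  rw [Real.dist_eq, le_div_iff₀ hl0, ← abs_of_pos hl0, ← abs_mul, abs_of_pos hl0]
  refine le_trans (le_of_eq ?_) this
  congr 1
  field_simp

/-- Uniform asymptotics for the number of zeros in an interval of fixed logarithmic length. -/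
lemma tendsto_N_div (hLam : Lam < 0) {α : ℝ} (hα : 0 < α) :
    Tendsto (fun i : Ioc Lam 0 × ℝ =>
      (N i.1 (Icc i.2 (i.2 + α * logPlus i.2)) : ℝ) / logPlus i.2 ^ 2) uniformAtTop
      (𝓝 (α / (4 * Real.pi))) := by
  obtain ⟨m, hm100, hm⟩ := tendsto_neg_im_logDeriv_div (half_pos hα).le
  have hm0 : 0 < m := by linarith
  have hpi := Real.pi_pos
  have hl0 : ∀ T, 0 < logPlus T := fun T => by linarith [half_le_logPlus (T := T)]
  have hF : ∀ i : Ioc Lam 0 × ℝ, SimplyRealRooted (H i.1) := fun i =>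
    simplyRealRooted_H hLam i.1.2.1
  set M : Ioc Lam 0 × ℝ → C(Icc (0 : ℝ) 1, ℝ) →ₗ[ℝ] ℝ := fun i =>
    (hF i).zeroFunctional hm0 (hl0 i.2) (i.2 + α / 2 * logPlus i.2)
  have hres : ∀ a, 0 ≤ a → Tendsto (fun i => M i (resolventFn a)) uniformAtTop
      (𝓝 (uniformFunctional hm0 (resolventFn a))) := by
    intro a ha
    rw [uniformFunctional_resolventFn hm0 ha]
    simp only [M, (hF _).zeroFunctional_resolventFn hm0 (hl0 _) _ ha]
    refine (hm (m * √(1 + a)) ?_).const_mul _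
    exact le_mul_of_one_le_right hm0.le (Real.one_le_sqrt.2 (by linarith))
  have hone : resolventFn 0 = 1 := by
    ext q
    simp [resolventFn]
  have hconv : ∀ φ, Tendsto (fun i => M i φ) uniformAtTop (𝓝 (uniformFunctional hm0 φ)) := by
    refine tendsto_of_tendsto_resolventFn (B := uniformFunctional hm0 1 + 1) ?_ (fun φ => ?_) hres
    · have h1 := hres 0 le_rfl
      rw [hone] at h1
      filter_upwards [h1.eventually_le_const (lt_add_one _)] with i hi φ
      exact ((hF i).abs_zeroFunctional_le hm0 (hl0 i.2) _ φ).trans (by gcongr)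
    · exact (abs_uniformFunctional_le hm0 φ).trans (by gcongr; linarith)
  have hN : ∀ i : Ioc Lam 0 × ℝ, (N i.1 (Icc i.2 (i.2 + α * logPlus i.2)) : ℝ)
      = ({x : ℝ | x ∈ Icc (i.2 + α / 2 * logPlus i.2 - α / 2 * logPlus i.2)
        (i.2 + α / 2 * logPlus i.2 + α / 2 * logPlus i.2) ∧ H i.1 x = 0}.ncard : ℝ) := by
    intro i
    rw [add_sub_cancel_right, add_assoc, ← add_mul, add_halves]
    rfl
  rw [tendsto_order]
  constructor
  · intro b hb
    rw [lt_div_iff₀ (by positivity)] at hb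
    -- a trapezoid supported in the interval, of almost full mass
    set r := max 0 ((b * (4 * Real.pi) + α) / 2 / 2) with hr
    have hr0 : 0 ≤ r := le_max_left _ _
    have hrs : r < α / 2 := max_lt (by positivity) (by linarith)
    have hbr : b < r / (2 * Real.pi) := by
      rw [lt_div_iff₀ (by positivity)]
      have := le_max_right 0 ((b * (4 * Real.pi) + α) / 2 / 2)
      rw [← hr] at this
      linarith
    have h1 := (uniformFunctional_trapezoid_bounds hm0 hr0 hrs).1
    filter_upwards [(hconv (trapezoid hm0 r (α / 2))).eventually_const_lt (hbr.trans_le h1)]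
      with i hi
    rw [hN]
    exact hi.trans_le ((hF i).zeroFunctional_trapezoid_bounds hm0 (hl0 i.2) _ hr0 hrs).2
  · intro b hb
    rw [gt_iff_lt, div_lt_iff₀ (by positivity)] at hb
    -- a trapezoid equal to one on the interval, of barely larger mass
    set s := (b * (4 * Real.pi) + α) / 2 / 2 with hs
    have hrs : α / 2 < s := by linarith
    have hbs : s / (2 * Real.pi) < b := by
      rw [div_lt_iff₀ (by positivity)]
      linarith
    have h1 := (uniformFunctional_trapezoid_bounds hm0 (half_pos hα).le hrs).2
    filter_upwards [(hconv (trapezoid hm0 (α / 2) s)).eventually_lt_const (h1.trans_lt hbs)]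
      with i hi
    rw [hN]
    exact ((hF i).zeroFunctional_trapezoid_bounds hm0 (hl0 i.2) _ (half_pos hα).le hrs).1.trans_lt hi

lemma N_mono (hLam : Lam < 0) {t : ℝ} (ht : Lam < t) {a b a' b' : ℝ} (ha : a' ≤ a) (hb : b ≤ b') :
    N t (Icc a b) ≤ N t (Icc a' b') :=
  Set.ncard_le_ncard (fun _ hx => ⟨Icc_subset_Icc ha hb hx.1, hx.2⟩)
    ((simplyRealRooted_H hLam ht).finite_zeros_Icc a' b')

/-- The asymptotics hold uniformly in the length, by monotonicity of the count in the length. -/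
lemma eventually_forall_abs_N_sub_le (hLam : Lam < 0) (C : ℝ) {ε : ℝ} (hε : 0 < ε) :
    ∀ᶠ T in atTop, ∀ t, Lam < t → t ≤ 0 → ∀ α, 0 ≤ α → α ≤ C →
      |(N t (Icc T (T + α * logPlus T)) : ℝ) / logPlus T ^ 2 - α / (4 * Real.pi)| ≤ ε := by
  have hpi := Real.pi_gt_three
  obtain ⟨n, hn⟩ := exists_nat_gt (C / ε)
  have hgrid : ∀ k : ℕ, ∀ᶠ T in atTop, ∀ t, Lam < t → t ≤ 0 → 0 < k →
      |(N t (Icc T (T + k * ε * logPlus T)) : ℝ) / logPlus T ^ 2 - k * ε / (4 * Real.pi)|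
        ≤ ε / 2 := by
    intro k
    rcases k.eq_zero_or_pos with rfl | hk
    · exact Eventually.of_forall fun _ _ _ _ h => absurd h (lt_irrefl _)
    have hk' : (0 : ℝ) < k := by exact_mod_cast hk
    have h := Metric.tendsto_nhds.1 (tendsto_N_div hLam (α := k * ε) (by positivity)) (ε / 2)
      (by positivity)
    rw [uniformAtTop, eventually_comap] at h
    filter_upwards [h] with T hT t ht ht0 _
    exact (hT (⟨t, ht, ht0⟩, T) rfl).le
  have hall : ∀ᶠ T in atTop, ∀ k ∈ Finset.range (n + 2), ∀ t, Lam < t → t ≤ 0 → 0 < k →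
      |(N t (Icc T (T + k * ε * logPlus T)) : ℝ) / logPlus T ^ 2 - k * ε / (4 * Real.pi)|
        ≤ ε / 2 := by
    rw [Filter.eventually_all_finset]
    exact fun k _ => hgrid k
  filter_upwards [hall] with T hT t ht ht0 α hα hαC
  have hl0 : 0 < logPlus T := by linarith [half_le_logPlus (T := T)]
  set k := ⌊α / ε⌋₊ with hk
  have hk1 : k * ε ≤ α := by
    have := Nat.floor_le (div_nonneg hα hε.le)
    rwa [le_div_iff₀ hε] at this
  have hk2 : α ≤ (k + 1 : ℕ) * ε := by
    have := (Nat.lt_floor_add_one (α / ε)).le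
    rw [div_le_iff₀ hε] at this
    push_cast
    exact this
  have hkn : k ≤ n := by
    have h1 : (k : ℝ) < n := by
      refine lt_of_le_of_lt ?_ hn
      rw [le_div_iff₀ hε]
      linarith
    exact_mod_cast h1.le
  have hupper : (N t (Icc T (T + α * logPlus T)) : ℝ) / logPlus T ^ 2
      ≤ (N t (Icc T (T + (k + 1 : ℕ) * ε * logPlus T)) : ℝ) / logPlus T ^ 2 := by
    gcongr
    exact N_mono hLam ht le_rfl (by gcongr)
  have h1 := (abs_le.1 (hT (k + 1) (by simp; omega) t ht ht0 k.succ_pos)).2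
  have h2 : (k + 1 : ℕ) * ε / (4 * Real.pi) ≤ α / (4 * Real.pi) + ε / 2 := by
    rw [← sub_le_iff_le_add', ← sub_div, div_le_iff₀ (by positivity)]
    push_cast
    nlinarith
  have hlower : α / (4 * Real.pi) - ε
      ≤ (N t (Icc T (T + α * logPlus T)) : ℝ) / logPlus T ^ 2 := by
    have h3 : α / (4 * Real.pi) - ε / 2 ≤ k * ε / (4 * Real.pi) := by
      rw [sub_le_comm, ← sub_div, div_le_iff₀ (by positivity)]
      push_cast at hk2
      nlinarith
    rcases k.eq_zero_or_pos with h0 | hkp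
    · rw [h0, Nat.cast_zero, zero_mul, zero_div] at h3
      refine le_trans ?_ (by positivity : (0 : ℝ) ≤ _)
      linarith
    · have h4 := (abs_le.1 (hT k (by simp; omega) t ht ht0 hkp)).1
      have h5 : (N t (Icc T (T + k * ε * logPlus T)) : ℝ) / logPlus T ^ 2
          ≤ (N t (Icc T (T + α * logPlus T)) : ℝ) / logPlus T ^ 2 := by
        gcongr
        exact N_mono hLam ht le_rfl (by gcongr)
      linarith
  rw [abs_le]
  constructor <;> linarith

theorem exists_abs_N_sub_le (hLam : Lam < 0) {C : ℝ} (hC : 0 < C) :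
    ∃ c : ℝ → ℝ, Tendsto c atTop (𝓝 0) ∧ ∀ t : ℝ, Lam < t → t ≤ 0 → ∀ T : ℝ, 0 < T →
      ∀ α : ℝ, 0 ≤ α → α ≤ C →
        |(N t (Icc T (T + α * logPlus T)) : ℝ) - α * logPlus T ^ 2 / (4 * Real.pi)|
          ≤ c T * logPlus T ^ 2 := by
  have hpi := Real.pi_pos
  set S : ℝ → Set ℝ := fun T => {y | ∃ t α : ℝ, Lam < t ∧ t ≤ 0 ∧ 0 ≤ α ∧ α ≤ C ∧
    y = |(N t (Icc T (T + α * logPlus T)) : ℝ) / logPlus T ^ 2 - α / (4 * Real.pi)|} with hS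
  have hne : ∀ T, (S T).Nonempty := fun T => ⟨_, 0, 0, hLam, le_rfl, le_rfl, hC.le, rfl⟩
  have hbdd : ∀ T, 0 < T → BddAbove (S T) := by
    intro T hT
    have hl0 : 0 < logPlus T := by linarith [half_le_logPlus (T := T)]
    obtain ⟨K, hK⟩ := exists_abs_N_sub_Psi_le hLam
    set T' := T + C * logPlus T with hT'
    have hT'0 : 0 < T' := by positivity
    refine ⟨(|Psi T'| + K * logPlus T' ^ 2) / logPlus T ^ 2 + C / (4 * Real.pi), ?_⟩
    rintro _ ⟨t, α, ht, ht0, hα, hαC, rfl⟩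
    have h1 : (N t (Icc T (T + α * logPlus T)) : ℝ) ≤ N t (Icc 0 T') := by
      exact_mod_cast N_mono hLam ht hT.le (by rw [hT']; gcongr)
    have h2 := (abs_le.1 (hK t ht ht0 T' hT'0)).2
    have h3 := le_abs_self (Psi T')
    refine (abs_sub _ _).trans ?_
    rw [abs_of_nonneg (by positivity), abs_of_nonneg (by positivity)]
    gcongr
    linarith
  -- the supremum of the normalized errors, which is finite because of the counting formula for
  -- `[0, T']`
  refine ⟨fun T => sSup (S T), ?_, fun t ht ht0 T hT α hα hαC => ?_⟩
  · rw [Metric.tendsto_nhds]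
    intro ε hε
    filter_upwards [eventually_forall_abs_N_sub_le hLam C (half_pos hε)] with T hT
    have h1 : sSup (S T) ≤ ε / 2 := csSup_le (hne T) (by
      rintro _ ⟨t, α, ht, ht0, hα, hαC, rfl⟩
      exact hT t ht ht0 α hα hαC)
    have h2 : 0 ≤ sSup (S T) := Real.sSup_nonneg (by
      rintro _ ⟨t, α, ht, ht0, hα, hαC, rfl⟩
      exact abs_nonneg _)
    rw [Real.dist_eq, sub_zero, abs_of_nonneg h2]
    linarith
  · have hl0 : 0 < logPlus T := by linarith [half_le_logPlus (T := T)]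
    have h := le_csSup (hbdd T hT) ⟨t, α, ht, ht0, hα, hαC, rfl⟩
    have e : (N t (Icc T (T + α * logPlus T)) : ℝ) - α * logPlus T ^ 2 / (4 * Real.pi)
        = ((N t (Icc T (T + α * logPlus T)) : ℝ) / logPlus T ^ 2 - α / (4 * Real.pi))
          * logPlus T ^ 2 := by
      field_simp
    rw [e, abs_mul, abs_of_pos (pow_pos hl0 2)]
    gcongr

end DeBruijnNewman

end

theorem theorem3p2 (_hLam : DeBruijnNewman.Lam < 0) :
    (∃ K : ℝ, ∀ t : ℝ, DeBruijnNewman.Lam < t → t ≤ 0 → ∀ T : ℝ, 0 < T →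
      (DeBruijnNewman.zerosIn t (Set.Icc 0 T)).Finite ∧
      |(DeBruijnNewman.N t (Set.Icc 0 T) : ℝ) - DeBruijnNewman.Psi T|
        ≤ K * DeBruijnNewman.logPlus T ^ 2) ∧
    (∀ C : ℝ, 0 < C → ∃ c : ℝ → ℝ, Tendsto c atTop (𝓝 0) ∧
      ∀ t : ℝ, DeBruijnNewman.Lam < t → t ≤ 0 → ∀ T : ℝ, 0 < T →
        ∀ α : ℝ, 0 ≤ α → α ≤ C →
          |(DeBruijnNewman.N t (Set.Icc T (T + α * DeBruijnNewman.logPlus T)) : ℝ)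
              - α * DeBruijnNewman.logPlus T ^ 2 / (4 * Real.pi)|
            ≤ c T * DeBruijnNewman.logPlus T ^ 2) := by
  refine ⟨?_, fun C hC => DeBruijnNewman.exists_abs_N_sub_le _hLam hC⟩
  obtain ⟨K, hK⟩ := DeBruijnNewman.exists_abs_N_sub_Psi_le _hLam
  exact ⟨K, fun t ht ht0 T hT =>
    ⟨(DeBruijnNewman.simplyRealRooted_H _hLam ht).finite_zeros_Icc 0 T, hK t ht ht0 T hT⟩⟩
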